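/- Notation. Let $B^4\subset\mathbb C^2$ be the closed unit ball and $S^3$ its boundary. For coprime integers $p,q$ let $T(p,q)\subset S^3$ be the torus knot $\{\tfrac1{\sqrt2}(e^{ip\theta},e^{iq\theta}):\theta\in\mathbb R\}$. For a knot $K\subset S^3$, let $\gamma_4(K)$ (the nonorientable smooth 4-genus) be the smallest first Betti number of a connected nonorientable surface smoothly and properly embedded in $B^4$ with boundary $K$. A pinch move on $T(p,q)$ (with $p,q>0$ coprime) is the nonorientable band move along a band on the torus between two neighbouring strands; up to orientation it produces the torus knot $T(r,s)$ with $(r,s)=(|p-2t|,|q-2h|)$, where $t\in\{0,\dots,p-1\}$, $t\equiv -q^{-1}\pmod p$, and $h\in\{0,\dots,q-1\}$, $h\equiv p^{-1}\pmod q$. Let $p,q>1$ be coprime with $q$ odd, and with $p>q$ if $p$ is also odd. Let $F_{p,q}\subset B^4$ be the surface with boundary $T(p,q)$ obtained by applying to $T(p,q)$ the minimum number of successive pinch moves that results in an unknot $T(p_0,1)$, $p_0\ge 0$, gluing a disk to the resulting cobordism along $T(p_0,1)$, and pushing the interior of the surface into $B^4$. Proposition. (1) For $p,q>1$ coprime with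 $q$ odd, and with $p>q$ if $p$ is also odd, the surface $F_{p,q}$ is a Möbius band if and only if $T(p,q)$ agrees, up to an isometry of $S^3$ (orientation-reversing ones, that is, passing to the mirror image, being allowed), with $T(am\pm 2,a)$ for some odd integer $a\ge 3$, some integer $m\ge 0$ and some choice of the sign. (2) For every odd integer $q\ge 3$, every integer $m\ge 0$ and either sign, $\gamma_4(T(qm\pm 2,q))=1$. -/

import Mathlib

open scoped ContDiff

noncomputable section

namespace TorusKnotMobius

/-! ### The 4-ball, torus knots -/

/-- `ℂ² = ℝ⁴` with its Euclidean norm. The 4-ball is its closed unit ball, `S³` its unit sphere. -/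
abbrev C2 : Type := EuclideanSpace ℂ (Fin 2)

/-- The closed unit ball `B⁴`. -/
def B4 : Set C2 := Metric.closedBall 0 1

/-- The unit sphere `S³ = ∂B⁴`. -/
def S3 : Set C2 := Metric.sphere 0 1

/-- The point with angular coordinates `(x, y)` (measured in full turns) on the Clifford torus
`|z| = |w| = ρ / √2` of the sphere of radius `ρ`. -/
def torusPoint (ρ x y : ℝ) : C2 :=
  !₂[((ρ / √2 : ℝ) : ℂ) * Complex.exp ((2 * Real.pi * x : ℝ) * Complex.I),
     ((ρ / √2 : ℝ) : ℂ) * Complex.exp ((2 * Real.pi * y : ℝ) * Complex.I)]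

/-- The torus knot `T(p,q)`: the curve of slope `p/q` on the standard torus in `S³`.
(It is a knot when `p` and `q` are coprime.) -/
def torusKnot (p q : ℤ) : Set C2 :=
  Set.range fun θ : ℝ => torusPoint 1 (p * θ) (q * θ)

/-- Two curves in `S³` agree up to an isometry of `S³` (that is, an orthogonal transformation of
`ℝ⁴ = ℂ²`). Isometries that reverse the orientation are allowed, so that a knot agrees with
its mirror image. For torus knots this contains `T(p,q) = T(q,p) = T(-p,-q)` and
`T(-p,q)` = mirror image of `T(p,q)`. -/
def SameUpToMirror (K L : Set C2) : Prop :=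
  ∃ g : C2 ≃ₗᵢ[ℝ] C2, g '' K = L

/-! ### Pinch moves and the surface `F_{p,q}` -/

/-- The parameters `(|p - 2t|, |q - 2h|)` of the torus knot produced from `T(p,q)` by a pinch move,
where `t ≡ -q⁻¹ (mod p)`, `0 ≤ t < p` and `h ≡ p⁻¹ (mod q)`, `0 ≤ h < q`. -/
def pinch (c : ℕ × ℕ) : ℕ × ℕ :=
  (((c.1 : ℤ) - 2 * ((-(c.2 : ZMod c.1)⁻¹ : ZMod c.1).val : ℤ)).natAbs,
   ((c.2 : ℤ) - 2 * (((c.1 : ZMod c.2)⁻¹ : ZMod c.2).val : ℤ)).natAbs)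

/-- The parameters after `k` pinch moves on `T(p,q)`. -/
def pinchIter (p q k : ℕ) : ℕ × ℕ := pinch^[k] (p, q)

/-- The minimum number of pinch moves after which `T(p,q)` has become an unknot `T(p₀,1)`. -/
def pinchNumber (p q : ℕ) : ℕ := sInf {n | (pinchIter p q n).2 = 1}

/-- A function of the angular coordinates `(x, y)`. For `c = (p,q)`, `c' = (r,s)` with
`p ≡ r`, `q ≡ s (mod 2)` it is defined up to sign on the torus, so that its zero set is a curve on
the torus. For `l = 0` the zero set is `q x - p y ∈ ℤ`, the curve `T(p,q)`; for `l = 1` it is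
`T(r,s)`.

If `(r,s) = pinch (p,q)`, so that `r q - s p = ±2`, the zero sets for `l` from `0` to `1` are a movie
of the pinch move: the zero is regular except for `l = 1/2`, so the curve moves by isotopy on the
torus for `l < 1/2` and for `l > 1/2`, while at `l = 1/2` it is the union of two closed curves of
classes `((p ± r)/2, (q ± s)/2)` that cross in exactly one point, a nondegenerate saddle: there two
neighbouring strands of `T(p,q)` have come together across the annulus which is the
complement of `T(p,q)` in the torus, and they get reconnected (the band of the pinch move being the
band between these two strands). -/
def pinchMovie (c c' : ℕ × ℕ) (l x y : ℝ) : ℝ :=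
  (1 - l) * Real.sin (Real.pi * (c.2 * x - c.1 * y)) +
    l * Real.sin (Real.pi * (c'.2 * x - c'.1 * y))

/-- The cobordism of one pinch move from `T(c)` to `T(c')`, pushed into the ball: the time
`u ∈ [0,1]` of the movie is placed on the sphere of radius `(1 - u) a + u b`. The time change
`Real.smoothTransition` makes the movie stationary to infinite order at both ends, so
that consecutive cobordisms fit together smoothly. -/
def pinchCobordism (c c' : ℕ × ℕ) (a b : ℝ) : Set C2 :=
  {P | ∃ u x y : ℝ, u ∈ Set.Icc 0 1 ∧ pinchMovie c c' (Real.smoothTransition u) x y = 0 ∧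
    P = torusPoint ((1 - u) * a + u * b) x y}

/-- A disk in the ball of radius `1/2` whose boundary is the unknot `T(m,1)` on the sphere of radius
`1/2`. In suitable coordinates it is the graph of `z = w ^ m` for `|w| ≤ 1`, except that `|z|` is
modified as a function of `|w|`, so that the disk continues smoothly by the cone over `T(m,1)`. -/
def unknotDisk (m : ℕ) : Set C2 :=
  {P | ∃ r y : ℝ, r ∈ Set.Icc 0 1 ∧
    P = !₂[(((1 / 2) / √2 * ((1 - Real.smoothTransition r) * r ^ m + Real.smoothTransition r * r)
              : ℝ) : ℂ) * Complex.exp ((2 * Real.pi * (m * y) : ℝ) * Complex.I),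
           (((1 / 2) / √2 * r : ℝ) : ℂ) * Complex.exp ((2 * Real.pi * y : ℝ) * Complex.I)]}

/-- The surface `F_{p,q} ⊆ B⁴` with boundary `T(p,q)`: the cobordisms of the `n = pinchNumber p q`
pinch moves `T(p,q) = T(c₀) → T(c₁) → ⋯ → T(cₙ) = T(p₀,1)`, one after the other in the shells of
radius from `1 - k/(2n)` to `1 - (k+1)/(2n)`, together with a disk bounded by `T(p₀,1)`. -/
def pinchSurface (p q : ℕ) : Set C2 :=
  (⋃ k ∈ Set.Iio (pinchNumber p q),
    pinchCobordism (pinchIter p q k) (pinchIter p q (k + 1))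
      (1 - (k : ℝ) / (2 * (pinchNumber p q : ℝ)))
      (1 - ((k : ℝ) + 1) / (2 * (pinchNumber p q : ℝ)))) ∪
  unknotDisk (pinchIter p q (pinchNumber p q)).1

/-! ### Möbius bands -/

/-- The Möbius band: `[0,1] × [0,1]` with `(0, y)` glued to `(1, 1 - y)`. -/
def MobiusBand : Type :=
  Quot fun a b : unitInterval × unitInterval =>
    a.1 = 0 ∧ b.1 = 1 ∧ b.2 = unitInterval.symm a.2

instance : TopologicalSpace MobiusBand := inferInstanceAs (TopologicalSpace (Quot _))

/-- `S` is a Möbius band. -/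
def IsMobiusBand (S : Set C2) : Prop := Nonempty (S ≃ₜ MobiusBand)

/-! ### Smoothly and properly embedded surfaces in the 4-ball, and `γ₄` -/

/-- A smooth slice chart of the pair `(B⁴, S)`: a diffeomorphism from an open set of `ℂ²` onto an
open set of `ℝ⁴` that takes `B⁴` to the half-space `0 ≤ y₀` and `S` to the half-plane
`0 ≤ y₀`, `y₂ = y₃ = 0`. Its domain may lie in the interior of `B⁴`, the image then lies in
`0 < y₀`. -/
structure IsSliceChart (S : Set C2) (φ : OpenPartialHomeomorph C2 (Fin 4 → ℝ)) : Prop where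
  smooth : ContDiffOn ℝ ∞ φ φ.source
  smooth_symm : ContDiffOn ℝ ∞ φ.symm φ.target
  ball_iff : ∀ x ∈ φ.source, x ∈ B4 ↔ 0 ≤ φ x 0
  mem_iff : ∀ x ∈ φ.source, x ∈ S ↔ 0 ≤ φ x 0 ∧ φ x 2 = 0 ∧ φ x 3 = 0

/-- `S` is a compact connected surface, smoothly and properly embedded in `B⁴`; its boundary is
`S ∩ S³`, where it meets `S³` transversally. -/
structure IsProperSurface (S : Set C2) : Prop where
  compact : IsCompact S
  connected : IsConnected S
  subset : S ⊆ B4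
  chart : ∀ x ∈ S, ∃ φ, IsSliceChart S φ ∧ x ∈ φ.source

/-- The Jacobian determinant at `x ∈ S` of the transition from the chart `φ|S` to the chart `ψ|S`,
in the coordinates `y₀, y₁` of the surface. -/
def transitionDet (φ ψ : OpenPartialHomeomorph C2 (Fin 4 → ℝ)) (x : C2) : ℝ :=
  (Matrix.of fun i j : Fin 2 =>
    fderiv ℝ (fun y => ψ (φ.symm y)) (φ x) (Pi.single (Fin.castLE (by norm_num) j) 1)
      (Fin.castLE (by norm_num) i)).det

/-- `S` has an oriented atlas. -/
def IsOrientable (S : Set C2) : Prop :=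
  ∃ A : Set (OpenPartialHomeomorph C2 (Fin 4 → ℝ)),
    (∀ φ ∈ A, IsSliceChart S φ) ∧ (∀ x ∈ S, ∃ φ ∈ A, x ∈ φ.source) ∧
    ∀ φ ∈ A, ∀ ψ ∈ A, ∀ x ∈ S, x ∈ φ.source → x ∈ ψ.source → 0 < transitionDet φ ψ x

/-- The first Betti number, `dim H₁(X; 𝔽₂)` (singular homology). For a compact connected surface
with nonempty boundary, `H₁(X; ℤ)` is free, so this is the rank of `H₁(X; ℤ)`. -/
def bettiOne (X : Type) [TopologicalSpace X] : ℕ :=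
  Module.finrank (ZMod 2)
    (((AlgebraicTopology.singularHomologyFunctor (ModuleCat.{0} (ZMod 2)) 1).obj
      (ModuleCat.of (ZMod 2) (ZMod 2))).obj (TopCat.of X))

/-- The nonorientable smooth 4-genus of `K ⊆ S³`: the smallest first Betti number of a nonorientable
surface `S` smoothly and properly embedded in `B⁴` with `∂S = K`. -/
def gammaFour (K : Set C2) : ℕ :=
  sInf {b | ∃ S : Set C2, IsProperSurface S ∧ ¬ IsOrientable S ∧ S ∩ S3 = K ∧ b = bettiOne S}

end TorusKnotMobius

end

/-!
Arithmetic of pinch moves. The parameters satisfy `(p - 2t) q - (q - 2h) p = ±2`, the second one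
stays odd and decreases, and `F_{p,q}` is made with a single pinch move exactly if `p = qm ± 2`
(`exists_eq_of_pinchNumber_eq_one`, `pinchNumber_eq_one`). Part (1) thus says that `F_{p,q}` is a
Möbius band if and only if one pinch move suffices; which torus knots are isometric is settled by
`natAbs_eq_of_sameUpToMirror`: an isometry carries one parametrization of a torus knot to another
one up to a change of the parameter, which preserves chord lengths and hence is affine, so the
frequencies agree.

One pinch move gives a Möbius band (`isMobiusBand_pinchSurface`). In the coordinates
`A = qx - (qm ± 2)y`, `B = x - my` on the torus the movie of the pinch move is
`(1 - l) sin πA + l sin πB = 0`, modulo the lattice of integer vectors with entries of equal parity.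
A fundamental domain of its trace is an octagon, which is parametrized explicitly; together with
the disc this is a rectangle whose ends are identified with a flip.

Two or more pinch moves do not (`pinchNumber_le_one_of_isMobiusBand`). Outside of the level of the
`k`-th knot the function `q_k x - p_k y` is a map to the circle, and it extends by a constant
inside. For `k = 1, 2` the degrees of these two maps along the knots with index `0, 1` form a
triangular matrix with diagonal entries `±2`, whereas on a Möbius band, whose fundamental group is
cyclic, such a matrix is singular.

The lower bound `1 ≤ γ₄` is `one_le_bettiOne`: the orientations of the slice charts define a double
cover, hence a homomorphism from one-dimensional mod 2 homology to `ZMod 2`; if the homology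
vanishes then there is a global orientation. Because the rank of an infinite-dimensional space is
`0` by convention, the homology is also shown to have finite dimension: a compact space that is
locally a retract of a plane has finitely generated one-dimensional homology
(`finiteDimensional_ker_bdry`). The upper bound comes from the surface `smoothBand`, which is one
pinch move with a disc whose profile is smooth at its centre (and which is defined also for the
parameter `-2`). It is a Möbius band for the same reason as above, and its homology has rank at
most `1` (`MobiusCover.bettiOne_le_one`). It is a proper surface (`isProperSurface_smoothBand`)
since it is cut out of the ball by two functions with independent derivatives: away from the core
of the disc these are an equation between the moduli of the coordinates and the equation of the
movie, and at the saddle the movie has a nonzero derivative in time. It is nonorientable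
(`not_isOrientable_smoothBand`) since along the closed curve `l = 1/2`, `A = B - 1` a moving
tangent frame comes back with its orientation reversed.
-/

namespace TorusKnotMobius

/-! ### One-dimensional singular homology with mod 2 coefficients -/

section Homology

open CategoryTheory AlgebraicTopology Simplicial

variable (X : Type) [TopologicalSpace X]

/-- The singular chain complex of `X` over the field with two elements. -/
noncomputable abbrev singChains : ChainComplex (ModuleCat.{0} (ZMod 2)) ℕ :=
  ((singularChainComplexFunctor (ModuleCat.{0} (ZMod 2))).obj
      (ModuleCat.of (ZMod 2) (ZMod 2))).obj (TopCat.of X)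

variable {X} in
/-- A continuous map from the standard simplex, as a simplex of the singular simplicial set. -/
noncomputable def singSimplex (n : ℕ) (f : C(stdSimplex ℝ (Fin (n + 1)), X)) :
    (TopCat.toSSet.obj (TopCat.of X)) _⦋n⦌ :=
  ((TopCat.of X).toSSetObjEquiv (.op ⦋n⦌)).symm f

/-- The inclusion of the `i`-th face of the standard simplex. -/
noncomputable def faceMap (n : ℕ) (i : Fin (n + 2)) :
    C(stdSimplex ℝ (Fin (n + 1)), stdSimplex ℝ (Fin (n + 2))) :=
  ⟨stdSimplex.map i.succAbove, stdSimplex.continuous_map _⟩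

variable {X} in
/-- The singular chain consisting of one simplex. -/
noncomputable def chainOf (n : ℕ) (f : C(stdSimplex ℝ (Fin (n + 1)), X)) :
    (singChains X).X n :=
  ((TopCat.toSSet.obj (TopCat.of X)).ιChainComplex
    (R := ModuleCat.of (ZMod 2) (ZMod 2)) (singSimplex n f)).hom (1 : ZMod 2)

variable {X} in
lemma chains_hom_ext {n : ℕ} {M : ModuleCat.{0} (ZMod 2)} {u v : (singChains X).X n ⟶ M}
    (h : ∀ f, u.hom (chainOf n f) = v.hom (chainOf n f)) : u = v := by
  apply SSet.chainComplex_hom_ext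
  intro x
  obtain ⟨f, rfl⟩ := ((TopCat.of X).toSSetObjEquiv (.op ⦋n⦌)).symm.surjective x
  ext
  exact h f

variable {X} in
/-- The linear map on singular chains with prescribed values on the simplices. -/
noncomputable def chainDesc {n : ℕ} {M : ModuleCat.{0} (ZMod 2)}
    (w : C(stdSimplex ℝ (Fin (n + 1)), X) → M) : (singChains X).X n ⟶ M :=
  Limits.Cofan.IsColimit.desc (SSet.isColimitChainComplexXCofan _ _ n)
    (fun x =>
      ModuleCat.ofHom (LinearMap.toSpanSingleton (ZMod 2) M
      (w ((TopCat.of X).toSSetObjEquiv (.op ⦋n⦌) x))))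

variable {X} in
lemma chainDesc_chainOf {n : ℕ} {M : ModuleCat.{0} (ZMod 2)}
    (w : C(stdSimplex ℝ (Fin (n + 1)), X) → M) (f) :
    (chainDesc w).hom (chainOf n f) = w f := by
  have := Limits.Cofan.IsColimit.fac
    (SSet.isColimitChainComplexXCofan (TopCat.toSSet.obj (TopCat.of X))
      (ModuleCat.of (ZMod 2) (ZMod 2)) n) (fun x =>
      ModuleCat.ofHom (LinearMap.toSpanSingleton (ZMod 2) M
      (w ((TopCat.of X).toSSetObjEquiv (.op ⦋n⦌) x)))) (singSimplex n f)
  have h2 := congrArg (fun z => z.hom (1 : ZMod 2)) this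
  change (chainDesc w).hom (chainOf n f) = _ at h2
  rw [h2]
  simp [singSimplex]

variable {X} in
lemma d_chainOf (n : ℕ) (f : C(stdSimplex ℝ (Fin (n + 2)), X)) :
    ((singChains X).d (n + 1) n).hom (chainOf (n + 1) f) =
      ∑ i : Fin (n + 2), chainOf n (f.comp (faceMap n i)) := by
  have := (TopCat.toSSet.obj (TopCat.of X)).ιChainComplex_d
    (R := ModuleCat.of (ZMod 2) (ZMod 2)) (singSimplex (n + 1) f)
  have h2 := congrArg (fun z => z.hom (1 : ZMod 2)) this
  refine h2.trans ?_
  simp only [ModuleCat.hom_sum, LinearMap.sum_apply]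
  refine Finset.sum_congr rfl fun i _ => ?_
  have h1 : ((-1 : ℤ) ^ i.val) •
      (TopCat.toSSet.obj (TopCat.of X)).ιChainComplex (R := ModuleCat.of (ZMod 2) (ZMod 2))
      ((TopCat.toSSet.obj (TopCat.of X)).δ i (singSimplex (n + 1) f)) =
      (TopCat.toSSet.obj (TopCat.of X)).ιChainComplex (R := ModuleCat.of (ZMod 2) (ZMod 2))
      ((TopCat.toSSet.obj (TopCat.of X)).δ i (singSimplex (n + 1) f)) := by
    rcases neg_one_pow_eq_or ℤ i.val with h | h <;> rw [h]
    · simp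
    · ext
      simp only [neg_smul, one_smul]
      rw [← neg_one_smul (ZMod 2)]
      have : (-1 : ZMod 2) = 1 := rfl
      rw [this, one_smul]
  rw [h1]
  rfl

/-- Singular 1-chains modulo boundaries. -/
abbrev ChainClass : Type := (singChains X).opcycles 1

variable {X} in
/-- The class of a singular 1-simplex modulo boundaries. -/
noncomputable def cls (σ : C(stdSimplex ℝ (Fin 2), X)) : ChainClass X :=
  ((singChains X).pOpcycles 1).hom (chainOf 1 σ)

variable {X} in
lemma cls_boundary (τ : C(stdSimplex ℝ (Fin 3), X)) :
    cls (τ.comp (faceMap 1 0)) + cls (τ.comp (faceMap 1 1)) + cls (τ.comp (faceMap 1 2)) = 0 := by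
  have h := congrArg (fun z => z.hom (chainOf 2 τ)) ((singChains X).d_pOpcycles 2 1)
  have h' : ((singChains X).pOpcycles 1).hom (((singChains X).d 2 1).hom (chainOf 2 τ)) = 0 := h
  rw [d_chainOf, map_sum, Fin.sum_univ_three] at h'
  exact h'

variable {X} in
lemma exists_lift_cls {M : Type} [AddCommGroup M] [Module (ZMod 2) M]
    (w : C(stdSimplex ℝ (Fin 2), X) → M)
    (hw : ∀ τ : C(stdSimplex ℝ (Fin 3), X), w (τ.comp (faceMap 1 0)) + w (τ.comp (faceMap 1 1)) +
      w (τ.comp (faceMap 1 2)) = 0) :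
    ∃ W : ChainClass X →ₗ[ZMod 2] M, ∀ σ, W (cls σ) = w σ := by
  have hd : (singChains X).d 2 1 ≫ chainDesc (M := ModuleCat.of (ZMod 2) M) w = 0 := by
    apply chains_hom_ext
    intro f
    change (chainDesc (M := ModuleCat.of (ZMod 2) M) w).hom
      (((singChains X).d 2 1).hom (chainOf 2 f)) = 0
    rw [d_chainOf, map_sum, Fin.sum_univ_three]
    refine Eq.trans (congrArg₂ _ (congrArg₂ _ (chainDesc_chainOf _ _) (chainDesc_chainOf _ _))
      (chainDesc_chainOf _ _)) (hw f)
  refine ⟨((singChains X).descOpcycles (chainDesc (M := ModuleCat.of (ZMod 2) M) w) 2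
    (by simp) hd).hom, fun σ => ?_⟩
  have := congrArg (fun z => z.hom (chainOf 1 σ)) ((singChains X).p_descOpcycles
    (chainDesc (M := ModuleCat.of (ZMod 2) M) w) 2 (by simp) hd)
  refine Eq.trans this ?_
  exact chainDesc_chainOf (M := ModuleCat.of (ZMod 2) M) w σ

variable {X} in
lemma chainClass_hom_ext {M : Type} [AddCommGroup M] [Module (ZMod 2) M]
    {u v : ChainClass X →ₗ[ZMod 2] M} (h : ∀ σ, u (cls σ) = v (cls σ)) : u = v := by
  have : ModuleCat.ofHom u = ModuleCat.ofHom v := by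
    rw [← cancel_epi ((singChains X).pOpcycles 1)]
    exact chains_hom_ext h
  exact congrArg ModuleCat.Hom.hom this

lemma exists_bdry : ∃ W : ChainClass X →ₗ[ZMod 2] (X →₀ ZMod 2), ∀ σ, W (cls σ) =
    Finsupp.single (σ (stdSimplex.vertex 1)) 1 + Finsupp.single (σ (stdSimplex.vertex 0)) 1 := by
  refine exists_lift_cls (M := X →₀ ZMod 2) _ fun τ => ?_
  have h01 : ∀ i j, (faceMap 1 i) (stdSimplex.vertex j) = stdSimplex.vertex (i.succAbove j) :=
    fun i j => stdSimplex.map_vertex _ _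
  simp only [ContinuousMap.comp_apply, h01]
  have h2 : ∀ a : X →₀ ZMod 2, a + a = 0 := fun a => by
    ext x; simpa using CharTwo.add_self_eq_zero (a x)
  have e : ∀ a b c : X →₀ ZMod 2, (a + b) + (a + c) + (b + c) = 0 :=
    fun a b c => by
      have : (a + b) + (a + c) + (b + c) = (a + a) + (b + b) + (c + c) := by abel
      rw [this, h2 a, h2 b, h2 c]; rfl
  exact e _ _ _

/-- The boundary of a class of 1-chains, as a finitely supported function on the points of `X`. -/
noncomputable def bdry : ChainClass X →ₗ[ZMod 2] (X →₀ ZMod 2) := (exists_bdry X).choose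

variable {X} in
lemma bdry_cls (σ : C(stdSimplex ℝ (Fin 2), X)) : bdry X (cls σ) =
    Finsupp.single (σ (stdSimplex.vertex 1)) 1 + Finsupp.single (σ (stdSimplex.vertex 0)) 1 :=
  (exists_bdry X).choose_spec σ

lemma exists_finsuppDesc (X : Type) {M : ModuleCat.{0} (ZMod 2)} (g : X → M) :
    ∃ L : ModuleCat.of (ZMod 2) (X →₀ ZMod 2) ⟶ M, ∀ x, L.hom (Finsupp.single x 1) = g x := by
  refine ⟨ModuleCat.ofHom (Finsupp.lift M (ZMod 2) X g), fun x => ?_⟩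
  have : (Finsupp.lift M (ZMod 2) X g) (Finsupp.single x 1) = g x := by
    rw [Finsupp.lift_apply, Finsupp.sum_single_index (by simp), one_smul]
  exact this

variable {X} in
lemma chainDesc_point_injective : Function.Injective
    (chainDesc (X := X) (n := 0) (M := ModuleCat.of (ZMod 2) (X →₀ ZMod 2))
      (fun f => Finsupp.single (f (stdSimplex.vertex 0)) 1)).hom := by
  obtain ⟨c1, hc1⟩ := exists_finsuppDesc X (fun x => chainOf 0 (.const _ x))
  have hc : (chainDesc (X := X) (n := 0) (M := ModuleCat.of (ZMod 2) (X →₀ ZMod 2))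
      (fun f => Finsupp.single (f (stdSimplex.vertex 0)) 1)) ≫ c1 = 𝟙 _ := by
    apply chains_hom_ext
    intro f
    refine (congrArg c1.hom (chainDesc_chainOf _ f)).trans ((hc1 _).trans ?_)
    change chainOf 0 _ = chainOf 0 f
    congr 1
    ext x
    exact congrArg f (Subsingleton.elim _ _)
  intro a b hab
  have := congrArg c1.hom hab
  have h3 := fun z => congrArg (fun y => y.hom z) hc
  exact (h3 a).symm.trans (this.trans (h3 b))

/-- The first Betti number is the dimension of the space of 1-cycles modulo boundaries. -/
lemma bettiOne_eq : bettiOne X = Module.finrank (ZMod 2) (LinearMap.ker (bdry X)) := by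
  let K := singChains X
  -- `C₀` is the free module on the points
  let c0 : K.X 0 ⟶ ModuleCat.of (ZMod 2) (X →₀ ZMod 2) :=
    chainDesc (fun f => Finsupp.single (f (stdSimplex.vertex 0)) 1)
  have hb : (K.fromOpcycles 1 0) ≫ c0 = ModuleCat.ofHom (bdry X) := by
    have : ((K.fromOpcycles 1 0) ≫ c0).hom = bdry X := by
      apply chainClass_hom_ext
      intro σ
      rw [bdry_cls]
      have h := congrArg (fun z => z.hom (chainOf 1 σ)) (K.p_fromOpcycles 1 0)
      change c0.hom ((K.fromOpcycles 1 0).hom (cls σ)) = _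
      have h' : (K.fromOpcycles 1 0).hom (cls σ) = (K.d 1 0).hom (chainOf 1 σ) := h
      rw [h', d_chainOf, map_sum, Fin.sum_univ_two]
      refine (congrArg₂ _ (chainDesc_chainOf _ _) (chainDesc_chainOf _ _)).trans ?_
      have h01 : ∀ i j, (faceMap 0 i) (stdSimplex.vertex j) = stdSimplex.vertex (i.succAbove j) :=
        fun i j => stdSimplex.map_vertex _ _
      simp only [ContinuousMap.comp_apply, h01]
      rfl
    rw [← this]; rfl
  have hker : LinearMap.ker (bdry X) = LinearMap.range (K.homologyι 1).hom := by
    have hex : (ShortComplex.mk _ _ (K.homologyι_comp_fromOpcycles 1 0)).Exact :=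
      ShortComplex.exact_of_f_is_kernel _ (K.homologyIsKernel 1 0 (by simp))
    have h1 := hex.moduleCat_range_eq_ker
    change LinearMap.range (K.homologyι 1).hom = LinearMap.ker (K.fromOpcycles 1 0).hom at h1
    rw [h1]
    have hb' : bdry X = c0.hom ∘ₗ (K.fromOpcycles 1 0).hom := by
      have := congrArg ModuleCat.Hom.hom hb
      exact this.symm
    have hinj : LinearMap.ker c0.hom = ⊥ := by
      rw [LinearMap.ker_eq_bot]
      exact chainDesc_point_injective
    rw [hb', LinearMap.ker_comp_of_ker_eq_bot _ hinj]
  rw [hker]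
  have hmono : Function.Injective (K.homologyι 1).hom :=
    (ModuleCat.mono_iff_injective _).1 inferInstance
  exact (LinearEquiv.ofInjective (K.homologyι 1).hom hmono).finrank_eq

end Homology
/-! ### Homology classes of paths -/

section PathClasses

open Topology Filter

variable {X : Type} [TopologicalSpace X]
variable {E : Type*} [AddCommGroup E] [Module ℝ E] [TopologicalSpace E] [ContinuousAdd E]
  [ContinuousSMul ℝ E]

/-- The affine 1-simplex from `a` to `b`. -/
def segMap (a b : E) : C(stdSimplex ℝ (Fin 2), E) where
  toFun s := s.1 0 • a + s.1 1 • b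
  continuous_toFun := by
    have h : ∀ j : Fin 2, Continuous fun s : stdSimplex ℝ (Fin 2) => s.1 j :=
      fun j => (continuous_apply j).comp continuous_subtype_val
    exact ((h 0).smul continuous_const).add ((h 1).smul continuous_const)

/-- The class modulo boundaries of the image under `f` of the segment from `a` to `b`. -/
noncomputable def pathCls (f : C(E, X)) (a b : E) : ChainClass X := cls (f.comp (segMap a b))

omit [TopologicalSpace E] [ContinuousAdd E] [ContinuousSMul ℝ E] in
lemma faceMap_one_apply (i : Fin 3) (s : stdSimplex ℝ (Fin 2)) (a : Fin 3 → E) :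
    ∑ j, (faceMap 1 i s).1 j • a j = ∑ j, s.1 j • a (i.succAbove j) := by
  have h : ∀ j, (faceMap 1 i s).1 j =
      ∑ k ∈ Finset.univ.filter (fun k => i.succAbove k = j), s.1 k := by
    intro j
    change FunOnFinite.linearMap ℝ ℝ i.succAbove s.1 j = _
    rw [FunOnFinite.linearMap_apply_apply]
  simp only [h, Finset.sum_smul]
  rw [Finset.sum_sigma']
  refine Finset.sum_bij' (fun x _ => x.2) (fun k _ => ⟨i.succAbove k, k⟩) ?_ ?_ ?_ ?_ ?_ <;>
    simp +contextual

lemma pathCls_add (f : C(E, X)) (a b c : E) :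
    pathCls f a b + pathCls f b c = pathCls f a c := by
  let τ : C(stdSimplex ℝ (Fin 3), X) :=
    f.comp ⟨fun s => ∑ j, s.1 j • (![a, b, c] : Fin 3 → E) j,
      continuous_finsetSum _ fun j _ => ((continuous_apply j).comp continuous_subtype_val).smul
        continuous_const⟩
  have h := cls_boundary τ
  have h0 : τ.comp (faceMap 1 0) = f.comp (segMap b c) := by
    ext s
    simp only [τ, ContinuousMap.comp_apply, ContinuousMap.coe_mk, faceMap_one_apply, segMap]
    simp [Fin.sum_univ_two, Fin.succAbove]
  have h1 : τ.comp (faceMap 1 1) = f.comp (segMap a c) := by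
    ext s
    simp only [τ, ContinuousMap.comp_apply, ContinuousMap.coe_mk, faceMap_one_apply, segMap]
    simp [Fin.sum_univ_two, Fin.succAbove]
  have h2 : τ.comp (faceMap 1 2) = f.comp (segMap a b) := by
    ext s
    simp only [τ, ContinuousMap.comp_apply, ContinuousMap.coe_mk, faceMap_one_apply, segMap]
    simp [Fin.sum_univ_two, Fin.succAbove]
  rw [h0, h1, h2] at h
  change pathCls f b c + pathCls f a c + pathCls f a b = 0 at h
  have h3 := ZModModule.add_self (pathCls f a c)
  have : pathCls f a b + pathCls f b c = (pathCls f b c + pathCls f a c + pathCls f a b) +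
    (pathCls f a c) - (pathCls f a c + pathCls f a c) := by abel
  rw [this, h, h3]; simp

lemma pathCls_self (f : C(E, X)) (a : E) : pathCls f a a = 0 := by
  have := pathCls_add f a a a
  simpa using this

lemma pathCls_symm (f : C(E, X)) (a b : E) : pathCls f a b = pathCls f b a := by
  have h := pathCls_add f a b a
  rw [pathCls_self] at h
  rw [← sub_eq_zero, ZModModule.sub_eq_add, h]

lemma bdry_pathCls (f : C(E, X)) (a b : E) :
    bdry X (pathCls f a b) = Finsupp.single (f b) 1 + Finsupp.single (f a) 1 := by
  rw [pathCls, bdry_cls]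
  congr 3 <;> simp [segMap, stdSimplex.vertex]

lemma segMap_zero_one_apply (s : stdSimplex ℝ (Fin 2)) : segMap (0 : ℝ) 1 s = s.1 1 := by
  simp [segMap]

/-- In the image of a vector space, the class of a path depends only on its end points. -/
lemma pathCls_comp (f : C(E, X)) (γ : C(ℝ, E)) (a b : ℝ) :
    pathCls (f.comp γ) a b = pathCls f (γ a) (γ b) := by
  let H : C(ℝ × ℝ × ℝ × ℝ, E) :=
    ⟨fun z => (1 - z.1) • γ z.2.1 + z.1 • (z.2.2.1 • γ a + z.2.2.2 • γ b), by fun_prop⟩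
  have e1 : pathCls (f.comp H) (0, a, 1, 0) (0, b, 0, 1) = pathCls (f.comp γ) a b := by
    unfold pathCls
    congr 1
    ext s
    simp [H, segMap]
  have e2 : pathCls (f.comp H) (1, a, 1, 0) (1, b, 0, 1) = pathCls f (γ a) (γ b) := by
    unfold pathCls
    congr 1
    ext s
    have hs : s.1 0 + s.1 1 = 1 := by simpa [Fin.sum_univ_two] using s.2.2
    simp [H, segMap, hs]
  have hconst : ∀ (u v : ℝ × ℝ × ℝ × ℝ) (x : X),
      (∀ s, (f.comp H) (segMap u v s) = x) → pathCls (f.comp H) u v = 0 := by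
    intro u v x h
    have : (f.comp H).comp (segMap u v) = (ContinuousMap.const ℝ x).comp (segMap (0 : ℝ) 0) := by
      ext s
      exact h s
    unfold pathCls
    rw [this]
    exact pathCls_self _ _
  have e3 : pathCls (f.comp H) (0, a, 1, 0) (1, a, 1, 0) = 0 := by
    refine hconst _ _ (f (γ a)) fun s => ?_
    have hs : s.1 0 + s.1 1 = 1 := by simpa [Fin.sum_univ_two] using s.2.2
    have h0 : s.1 0 = 1 - s.1 1 := by linarith
    have h2 : (1 - s.1 1) * a + s.1 1 * a = a := by ring
    simp [H, segMap, h0, h2, ← add_smul]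
  have e4 : pathCls (f.comp H) (1, b, 0, 1) (0, b, 0, 1) = 0 := by
    refine hconst _ _ (f (γ b)) fun s => ?_
    have hs : s.1 0 + s.1 1 = 1 := by simpa [Fin.sum_univ_two] using s.2.2
    have h0 : s.1 0 = 1 - s.1 1 := by linarith
    have h2 : (1 - s.1 1) * b + s.1 1 * b = b := by ring
    simp [H, segMap, h0, h2, ← add_smul]
  have h := pathCls_add (f.comp H) (0, a, 1, 0) (1, a, 1, 0) (0, b, 0, 1)
  have h' := pathCls_add (f.comp H) (1, a, 1, 0) (1, b, 0, 1) (0, b, 0, 1)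
  rw [e1, e3, zero_add] at h
  rw [e2, e4, add_zero] at h'
  rw [← h, h']

/-- The parametrization of the standard 1-simplex by `[0, 1]`, continued by constants. -/
noncomputable def clampSimplex : C(ℝ, stdSimplex ℝ (Fin 2)) where
  toFun t := ⟨![1 - max 0 (min t 1), max 0 (min t 1)], by
      constructor
      · intro i
        fin_cases i <;> simp
      · simp⟩
  continuous_toFun := by
    refine Continuous.subtype_mk (continuous_pi fun i => ?_) _
    fin_cases i
    · change Continuous fun t : ℝ => 1 - max 0 (min t 1)
      fun_prop
    · change Continuous fun t : ℝ => max 0 (min t 1)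
      fun_prop

lemma clampSimplex_zero (t : ℝ) : (clampSimplex t).1 0 = 1 - max 0 (min t 1) := rfl

lemma clampSimplex_one (t : ℝ) : (clampSimplex t).1 1 = max 0 (min t 1) := rfl

/-- A singular 1-simplex as a path, continued by constants. -/
noncomputable def simplexPath (σ : C(stdSimplex ℝ (Fin 2), X)) : C(ℝ, X) := σ.comp clampSimplex

lemma pathCls_simplexPath (σ : C(stdSimplex ℝ (Fin 2), X)) :
    pathCls (simplexPath σ) 0 1 = cls σ := by
  unfold pathCls
  congr 1
  ext s
  simp only [simplexPath, ContinuousMap.comp_apply, segMap_zero_one_apply]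
  congr 1
  have hs : s.1 0 + s.1 1 = 1 := by simpa [Fin.sum_univ_two] using s.2.2
  have h0 : 0 ≤ s.1 0 := s.2.1 0
  have h1 : 0 ≤ s.1 1 := s.2.1 1
  have h2 : max 0 (min (s.1 1) 1) = s.1 1 := by
    rw [min_eq_left (by linarith), max_eq_right h1]
  ext i
  fin_cases i
  · change 1 - max 0 (min (s.1 1) 1) = s.1 0
    rw [h2]; linarith
  · exact h2

/-- A formula for the class of a path in terms of its end points holds if it holds locally. -/
lemma map_pathCls_of_locally {M : Type*} [AddCommGroup M] [Module (ZMod 2) M]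
    (L : ChainClass X →ₗ[ZMod 2] M) (p : X → M) (γ : C(ℝ, X))
    (h : ∀ t₀, ∀ᶠ t in 𝓝 t₀, L (pathCls γ t₀ t) = p (γ t₀) + p (γ t)) (s t : ℝ) :
    L (pathCls γ s t) = p (γ s) + p (γ t) := by
  let g : ℝ → M := fun t => L (pathCls γ s t) + p (γ t)
  have hg : IsLocallyConstant g := by
    rw [IsLocallyConstant.iff_eventually_eq]
    intro t₀
    filter_upwards [h t₀] with t ht
    have h1 := pathCls_add γ s t₀ t
    simp only [g]
    rw [← h1, map_add, ht, add_assoc, add_assoc, ZModModule.add_self, add_zero]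
  have := hg.apply_eq_of_preconnectedSpace t s
  simp only [g, pathCls_self, map_zero, zero_add] at this
  rw [← this, add_assoc, ZModModule.add_self, add_zero]

end PathClasses

/-- If every 1-simplex is, up to boundaries and elements of `V`, a difference of values of a
function at its end points, then the first homology embeds into `V`. -/
lemma ker_bdry_le {X : Type} [TopologicalSpace X] (V : Submodule (ZMod 2) (ChainClass X))
    (p : X → ChainClass X ⧸ V)
    (h : ∀ γ : C(ℝ, X), V.mkQ (pathCls γ 0 1) = p (γ 0) + p (γ 1)) :
    LinearMap.ker (bdry X) ≤ V := by
  let P : (X →₀ ZMod 2) →ₗ[ZMod 2] ChainClass X ⧸ V := Finsupp.lift _ (ZMod 2) X p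
  have hP : P ∘ₗ bdry X = V.mkQ := by
    apply chainClass_hom_ext
    intro σ
    rw [← pathCls_simplexPath σ, h, LinearMap.comp_apply, bdry_pathCls, map_add]
    simp only [P, Finsupp.lift_apply]
    rw [Finsupp.sum_single_index (by simp), Finsupp.sum_single_index (by simp), one_smul, one_smul,
      add_comm]
  intro z hz
  rw [← V.ker_mkQ, LinearMap.mem_ker, ← hP, LinearMap.comp_apply, LinearMap.mem_ker.1 hz, map_zero]

/-! ### Finiteness of the first homology of a compact surface -/

section Finiteness

open Topology Filter

variable {X : Type} [TopologicalSpace X]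

/-- A subset of `X` (the range of `f`) presented as a retract of the plane: a partial inverse `g`
of `f` is continuous on the range of `f`. -/
structure PlaneRetract (X : Type) [TopologicalSpace X] where
  /-- the map from the plane -/
  f : C(ℝ × ℝ, X)
  /-- a section of `f` over its range -/
  g : X → ℝ × ℝ
  continuousOn_g : ContinuousOn g (Set.range f)
  right_inv : ∀ x ∈ Set.range f, f (g x) = x

/-- The underlying set of a plane retract. -/
def PlaneRetract.carrier (D : PlaneRetract X) : Set X := Set.range D.f

/-- The class of the paths from `x` to `y` inside a plane retract. -/
noncomputable def PlaneRetract.link (D : PlaneRetract X) (x y : X) : ChainClass X :=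
  pathCls D.f (D.g x) (D.g y)

lemma PlaneRetract.link_add (D : PlaneRetract X) (x y z : X) :
    D.link x y + D.link y z = D.link x z := pathCls_add _ _ _ _

lemma PlaneRetract.link_symm (D : PlaneRetract X) (x y : X) : D.link x y = D.link y x :=
  pathCls_symm _ _ _

lemma PlaneRetract.pathCls_eq (D : PlaneRetract X) (γ : C(ℝ, X)) (s t : ℝ)
    (h : ∀ u ∈ Set.uIcc s t, γ u ∈ D.carrier) : pathCls γ s t = D.link (γ s) (γ t) := by
  -- the restriction of `γ` to the interval, continued by constants, lifts to the plane
  let r : ℝ → ℝ := fun u => max (min s t) (min u (max s t))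
  have hr : Continuous r := by fun_prop
  have hle : min s t ≤ max s t := min_le_max
  have hr1 : ∀ u, r u ∈ Set.uIcc s t := fun u => ⟨le_max_left _ _, max_le hle (min_le_right _ _)⟩
  have hr2 : ∀ u ∈ Set.uIcc s t, r u = u := by
    rintro u ⟨h1, h2⟩
    simp only [r]
    rw [min_eq_left h2, max_eq_right h1]
  have hc : Continuous fun u => D.g (γ (r u)) :=
    D.continuousOn_g.comp_continuous (γ.continuous.comp hr) fun u => h _ (hr1 u)
  have e : pathCls γ s t = pathCls (D.f.comp ⟨_, hc⟩) s t := by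
    unfold pathCls
    congr 1
    ext v
    have hv : segMap s t v ∈ Set.uIcc s t := by
      have hs : v.1 0 + v.1 1 = 1 := by simpa [Fin.sum_univ_two] using v.2.2
      exact convex_uIcc s t Set.left_mem_uIcc Set.right_mem_uIcc (v.2.1 0) (v.2.1 1) hs
    simp only [ContinuousMap.comp_apply, ContinuousMap.coe_mk]
    rw [D.right_inv _ (h _ (hr1 _)), hr2 _ hv]
  rw [e, pathCls_comp]
  simp only [ContinuousMap.coe_mk, PlaneRetract.link]
  rw [hr2 s Set.left_mem_uIcc, hr2 t Set.right_mem_uIcc]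

lemma PlaneRetract.exists_path (D : PlaneRetract X) {x y : X} (hx : x ∈ D.carrier)
    (hy : y ∈ D.carrier) : ∃ γ : C(ℝ, X), γ 0 = x ∧ γ 1 = y ∧ (∀ t, γ t ∈ D.carrier) ∧
      pathCls γ 0 1 = D.link x y := by
  let l : C(ℝ, ℝ × ℝ) := ⟨fun t => (1 - t) • D.g x + t • D.g y, by fun_prop⟩
  refine ⟨D.f.comp l, ?_, ?_, fun t => ⟨l t, rfl⟩, ?_⟩
  · simp [l, D.right_inv x hx]
  · simp [l, D.right_inv y hy]
  · rw [pathCls_comp]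
    simp [l, PlaneRetract.link]

lemma PlaneRetract.link_eq (D U : PlaneRetract X) (h : D.carrier ⊆ U.carrier) {x y : X}
    (hx : x ∈ D.carrier) (hy : y ∈ D.carrier) : D.link x y = U.link x y := by
  obtain ⟨γ, h0, h1, hγ, hc⟩ := D.exists_path hx hy
  rw [← hc, U.pathCls_eq γ 0 1 fun u _ => h (hγ u), h0, h1]

/-- A compact space in which every point has arbitrarily small neighbourhoods that are retracts of
the plane has finite-dimensional first homology: a path is, up to terms depending on its end
points, a sum of links between finitely many points inside finitely many retracts. -/
theorem finiteDimensional_ker_bdry {X : Type} [MetricSpace X] [CompactSpace X]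
    (h : ∀ x : X, ∀ U ∈ 𝓝 x, ∃ D : PlaneRetract X, D.carrier ∈ 𝓝 x ∧ D.carrier ⊆ U) :
    FiniteDimensional (ZMod 2) (LinearMap.ker (bdry X)) := by
  choose D₀ hD₀ using fun x => h x Set.univ Filter.univ_mem
  obtain ⟨T, hT⟩ := CompactSpace.elim_nhds_subcover (fun x => interior (D₀ x).carrier)
    fun x => interior_mem_nhds.2 (hD₀ x).1
  obtain ⟨δ, hδ, hleb⟩ := lebesgue_number_lemma_of_metric (s := (Set.univ : Set X))
    (c := fun x : T => interior (D₀ x).carrier) isCompact_univ (fun _ => isOpen_interior) (by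
      intro x _
      have : x ∈ ⋃ x ∈ T, interior (D₀ x).carrier := by rw [hT]; trivial
      simpa using this)
  choose D hD using fun x => h x (Metric.ball x (δ / 8)) (Metric.ball_mem_nhds x (by positivity))
  obtain ⟨T', hT'⟩ := CompactSpace.elim_nhds_subcover (fun x => interior (D x).carrier)
    fun x => interior_mem_nhds.2 (hD x).1
  have hc : ∀ x, ∃ i ∈ T', x ∈ interior (D i).carrier := by
    intro x
    have : x ∈ ⋃ x ∈ T', interior (D x).carrier := by rw [hT']; trivial
    simpa using this
  choose i hiT hi using hc
  have hi' : ∀ x, x ∈ (D (i x)).carrier := fun x => interior_subset (hi x)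
  let V : Submodule (ZMod 2) (ChainClass X) := Submodule.span (ZMod 2)
    (Set.range fun z : T × T' × T' => (D₀ z.1).link z.2.1 z.2.2)
  have hV : FiniteDimensional (ZMod 2) V :=
    FiniteDimensional.span_of_finite _ (Set.finite_range _)
  have hcenter : ∀ x, x ∈ (D x).carrier := fun x => mem_of_mem_nhds (hD x).1
  let p : X → ChainClass X ⧸ V := fun x => V.mkQ ((D (i x)).link x (i x))
  have hle : LinearMap.ker (bdry X) ≤ V := by
    refine ker_bdry_le V p fun γ => map_pathCls_of_locally _ p γ (fun t₀ => ?_) 0 1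
    set l := i (γ t₀) with hl
    have hnhds : γ ⁻¹' (interior (D l).carrier) ∈ 𝓝 t₀ :=
      γ.continuous.continuousAt (isOpen_interior.mem_nhds (hi (γ t₀)))
    obtain ⟨ε, hε, hball⟩ := Metric.mem_nhds_iff.1 hnhds
    filter_upwards [Metric.ball_mem_nhds t₀ hε] with t ht
    have hpath : ∀ u ∈ Set.uIcc t₀ t, γ u ∈ (D l).carrier := fun u hu =>
      interior_subset (hball ((convex_ball t₀ ε).ordConnected.uIcc_subset
        (Metric.mem_ball_self hε) ht hu))
    have hyl : γ t ∈ (D l).carrier := hpath t Set.right_mem_uIcc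
    obtain ⟨k, hk⟩ := hleb l (Set.mem_univ _)
    set j := i (γ t) with hj
    have hlU : (D l).carrier ⊆ (D₀ k).carrier := fun z hz => interior_subset
      (hk (Metric.ball_subset_ball (by linarith) ((hD l).2 hz)))
    have hjU : (D j).carrier ⊆ (D₀ k).carrier := fun z hz => by
      refine interior_subset (hk ?_)
      have h1 : dist z j < δ / 8 := (hD j).2 hz
      have h2 : dist (γ t) j < δ / 8 := (hD j).2 (hi' (γ t))
      have h3 : dist (γ t) l < δ / 8 := (hD l).2 hyl
      rw [Metric.mem_ball]
      calc dist z l ≤ dist z j + dist j (γ t) + dist (γ t) l := dist_triangle4 _ _ _ _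
        _ < δ := by rw [dist_comm j]; linarith
    have e : pathCls γ t₀ t = (D l).link (γ t₀) l + (D j).link (γ t) j + (D₀ k).link l j := by
      rw [(D l).pathCls_eq γ t₀ t hpath, (D l).link_eq _ hlU (hi' _) hyl,
        (D l).link_eq _ hlU (hi' _) (hcenter l), (D j).link_eq _ hjU (hi' _) (hcenter j),
        (D₀ k).link_symm (γ t) j, ← (D₀ k).link_add (γ t₀) l (γ t),
        ← (D₀ k).link_add l j (γ t)]
      abel
    have hmem : (D₀ k).link l j ∈ V :=
      Submodule.subset_span ⟨(k, ⟨l, hiT _⟩, ⟨j, hiT _⟩), rfl⟩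
    rw [e, map_add, map_add]
    have : V.mkQ ((D₀ k).link l j) = 0 := by simpa using hmem
    rw [this, add_zero]
  exact Submodule.finiteDimensional_of_le hle

end Finiteness
/-! ### Double covers and mod 2 homology -/

section Cocycles

open Topology Filter

lemma eventually_eq_zmod (v : ZMod 2) : ∀ᶠ y in 𝓝 v, y = v := by simp [nhds_discrete]

/-- A locally constant cocycle with values in `ℤ/2` on an open cover `U` of `B`. -/
structure SignCocycle (ι B : Type) [TopologicalSpace B] where
  /-- the open cover -/
  U : ι → Set B
  isOpen_U : ∀ i, IsOpen (U i)
  /-- a member of the cover containing a given point -/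
  idx : B → ι
  mem_idx : ∀ x, x ∈ U (idx x)
  /-- the transition functions -/
  s : ι → ι → B → ZMod 2
  s_self : ∀ i x, x ∈ U i → s i i x = 0
  s_add : ∀ i j k x, x ∈ U i → x ∈ U j → x ∈ U k → s i j x + s j k x = s i k x
  s_loc : ∀ i j x, x ∈ U i → x ∈ U j → ∀ᶠ y in 𝓝 x, s i j y = s i j x

namespace SignCocycle

variable {ι B : Type} [TopologicalSpace B] (Z : SignCocycle ι B)

lemma s_symm {i j : ι} {x : B} (hi : x ∈ Z.U i) (hj : x ∈ Z.U j) : Z.s i j x = Z.s j i x := by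
  have h := Z.s_add i j i x hi hj hi
  rw [Z.s_self i x hi] at h
  rw [← sub_eq_zero, ZModModule.sub_eq_add, h]

/-- `c` is a section along `f` of the double cover described by a cocycle, `c i` being its
coordinate over the `i`-th set of the cover. -/
structure IsSection {A : Type} [TopologicalSpace A] (f : A → B) (c : ι → A → ZMod 2) : Prop where
  loc : ∀ i a, f a ∈ Z.U i → ∀ᶠ a' in 𝓝 a, c i a' = c i a
  trans : ∀ i j a, f a ∈ Z.U i → f a ∈ Z.U j → c j a = c i a + Z.s i j (f a)

/-- The double cover described by a cocycle. -/
def bundleCore : FiberBundleCore ι B (ZMod 2) where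
  baseSet := Z.U
  isOpen_baseSet := Z.isOpen_U
  indexAt := Z.idx
  mem_baseSet_at := Z.mem_idx
  coordChange i j x v := v + Z.s i j x
  coordChange_self i x hx v := by simp [Z.s_self i x hx]
  continuousOn_coordChange i j := by
    intro p hp
    have h : ∀ᶠ q : B × ZMod 2 in 𝓝 p, q.2 + Z.s i j q.1 = p.2 + Z.s i j p.1 := by
      have h1 := (continuous_fst.tendsto p).eventually (Z.s_loc i j p.1 hp.1.1 hp.1.2)
      have h2 : ∀ᶠ q : B × ZMod 2 in 𝓝 p, q.2 = p.2 :=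
        (continuous_snd.tendsto p).eventually (eventually_eq_zmod p.2)
      filter_upwards [h1, h2] with q hq1 hq2
      rw [hq1, hq2]
    exact (continuousAt_const.congr (h.mono fun q hq => hq.symm)).continuousWithinAt
  coordChange_comp i j k x hx v := by
    rw [add_assoc, Z.s_add i j k x hx.1.1 hx.1.2 hx.2]

/-- Over a simply connected space, the pulled back double cover has a section. -/
lemma exists_isSection {A : Type} [TopologicalSpace A] [SimplyConnectedSpace A]
    [LocallyPathConnectedSpace A] (f : C(A, B)) : ∃ c, Z.IsSection f c := by
  let W := Z.bundleCore
  have hcov : IsCoveringMap W.proj := IsFiberBundle.isCoveringMap (F := ZMod 2)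
    fun x => ⟨W.localTrivAt x, W.mem_localTrivAt_baseSet x⟩
  obtain ⟨a₀⟩ : Nonempty A := inferInstance
  obtain ⟨F, ⟨-, hF⟩, -⟩ := hcov.existsUnique_continuousMap_lifts f a₀ ⟨f a₀, (0 : ZMod 2)⟩ rfl
  have hF' : ∀ a, (F a).1 = f a := fun a => congrFun hF a
  refine ⟨fun i a => (W.localTriv i (F a)).2, fun i a ha => ?_, fun i j a hi hj => ?_⟩
  · have hs : F a ∈ (W.localTriv i).source := by
      rw [W.mem_localTriv_source]
      change (F a).1 ∈ Z.U i
      rwa [hF']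
    have hc : ContinuousAt (fun a => (W.localTriv i (F a)).2) a :=
      continuousAt_snd.comp (((W.localTriv i).continuousOn.continuousAt
        ((W.localTriv i).open_source.mem_nhds hs)).comp F.continuous.continuousAt)
    exact hc.eventually (eventually_eq_zmod _)
  · have hi' : (F a).1 ∈ Z.U i := by rwa [hF']
    have hj' : (F a).1 ∈ Z.U j := by rwa [hF']
    simp only [W.localTriv_apply]
    rw [← hF' a]
    have h := Z.s_add _ _ _ _ (Z.mem_idx _) hi' hj'
    let v : ZMod 2 := (F a).2
    exact (congrArg (fun z : ZMod 2 => v + z) h).symm.trans (add_assoc v _ _).symm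

variable {Z}

lemma IsSection.comp {A A' : Type} [TopologicalSpace A] [TopologicalSpace A'] {f : A → B}
    {c : ι → A → ZMod 2} (h : Z.IsSection f c) (g : C(A', A)) :
    Z.IsSection (f ∘ g) fun i a => c i (g a) :=
  ⟨fun i a ha => (g.continuous.tendsto a).eventually (h.loc i (g a) ha),
    fun i j a hi hj => h.trans i j (g a) hi hj⟩

/-- The change of coordinate of a section between two points. -/
def monodromy (Z : SignCocycle ι B) {A : Type} (f : A → B) (c : ι → A → ZMod 2) (a b : A) :
    ZMod 2 :=
  c (Z.idx (f b)) b + c (Z.idx (f a)) a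

/-- Two sections along the same map differ by a constant. -/
lemma IsSection.monodromy_eq {A : Type} [TopologicalSpace A] [PreconnectedSpace A] {f : A → B}
    {c c' : ι → A → ZMod 2} (h : Z.IsSection f c) (h' : Z.IsSection f c') (hf : Continuous f)
    (a b : A) : Z.monodromy f c a b = Z.monodromy f c' a b := by
  let d : A → ZMod 2 := fun a => c (Z.idx (f a)) a + c' (Z.idx (f a)) a
  have hd : ∀ i a, f a ∈ Z.U i → d a = c i a + c' i a := by
    intro i a hi
    simp only [d]
    rw [h.trans i _ a hi (Z.mem_idx _), h'.trans i _ a hi (Z.mem_idx _)]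
    have := ZModModule.add_self (Z.s i (Z.idx (f a)) (f a))
    linear_combination this
  have hloc : IsLocallyConstant d := by
    rw [IsLocallyConstant.iff_eventually_eq]
    intro a
    have ha := Z.mem_idx (f a)
    filter_upwards [h.loc _ a ha, h'.loc _ a ha,
      hf.continuousAt.eventually ((Z.isOpen_U _).mem_nhds ha)] with a' h1 h2 h3
    rw [hd _ a' h3, hd _ a ha, h1, h2]
  have := hloc.apply_eq_of_preconnectedSpace a b
  simp only [d] at this
  simp only [monodromy]
  have h1 := ZModModule.add_self (c (Z.idx (f a)) a)
  have h2 := ZModModule.add_self (c' (Z.idx (f b)) b)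
  linear_combination h1 - h2 - this

variable (Z) in
/-- The mod 2 cochain given by the monodromy along 1-simplices vanishes on boundaries. -/
lemma exists_monodromy_map : ∃ W : ChainClass B →ₗ[ZMod 2] ZMod 2,
    ∀ (γ : C(ℝ, B)) (c : ι → ℝ → ZMod 2), Z.IsSection γ c →
      W (pathCls γ 0 1) = Z.monodromy γ c 0 1 := by
  choose c hc using fun γ : C(ℝ, B) => Z.exists_isSection γ
  obtain ⟨W, hW⟩ := exists_lift_cls (X := B) (M := ZMod 2)
    (fun σ => Z.monodromy (simplexPath σ) (c (simplexPath σ)) 0 1) (by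
    intro τ
    -- the square `(u, v)` is mapped onto the triangle, its side `u = 0` onto the vertex `0`
    let cl : ℝ → ℝ := fun t => max 0 (min t 1)
    have hcl : Continuous cl := by fun_prop
    have hcl0 : ∀ t, 0 ≤ cl t := fun t => le_max_left _ _
    have hcl1 : ∀ t, cl t ≤ 1 := fun t => max_le zero_le_one (min_le_right _ _)
    have e0 : cl 0 = 0 := by simp [cl]
    have e1 : cl 1 = 1 := by simp [cl]
    let r : C(ℝ × ℝ, stdSimplex ℝ (Fin 3)) := ⟨fun z =>
      ⟨![1 - cl z.1, cl z.1 * (1 - cl z.2), cl z.1 * cl z.2], by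
        constructor
        · intro i
          fin_cases i
          · simpa using hcl1 z.1
          · exact mul_nonneg (hcl0 _) (sub_nonneg.2 (hcl1 _))
          · exact mul_nonneg (hcl0 _) (hcl0 _)
        · simp [Fin.sum_univ_three]; ring⟩, by
      refine Continuous.subtype_mk (continuous_pi fun i => ?_) _
      fin_cases i
      · change Continuous fun z : ℝ × ℝ => 1 - cl z.1
        fun_prop
      · change Continuous fun z : ℝ × ℝ => cl z.1 * (1 - cl z.2)
        fun_prop
      · change Continuous fun z : ℝ × ℝ => cl z.1 * cl z.2
        fun_prop⟩
    obtain ⟨d, hd⟩ := Z.exists_isSection (τ.comp r)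
    have key : ∀ (i : Fin 3) (l : C(ℝ, ℝ × ℝ)),
        (∀ t, ∀ j, (r (l t)).1 j = (faceMap 1 i (clampSimplex t)).1 j) →
        Z.monodromy (simplexPath (τ.comp (faceMap 1 i)))
          (c (simplexPath (τ.comp (faceMap 1 i)))) 0 1
          = d (Z.idx (τ (r (l 1)))) (l 1) + d (Z.idx (τ (r (l 0)))) (l 0) := by
      intro i l hl
      have heq : simplexPath (τ.comp (faceMap 1 i)) = (τ.comp r).comp l := by
        ext t
        simp only [simplexPath, ContinuousMap.comp_apply]
        congr 1
        ext j
        exact (hl t j).symm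
      rw [heq]
      exact (hc ((τ.comp r).comp l)).monodromy_eq (hd.comp l) (ContinuousMap.continuous _) 0 1
    have hface : ∀ (i : Fin 3) (t : ℝ) (j : Fin 3), (faceMap 1 i (clampSimplex t)).1 j =
          (1 - cl t) * (if i.succAbove 0 = j then 1 else 0) +
          cl t * (if i.succAbove 1 = j then 1 else 0) := by
      intro i t j
      have := faceMap_one_apply (E := ℝ) i (clampSimplex t) (fun k => if k = j then 1 else 0)
      simpa [Fin.sum_univ_two, clampSimplex_zero, clampSimplex_one, cl] using this
    have k0 := key 0 ⟨fun t => (1, t), by fun_prop⟩ (by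
      intro t j
      rw [hface]
      fin_cases j <;> simp [r, e1, Fin.succAbove])
    have k1 := key 1 ⟨fun t => (t, 1), by fun_prop⟩ (by
      intro t j
      rw [hface]
      fin_cases j <;> simp [r, e1, Fin.succAbove])
    have k2 := key 2 ⟨fun t => (t, 0), by fun_prop⟩ (by
      intro t j
      rw [hface]
      fin_cases j <;> simp [r, e0, Fin.succAbove])
    have hconst : d (Z.idx (τ (r (0, 1)))) (0, 1) = d (Z.idx (τ (r (0, 0)))) (0, 0) := by
      have hv : ∀ t, r (0, t) = r (0, 0) := fun t => by
        ext j
        fin_cases j <;> simp [r, e0]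
      have hloc : IsLocallyConstant fun t : ℝ => d (Z.idx (τ (r (0, 0)))) ((0 : ℝ), t) := by
        rw [IsLocallyConstant.iff_eventually_eq]
        intro t
        have := hd.loc (Z.idx (τ (r (0, 0)))) (0, t) (by
          simp only [ContinuousMap.comp_apply]
          rw [hv t]; exact Z.mem_idx (τ (r (0, 0))))
        exact (Continuous.tendsto (f := fun t : ℝ => ((0 : ℝ), t)) (by fun_prop) t).eventually this
      rw [hv]
      exact hloc.apply_eq_of_preconnectedSpace 1 0
    rw [k0, k1, k2]
    simp only [ContinuousMap.coe_mk]
    rw [hconst]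
    generalize d (Z.idx (τ (r (1, 1)))) (1, 1) = a
    generalize d (Z.idx (τ (r (1, 0)))) (1, 0) = b
    generalize d (Z.idx (τ (r (0, 0)))) (0, 0) = e
    revert a b e
    decide)
  refine ⟨W, fun γ d hd => ?_⟩
  have hs := hW (γ.comp (segMap 0 1))
  change W (pathCls γ 0 1) = _ at hs
  rw [hs]
  let cl : C(ℝ, ℝ) := ⟨fun t => max 0 (min t 1), by fun_prop⟩
  have heq : simplexPath (γ.comp (segMap 0 1)) = γ.comp cl := by
    ext t
    simp [simplexPath, segMap, cl, clampSimplex]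
  rw [heq]
  refine ((hc _).monodromy_eq (hd.comp cl) (ContinuousMap.continuous _) 0 1).trans ?_
  have e0 : cl 0 = 0 := by simp [cl]
  have e1 : cl 1 = 1 := by simp [cl]
  simp [monodromy, e0, e1]

/-- If the first mod 2 homology of a space with small plane retracts vanishes, then every double
cover has a global section. -/
theorem exists_global_section (hB : ∀ x : B, ∀ U ∈ 𝓝 x, ∃ D : PlaneRetract B,
      D.carrier ∈ 𝓝 x ∧ D.carrier ⊆ U)
    (hker : LinearMap.ker (bdry B) = ⊥) : ∃ o : ι → B → ZMod 2, Z.IsSection id o := by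
  obtain ⟨W, hW⟩ := Z.exists_monodromy_map
  let J : B → B → Prop := fun x y => ∃ γ : C(ℝ, B), γ 0 = x ∧ γ 1 = y
  have hJ : Equivalence J := by
    have hjoin : ∀ x y, J x y ↔ Joined x y := by
      intro x y
      constructor
      · rintro ⟨γ, h0, h1⟩
        exact ⟨⟨γ.comp ⟨Subtype.val, continuous_subtype_val⟩, h0, h1⟩⟩
      · rintro ⟨p⟩
        exact ⟨⟨p.extend, p.continuous_extend⟩, by simp, by simp⟩
    refine ⟨fun x => (hjoin _ _).2 (Joined.refl x), fun {x y} h => (hjoin _ _).2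
      ((hjoin _ _).1 h).symm, fun {x y z} h h' => (hjoin _ _).2
      (((hjoin _ _).1 h).trans ((hjoin _ _).1 h'))⟩
  let S : Setoid B := ⟨J, hJ⟩
  have hbase : ∀ x : B, J (Quotient.mk S x).out x := fun x => Quotient.mk_out (s := S) x
  choose γ hγ0 hγ1 using hbase
  let O : B → ZMod 2 := fun x => W (pathCls (γ x) 0 1)
  refine ⟨fun i x => O x + Z.s (Z.idx x) i x, ⟨fun i x hi => ?_, fun i j x hi hj => ?_⟩⟩
  · simp only [id] at hi
    obtain ⟨D, hD, hDU⟩ := hB x (Z.U i) ((Z.isOpen_U i).mem_nhds hi)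
    filter_upwards [hD] with y hy
    have hx : x ∈ D.carrier := mem_of_mem_nhds hD
    obtain ⟨δ, hδ0, hδ1, hδ, -⟩ := D.exists_path hx hy
    have hxy : (Quotient.mk S x) = (Quotient.mk S y) := Quotient.sound (s := S) ⟨δ, hδ0, hδ1⟩
    have hsec : Z.IsSection δ (fun j t => Z.s i j (δ t)) := by
      refine ⟨fun j t hj => ?_, fun j k t hj hk => ?_⟩
      · exact (δ.continuous.tendsto t).eventually (Z.s_loc i j _ (hDU (hδ t)) hj)
      · exact (Z.s_add i j k _ (hDU (hδ t)) hj hk).symm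
    have hδW := hW δ _ hsec
    have hcyc : pathCls (γ x) 0 1 + pathCls δ 0 1 + pathCls (γ y) 0 1 = 0 := by
      have : pathCls (γ x) 0 1 + pathCls δ 0 1 + pathCls (γ y) 0 1 ∈ LinearMap.ker (bdry B) := by
        rw [LinearMap.mem_ker, map_add, map_add, bdry_pathCls, bdry_pathCls, bdry_pathCls,
          hγ0, hγ1, hγ0, hγ1, hδ0, hδ1, hxy]
        generalize Finsupp.single x (1 : ZMod 2) = a
        generalize Finsupp.single y (1 : ZMod 2) = b
        generalize Finsupp.single (Quotient.mk S y).out (1 : ZMod 2) = e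
        have h1 := ZModModule.add_self a
        have h2 := ZModModule.add_self b
        have h3 := ZModModule.add_self e
        have : a + e + (b + a) + (b + e) = (a + a) + (b + b) + (e + e) := by abel
        rw [this, h1, h2, h3]; simp
      rw [hker] at this
      exact this
    have hO := congrArg W hcyc
    rw [map_add, map_add, map_zero, hδW] at hO
    simp only [monodromy, hδ0, hδ1] at hO
    rw [Z.s_symm (hDU hy) (Z.mem_idx y), Z.s_symm hi (Z.mem_idx x)] at hO
    change O x + _ + O y = 0 at hO
    revert hO
    generalize O x = a
    generalize O y = b
    generalize Z.s (Z.idx x) i x = e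
    generalize Z.s (Z.idx y) i y = f
    revert a b e f
    decide
  · simp only [id] at hi hj ⊢
    rw [add_assoc, Z.s_add _ _ _ _ (Z.mem_idx x) hi hj]

end SignCocycle
end Cocycles
/-! ### Slice charts and orientations -/

section SliceCharts

open Topology Filter

variable {S : Set C2} {φ ψ χ : OpenPartialHomeomorph C2 (Fin 4 → ℝ)} {x : C2}

/-- The derivative of the transition map between two charts. -/
noncomputable def transitionMap (φ ψ : OpenPartialHomeomorph C2 (Fin 4 → ℝ)) (x : C2) :
    (Fin 4 → ℝ) →L[ℝ] (Fin 4 → ℝ) :=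
  fderiv ℝ (fun y => ψ (φ.symm y)) (φ x)

namespace IsSliceChart

lemma contDiffAt (h : IsSliceChart S φ) (hx : x ∈ φ.source) : ContDiffAt ℝ ∞ φ x :=
  h.smooth.contDiffAt (φ.open_source.mem_nhds hx)

lemma contDiffAt_symm (h : IsSliceChart S φ) {y : Fin 4 → ℝ} (hy : y ∈ φ.target) :
    ContDiffAt ℝ ∞ φ.symm y :=
  h.smooth_symm.contDiffAt (φ.open_target.mem_nhds hy)

lemma contDiffAt_transition (hφ : IsSliceChart S φ) (hψ : IsSliceChart S ψ) (hx : x ∈ φ.source)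
    (hx' : x ∈ ψ.source) : ContDiffAt ℝ ∞ (fun y => ψ (φ.symm y)) (φ x) := by
  have h1 := hφ.contDiffAt_symm (φ.map_source hx)
  have h2 : ContDiffAt ℝ ∞ ψ (φ.symm (φ x)) := by
    rw [φ.left_inv hx]; exact hψ.contDiffAt hx'
  exact h2.comp _ h1

lemma hasFDerivAt_transition (hφ : IsSliceChart S φ) (hψ : IsSliceChart S ψ) (hx : x ∈ φ.source)
    (hx' : x ∈ ψ.source) :
    HasFDerivAt (fun y => ψ (φ.symm y)) (transitionMap φ ψ x) (φ x) :=
  ((hφ.contDiffAt_transition hψ hx hx').differentiableAt (by simp)).hasFDerivAt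

lemma transitionMap_comp (hφ : IsSliceChart S φ) (hψ : IsSliceChart S ψ) (hχ : IsSliceChart S χ)
    (h1 : x ∈ φ.source) (h2 : x ∈ ψ.source) (h3 : x ∈ χ.source) :
    transitionMap φ χ x = (transitionMap ψ χ x).comp (transitionMap φ ψ x) := by
  have d1 := hφ.hasFDerivAt_transition hψ h1 h2
  have d2 := hψ.hasFDerivAt_transition hχ h2 h3
  have d2' : HasFDerivAt (fun y => χ (ψ.symm y)) (transitionMap ψ χ x) (ψ (φ.symm (φ x))) := by
    rwa [φ.left_inv h1]
  have d3 := d2'.comp (φ x) d1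
  refine HasFDerivAt.unique ?_ d3
  refine (hφ.hasFDerivAt_transition hχ h1 h3).congr_of_eventuallyEq ?_
  have hc : ContinuousAt φ.symm (φ x) := φ.continuousAt_symm (φ.map_source h1)
  have : ∀ᶠ y in 𝓝 (φ x), φ.symm y ∈ ψ.source :=
    hc.eventually (by rw [φ.left_inv h1]; exact ψ.open_source.mem_nhds h2)
  filter_upwards [this] with y hy
  simp [ψ.left_inv hy]

lemma transitionMap_self (hφ : IsSliceChart S φ) (h1 : x ∈ φ.source) :
    transitionMap φ φ x = ContinuousLinearMap.id ℝ _ := by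
  refine HasFDerivAt.unique (hφ.hasFDerivAt_transition hφ h1 h1)
    ((hasFDerivAt_id _).congr_of_eventuallyEq ?_)
  filter_upwards [φ.open_target.mem_nhds (φ.map_source h1)] with y hy
  simp [φ.right_inv hy]

/-- A curve in the surface, starting at a point of a chart, has a velocity tangent to the
coordinate plane. -/
lemma deriv_normal_eq_zero (hψ : IsSliceChart S ψ) {δ : ℝ → C2} (hS : ∀ᶠ t in 𝓝[≥] 0, δ t ∈ S)
    (hδ0 : δ 0 ∈ ψ.source) (hc : ContinuousWithinAt δ (Set.Ici 0) 0) {v : Fin 4 → ℝ}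
    (hv : HasDerivWithinAt (fun t => ψ (δ t)) v (Set.Ici 0) 0) : v 2 = 0 ∧ v 3 = 0 := by
  have hs : ∀ᶠ t in 𝓝[≥] (0 : ℝ), δ t ∈ ψ.source :=
    hc.eventually (ψ.open_source.mem_nhds hδ0)
  have key : ∀ i : Fin 4, (i = 2 ∨ i = 3) → v i = 0 := by
    intro i hi
    have h1 : HasDerivWithinAt (fun t => ψ (δ t) i) (v i) (Set.Ici 0) 0 :=
      (hasDerivWithinAt_pi.1 hv) i
    have h2 : (fun t => ψ (δ t) i) =ᶠ[𝓝[≥] (0 : ℝ)] fun _ => 0 := by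
      filter_upwards [hs, hS] with t h1 h2
      have := (hψ.mem_iff _ h1).1 h2
      rcases hi with rfl | rfl
      · exact this.2.1
      · exact this.2.2
    have h3 : HasDerivWithinAt (fun t => ψ (δ t) i) 0 (Set.Ici 0) 0 :=
      (hasDerivWithinAt_const (0 : ℝ) (Set.Ici 0) (0 : ℝ)).congr_of_eventuallyEq h2
        (h2.eq_of_nhdsWithin (Set.mem_Ici.2 le_rfl))
    exact (uniqueDiffWithinAt_Ici (0 : ℝ)).eq_deriv _ h1 h3
  exact ⟨key 2 (Or.inl rfl), key 3 (Or.inr rfl)⟩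

lemma transitionMap_tangent (hφ : IsSliceChart S φ) (hψ : IsSliceChart S ψ) (hxS : x ∈ S)
    (h1 : x ∈ φ.source) (h2 : x ∈ ψ.source) (j : Fin 4) (hj : j = 0 ∨ j = 1) :
    transitionMap φ ψ x (Pi.single j 1) 2 = 0 ∧ transitionMap φ ψ x (Pi.single j 1) 3 = 0 := by
  let l : ℝ → Fin 4 → ℝ := fun t => φ x + t • Pi.single j 1
  have hl : HasDerivAt l (Pi.single j 1) 0 := by
    have h := ((hasDerivAt_id (0 : ℝ)).smul_const (Pi.single j (1 : ℝ) : Fin 4 → ℝ)).const_add (φ x)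
    rwa [one_smul] at h
  have hl0 : l 0 = φ x := by simp [l]
  have hlt : ∀ᶠ t in 𝓝 (0 : ℝ), l t ∈ φ.target :=
    hl.continuousAt.eventually (by rw [hl0]; exact φ.open_target.mem_nhds (φ.map_source h1))
  have hd : HasDerivAt (fun t => ψ (φ.symm (l t))) (transitionMap φ ψ x (Pi.single j 1)) 0 := by
    have := hφ.hasFDerivAt_transition hψ h1 h2
    rw [← hl0] at this
    exact this.comp_hasDerivAt 0 hl
  have hx := (hφ.mem_iff x h1).1 hxS
  refine hψ.deriv_normal_eq_zero (δ := fun t => φ.symm (l t)) ?_ ?_ ?_ hd.hasDerivWithinAt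
  · have h0 : ∀ᶠ t in 𝓝[≥] (0 : ℝ), 0 ≤ t := eventually_mem_nhdsWithin
    filter_upwards [hlt.filter_mono nhdsWithin_le_nhds, h0] with t ht ht0
    rw [hφ.mem_iff _ (φ.map_target ht), φ.right_inv ht]
    rcases hj with rfl | rfl <;> (simp [l, hx.1, hx.2.1, hx.2.2]; try linarith [hx.1])
  · simp only [hl0, φ.left_inv h1]; exact h2
  · have hc : ContinuousAt φ.symm (l 0) := by
      rw [hl0]; exact φ.continuousAt_symm (φ.map_source h1)
    exact (hc.comp hl.continuousAt).continuousWithinAt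

end IsSliceChart

/-- If `A` maps the plane of the coordinates `0, 1` to itself, then the minors of `A` and `B` that
belong to this plane are multiplicative. -/
lemma planeDet_comp {A B : (Fin 4 → ℝ) →L[ℝ] (Fin 4 → ℝ)}
    (hA : ∀ j : Fin 4, (j = 0 ∨ j = 1) → A (Pi.single j 1) 2 = 0 ∧ A (Pi.single j 1) 3 = 0) :
    (Matrix.of fun i j : Fin 2 => (B.comp A) (Pi.single (Fin.castLE (by norm_num) j) 1)
      (Fin.castLE (by norm_num) i : Fin 4)).det =
    (Matrix.of fun i j : Fin 2 => B (Pi.single (Fin.castLE (by norm_num) j) 1)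
      (Fin.castLE (by norm_num) i : Fin 4)).det *
    (Matrix.of fun i j : Fin 2 => A (Pi.single (Fin.castLE (by norm_num) j) 1)
      (Fin.castLE (by norm_num) i : Fin 4)).det := by
  rw [← Matrix.det_mul]
  congr 1
  ext i j
  simp only [Matrix.of_apply, Matrix.mul_apply, Fin.sum_univ_two, ContinuousLinearMap.comp_apply]
  have hj : (Fin.castLE (by norm_num : 2 ≤ 4) j) = 0 ∨
      (Fin.castLE (by norm_num : 2 ≤ 4) j) = 1 := by
    fin_cases j <;> simp
  obtain ⟨h2, h3⟩ := hA _ hj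
  set v := A (Pi.single (Fin.castLE (by norm_num : 2 ≤ 4) j) 1) with hv
  have : v = v 0 • Pi.single 0 1 + v 1 • Pi.single 1 1 := by
    ext k
    fin_cases k <;> simp [h2, h3]
  conv_lhs => rw [this]
  rw [map_add, map_smul, map_smul]
  simp only [Pi.add_apply, Pi.smul_apply, smul_eq_mul]
  simp
  ring

namespace IsSliceChart

lemma transitionDet_eq (φ ψ : OpenPartialHomeomorph C2 (Fin 4 → ℝ)) (x : C2) :
    transitionDet φ ψ x = (Matrix.of fun i j : Fin 2 =>
      transitionMap φ ψ x (Pi.single (Fin.castLE (by norm_num) j) 1)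
      (Fin.castLE (by norm_num) i : Fin 4)).det := rfl

lemma transitionDet_mul (hφ : IsSliceChart S φ) (hψ : IsSliceChart S ψ) (hχ : IsSliceChart S χ)
    (hxS : x ∈ S) (h1 : x ∈ φ.source) (h2 : x ∈ ψ.source) (h3 : x ∈ χ.source) :
    transitionDet φ χ x = transitionDet ψ χ x * transitionDet φ ψ x := by
  rw [transitionDet_eq, hφ.transitionMap_comp hψ hχ h1 h2 h3, planeDet_comp]
  · rfl
  · exact hφ.transitionMap_tangent hψ hxS h1 h2

lemma transitionDet_self (hφ : IsSliceChart S φ) (h1 : x ∈ φ.source) :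
    transitionDet φ φ x = 1 := by
  rw [transitionDet_eq, hφ.transitionMap_self h1, Matrix.det_fin_two]
  simp

lemma transitionDet_ne_zero (hφ : IsSliceChart S φ) (hψ : IsSliceChart S ψ)
    (hxS : x ∈ S) (h1 : x ∈ φ.source) (h2 : x ∈ ψ.source) : transitionDet φ ψ x ≠ 0 := by
  have h := hφ.transitionDet_mul hψ hφ hxS h1 h2 h1
  rw [hφ.transitionDet_self h1] at h
  exact fun h0 => by rw [h0, mul_zero] at h; exact one_ne_zero h

lemma continuousAt_transitionDet (hφ : IsSliceChart S φ) (hψ : IsSliceChart S ψ)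
    (h1 : x ∈ φ.source) (h2 : x ∈ ψ.source) : ContinuousAt (transitionDet φ ψ) x := by
  have hT : ContinuousAt (transitionMap φ ψ) x := by
    have := (hφ.contDiffAt_transition hψ h1 h2).fderiv_right (m := 0) (by simp)
    exact ContinuousAt.comp (f := φ) (g := fderiv ℝ fun y => ψ (φ.symm y))
      this.continuousAt (φ.continuousAt h1)
  have he : ∀ j i : Fin 4, ContinuousAt (fun x => transitionMap φ ψ x (Pi.single j 1) i) x := by
    intro j i
    have h3 : ContinuousAt (fun x => transitionMap φ ψ x (Pi.single j 1)) x :=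
      hT.clm_apply continuousAt_const
    exact (continuous_apply i).continuousAt.comp h3
  have : transitionDet φ ψ = fun x => transitionMap φ ψ x (Pi.single 0 1) 0 *
      transitionMap φ ψ x (Pi.single 1 1) 1 - transitionMap φ ψ x (Pi.single 1 1) 0 *
      transitionMap φ ψ x (Pi.single 0 1) 1 := by
    ext x
    rw [transitionDet_eq, Matrix.det_fin_two]
    rfl
  rw [this]
  exact ((he _ _).mul (he _ _)).sub ((he _ _).mul (he _ _))

/-- A slice chart restricted to a smaller open set. -/
lemma restrOpen (hφ : IsSliceChart S φ) (V : Set C2) (hV : IsOpen V) :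
    IsSliceChart S (φ.restrOpen V hV) where
  smooth := hφ.smooth.mono fun _ hz => hz.1
  smooth_symm := hφ.smooth_symm.mono fun _ hz => hz.1
  ball_iff z hz := hφ.ball_iff z hz.1
  mem_iff z hz := hφ.mem_iff z hz.1

/-- The reflection of `ℝ⁴` in the second coordinate. -/
def flipHomeo : (Fin 4 → ℝ) ≃ₜ (Fin 4 → ℝ) where
  toFun y i := (![1, -1, 1, 1] : Fin 4 → ℝ) i * y i
  invFun y i := (![1, -1, 1, 1] : Fin 4 → ℝ) i * y i
  left_inv y := by ext i; fin_cases i <;> simp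
  right_inv y := by ext i; fin_cases i <;> simp
  continuous_toFun := by fun_prop
  continuous_invFun := by fun_prop

lemma contDiff_flipHomeo : ContDiff ℝ ∞ flipHomeo := by
  rw [contDiff_pi]
  intro i
  exact contDiff_const.mul (contDiff_apply ℝ ℝ i)

/-- A slice chart composed with the reflection that reverses the orientation of the surface. -/
lemma flip (hφ : IsSliceChart S φ) : IsSliceChart S (φ.transHomeomorph flipHomeo) where
  smooth := contDiff_flipHomeo.comp_contDiffOn hφ.smooth
  smooth_symm := by
    refine hφ.smooth_symm.comp contDiff_flipHomeo.contDiffOn ?_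
    intro y hy
    exact hy
  ball_iff z hz := by
    rw [hφ.ball_iff z hz]
    simp [flipHomeo]
  mem_iff z hz := by
    rw [hφ.mem_iff z hz]
    simp [flipHomeo]

lemma transitionDet_flip (h1 : x ∈ φ.source) :
    transitionDet φ (φ.transHomeomorph flipHomeo) x = -1 := by
  have h : transitionMap φ (φ.transHomeomorph flipHomeo) x =
      fderiv ℝ flipHomeo (φ x) := by
    unfold transitionMap
    apply Filter.EventuallyEq.fderiv_eq
    filter_upwards [φ.open_target.mem_nhds (φ.map_source h1)] with y hy
    simp [φ.right_inv hy]
  have h2 : ∀ j i : Fin 4, fderiv ℝ flipHomeo (φ x) (Pi.single j 1) i =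
      (![1, -1, 1, 1] : Fin 4 → ℝ) i * (Pi.single j 1 : Fin 4 → ℝ) i := by
    intro j i
    let L : (Fin 4 → ℝ) →L[ℝ] (Fin 4 → ℝ) := ContinuousLinearMap.pi fun i =>
      (![1, -1, 1, 1] : Fin 4 → ℝ) i • ContinuousLinearMap.proj (R := ℝ) (φ := fun _ => ℝ) i
    have : (flipHomeo : (Fin 4 → ℝ) → _) = L := by
      ext y i; simp [L, flipHomeo]
    rw [this, L.fderiv]
    simp [L]
  rw [transitionDet_eq, h, Matrix.det_fin_two]
  simp [h2]

end IsSliceChart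

/-- The cocycle of signs of the transition determinants, which describes the orientation double
cover of a surface. -/
noncomputable def orientationCocycle (hS : ∀ x ∈ S, ∃ φ, IsSliceChart S φ ∧ x ∈ φ.source) :
    SignCocycle {φ : OpenPartialHomeomorph C2 (Fin 4 → ℝ) // IsSliceChart S φ} S where
  U φ := {x | x.1 ∈ φ.1.source}
  isOpen_U φ := φ.1.open_source.preimage continuous_subtype_val
  idx x := ⟨(hS x.1 x.2).choose, (hS x.1 x.2).choose_spec.1⟩
  mem_idx x := (hS x.1 x.2).choose_spec.2
  s φ ψ x := if 0 < transitionDet φ.1 ψ.1 x.1 then 0 else 1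
  s_self φ x hx := by simp [φ.2.transitionDet_self hx]
  s_add φ ψ χ x h1 h2 h3 := by
    rw [φ.2.transitionDet_mul ψ.2 χ.2 x.2 h1 h2 h3]
    have ha := φ.2.transitionDet_ne_zero ψ.2 x.2 h1 h2
    have hb := ψ.2.transitionDet_ne_zero χ.2 x.2 h2 h3
    rcases lt_or_gt_of_ne ha with ha | ha <;> rcases lt_or_gt_of_ne hb with hb | hb
    · simp [mul_pos_of_neg_of_neg hb ha, ha.not_gt, hb.not_gt]; decide
    · simp [(mul_neg_of_pos_of_neg hb ha).not_gt, ha.not_gt, hb]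
    · simp [(mul_neg_of_neg_of_pos hb ha).not_gt, ha, hb.not_gt]
    · simp [mul_pos hb ha, ha, hb]
  s_loc φ ψ x h1 h2 := by
    have hc : ContinuousAt (fun y : S => transitionDet φ.1 ψ.1 y.1) x :=
      (φ.2.continuousAt_transitionDet ψ.2 h1 h2).comp continuous_subtype_val.continuousAt
    rcases lt_or_gt_of_ne (φ.2.transitionDet_ne_zero ψ.2 x.2 h1 h2) with h | h
    · filter_upwards [hc.eventually (gt_mem_nhds h)] with y hy
      simp [h.not_gt, hy.not_gt]
    · filter_upwards [hc.eventually (lt_mem_nhds h)] with y hy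
      simp [h, hy]

/-- A global section of the orientation double cover gives an oriented atlas. -/
lemma isOrientable_of_section (hS : ∀ x ∈ S, ∃ φ, IsSliceChart S φ ∧ x ∈ φ.source)
    (o : {φ : OpenPartialHomeomorph C2 (Fin 4 → ℝ) // IsSliceChart S φ} → S → ZMod 2)
    (ho : (orientationCocycle hS).IsSection id o) : IsOrientable S := by
  refine ⟨{φ | ∃ h : IsSliceChart S φ, ∀ x (hx : x ∈ S), x ∈ φ.source → o ⟨φ, h⟩ ⟨x, hx⟩ = 0},
    fun φ h => h.1, fun x hx => ?_, ?_⟩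
  · obtain ⟨φ, hφ, hxφ⟩ := hS x hx
    obtain ⟨V, hV, hVo⟩ : ∃ V ∈ 𝓝 x, ∀ y (hy : y ∈ S), y ∈ V →
        o ⟨φ, hφ⟩ ⟨y, hy⟩ = o ⟨φ, hφ⟩ ⟨x, hx⟩ := by
      have h := ho.loc ⟨φ, hφ⟩ ⟨x, hx⟩ hxφ
      rw [nhds_subtype_eq_comap, Filter.eventually_comap] at h
      exact ⟨_, h, fun y hy hyV => hyV ⟨y, hy⟩ rfl⟩
    obtain ⟨V', hV', hVopen, hxV⟩ := mem_nhds_iff.1 hV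
    have hφ' := hφ.restrOpen V' hVopen
    set φ' := φ.restrOpen V' hVopen with hφ'def
    have ho' : ∀ y (hy : y ∈ S), y ∈ φ'.source → o ⟨φ', hφ'⟩ ⟨y, hy⟩ = o ⟨φ, hφ⟩ ⟨x, hx⟩ := by
      intro y hy hyφ
      have h := ho.trans ⟨φ, hφ⟩ ⟨φ', hφ'⟩ ⟨y, hy⟩ hyφ.1 hyφ
      have hd : transitionDet φ φ' y = 1 := hφ.transitionDet_self hyφ.1
      have hs : (orientationCocycle hS).s ⟨φ, hφ⟩ ⟨φ', hφ'⟩ ⟨y, hy⟩ = 0 := by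
        simp [orientationCocycle, hd]
      rw [h, id, hs, add_zero, hVo y hy (hV' hyφ.2)]
    rcases (by decide : ∀ z : ZMod 2, z = 0 ∨ z = 1) (o ⟨φ, hφ⟩ ⟨x, hx⟩) with h0 | h1
    · exact ⟨φ', ⟨hφ', fun y hy hyφ => (ho' y hy hyφ).trans h0⟩, ⟨hxφ, hxV⟩⟩
    · refine ⟨φ'.transHomeomorph IsSliceChart.flipHomeo, ⟨hφ'.flip, fun y hy hyφ => ?_⟩,
        ⟨hxφ, hxV⟩⟩
      have h := ho.trans ⟨φ', hφ'⟩ ⟨_, hφ'.flip⟩ ⟨y, hy⟩ hyφ hyφ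
      have hs : (orientationCocycle hS).s ⟨φ', hφ'⟩ ⟨_, hφ'.flip⟩ ⟨y, hy⟩ = 1 := by
        have hd := IsSliceChart.transitionDet_flip (φ := φ') (x := y) hyφ
        simp only [orientationCocycle, hd]
        norm_num
      rw [h, id, hs, ho' y hy hyφ, h1]
      decide
  · rintro φ ⟨hφ, h1⟩ ψ ⟨hψ, h2⟩ x hx hxφ hxψ
    have h := ho.trans ⟨φ, hφ⟩ ⟨ψ, hψ⟩ ⟨x, hx⟩ hxφ hxψ
    rw [h1 x hx hxφ, h2 x hx hxψ, zero_add] at h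
    by_contra hcon
    simp [orientationCocycle, hcon] at h

/-- A surface has small neighbourhoods that are retracts of the plane. -/
lemma exists_planeRetract (hS : ∀ x ∈ S, ∃ φ, IsSliceChart S φ ∧ x ∈ φ.source) (x : S)
    (U : Set S) (hU : U ∈ 𝓝 x) : ∃ D : PlaneRetract S, D.carrier ∈ 𝓝 x ∧ D.carrier ⊆ U := by
  obtain ⟨φ, hφ, hxφ⟩ := hS x.1 x.2
  rw [nhds_subtype_eq_comap, Filter.mem_comap] at hU
  obtain ⟨V, hV, hVU⟩ := hU
  set c := φ x with hc
  have hcS := (hφ.mem_iff x hxφ).1 x.2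
  have hct : c ∈ φ.target := φ.map_source hxφ
  have hV' : φ.target ∩ φ.symm ⁻¹' V ∈ 𝓝 c := by
    refine Filter.inter_mem (φ.open_target.mem_nhds hct) ?_
    exact φ.continuousAt_symm hct (by rw [hc, φ.left_inv hxφ]; exact hV)
  obtain ⟨r, hr, hball⟩ := Metric.nhds_basis_closedBall.mem_iff.1 hV'
  -- the clamped coordinates
  let q : ℝ × ℝ → Fin 4 → ℝ := fun z =>
    ![max 0 (max (c 0 - r) (min z.1 (c 0 + r))), max (c 1 - r) (min z.2 (c 1 + r)), 0, 0]
  have hq : Continuous q := by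
    refine continuous_pi fun i => ?_
    fin_cases i <;> simp [q] <;> fun_prop
  have hqr : ∀ z, q z ∈ Metric.closedBall c r := by
    intro z
    rw [Metric.mem_closedBall, dist_pi_le_iff hr.le]
    have hz1 : |max (c 0 - r) (min z.1 (c 0 + r)) - c 0| ≤ r := by
      rw [abs_le]
      constructor
      · linarith [le_max_left (c 0 - r) (min z.1 (c 0 + r))]
      · have : max (c 0 - r) (min z.1 (c 0 + r)) ≤ c 0 + r :=
          max_le (by linarith) (min_le_right _ _)
        linarith
    have hz2 : |max (c 1 - r) (min z.2 (c 1 + r)) - c 1| ≤ r := by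
      rw [abs_le]
      constructor
      · linarith [le_max_left (c 1 - r) (min z.2 (c 1 + r))]
      · have : max (c 1 - r) (min z.2 (c 1 + r)) ≤ c 1 + r :=
          max_le (by linarith) (min_le_right _ _)
        linarith
    have hc0 : 0 ≤ c 0 := hcS.1
    intro i
    rw [Real.dist_eq]
    fin_cases i
    · change |max 0 (max (c 0 - r) (min z.1 (c 0 + r))) - c 0| ≤ r
      rw [abs_le] at hz1 ⊢
      constructor
      · linarith [le_max_right 0 (max (c 0 - r) (min z.1 (c 0 + r))), hz1.1]
      · have : max 0 (max (c 0 - r) (min z.1 (c 0 + r))) ≤ c 0 + r :=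
          max_le (by linarith) (by linarith)
        linarith
    · exact hz2
    · change |0 - c 2| ≤ r
      rw [show c 2 = 0 from hcS.2.1]; simpa using hr.le
    · change |0 - c 3| ≤ r
      rw [show c 3 = 0 from hcS.2.2]; simpa using hr.le
  have hqt : ∀ z, q z ∈ φ.target := fun z => (hball (hqr z)).1
  have hqS : ∀ z, φ.symm (q z) ∈ S := by
    intro z
    rw [hφ.mem_iff _ (φ.map_target (hqt z)), φ.right_inv (hqt z)]
    refine ⟨?_, rfl, rfl⟩
    change 0 ≤ max 0 _
    exact le_max_left _ _
  let f : C(ℝ × ℝ, S) := ⟨fun z => ⟨φ.symm (q z), hqS z⟩,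
    Continuous.subtype_mk (φ.continuousOn_symm.comp_continuous hq hqt) _⟩
  let g : S → ℝ × ℝ := fun s => (φ s 0, φ s 1)
  have hmem : ∀ s : S, s.1 ∈ φ.source → φ s ∈ Metric.closedBall c r → f (g s) = s := by
    intro s hs hsr
    rw [Metric.mem_closedBall, dist_pi_le_iff hr.le] at hsr
    have h0 := hsr 0
    have h1 := hsr 1
    rw [Real.dist_eq, abs_le] at h0 h1
    have hsS := (hφ.mem_iff s hs).1 s.2
    have : q (g s) = φ s := by
      ext i
      fin_cases i
      · change max 0 (max (c 0 - r) (min (φ s 0) (c 0 + r))) = φ s 0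
        rw [min_eq_left (by linarith), max_eq_right (a := c 0 - r) (by linarith),
          max_eq_right hsS.1]
      · change max (c 1 - r) (min (φ s 1) (c 1 + r)) = φ s 1
        rw [min_eq_left (by linarith), max_eq_right (by linarith)]
      · exact hsS.2.1.symm
      · exact hsS.2.2.symm
    ext1
    change φ.symm (q (g s)) = s
    rw [this, φ.left_inv hs]
  refine ⟨⟨f, g, ?_, ?_⟩, ?_, ?_⟩
  · rintro _ ⟨z, rfl⟩
    have hcont : ContinuousAt (fun s : S => φ s) (f z) :=
      ContinuousAt.comp (f := Subtype.val) (x := f z) (φ.continuousAt (φ.map_target (hqt z)))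
        continuous_subtype_val.continuousAt
    exact (((continuous_apply 0).continuousAt.comp hcont).prodMk
      ((continuous_apply 1).continuousAt.comp hcont)).continuousWithinAt
  · rintro _ ⟨z, rfl⟩
    refine hmem _ (φ.map_target (hqt z)) ?_
    change φ (φ.symm (q z)) ∈ _
    rw [φ.right_inv (hqt z)]
    exact hqr z
  · have hcont : ContinuousAt (fun s : S => φ s) x :=
      (φ.continuousAt hxφ).comp continuous_subtype_val.continuousAt
    filter_upwards [hcont.eventually (Metric.closedBall_mem_nhds c hr),
      continuous_subtype_val.continuousAt.eventually (φ.open_source.mem_nhds hxφ)] with s h1 h2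
    exact ⟨g s, hmem s h2 h1⟩
  · rintro _ ⟨z, rfl⟩
    exact hVU (hball (hqr z)).2

/-- A compact nonorientable surface has nontrivial first mod 2 homology of finite dimension. -/
theorem one_le_bettiOne (hS : IsProperSurface S) (hno : ¬ IsOrientable S) : 1 ≤ bettiOne S := by
  rw [bettiOne_eq]
  have : CompactSpace S := isCompact_iff_compactSpace.1 hS.compact
  have hfin := finiteDimensional_ker_bdry (X := S) (exists_planeRetract hS.chart)
  rw [Nat.one_le_iff_ne_zero]
  intro h0
  have hbot : LinearMap.ker (bdry S) = ⊥ := by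
    rw [Module.finrank_zero_iff] at h0
    exact (Submodule.subsingleton_iff_eq_bot).1 h0
  obtain ⟨o, ho⟩ := (orientationCocycle hS.chart).exists_global_section
    (exists_planeRetract hS.chart) hbot
  exact hno (isOrientable_of_section hS.chart o ho)

end SliceCharts
/-! ### The universal cover of the Möbius band -/

section Mobius

open Topology Filter

instance : CompactSpace MobiusBand := inferInstanceAs (CompactSpace (Quot _))

/-- The map `(s, v) ↦ (s mod 1, v e^{πis})`, whose restriction to `|v| ≤ 1` parametrizes a Möbius
band. -/
noncomputable def twist (s v : ℝ) : AddCircle (1 : ℝ) × ℂ :=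
  ((s : AddCircle (1 : ℝ)), v * Complex.exp (Real.pi * s * Complex.I))

lemma continuous_twist : Continuous fun z : ℝ × ℝ => twist z.1 z.2 := by
  have : Continuous fun z : ℝ × ℝ => (z.1 : AddCircle (1 : ℝ)) :=
    (AddCircle.continuous_mk' 1).comp continuous_fst
  exact this.prodMk (by fun_prop)

lemma twist_eq_iff (s v s' v' : ℝ) :
    twist s v = twist s' v' ↔ ∃ n : ℤ, s' = s + n ∧ v' = (-1) ^ n * v := by
  have hexp : ∀ n : ℤ, Complex.exp (Real.pi * ((s + n : ℝ) : ℂ) * Complex.I) =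
      (-1) ^ n * Complex.exp (Real.pi * s * Complex.I) := by
    intro n
    have : (Real.pi * ((s + n : ℝ) : ℂ) * Complex.I) =
        n * (Real.pi * Complex.I) + Real.pi * s * Complex.I := by push_cast; ring
    rw [this, Complex.exp_add, Complex.exp_int_mul, Complex.exp_pi_mul_I]
  have h1 : ∀ n : ℤ, ((-1 : ℂ) ^ n) * (-1) ^ n = 1 := fun n => by
    rw [← mul_zpow]; simp
  have h1' : ∀ n : ℤ, ((-1 : ℝ) ^ n) * (-1) ^ n = 1 := fun n => by
    rw [← mul_zpow]; simp
  have key : ∀ n : ℤ, twist (s + n) v' = twist s ((-1) ^ n * v') := by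
    intro n
    unfold twist
    refine Prod.ext ?_ ?_
    · change ((s + n : ℝ) : AddCircle (1 : ℝ)) = s
      rw [AddCircle.coe_add, add_eq_left, AddCircle.coe_eq_zero_iff]; exact ⟨n, by simp⟩
    · change (v' : ℂ) * Complex.exp (Real.pi * ((s + n : ℝ) : ℂ) * Complex.I) = _
      rw [hexp]
      push_cast
      ring
  constructor
  · intro h
    obtain ⟨n, hn⟩ := AddCircle.coe_eq_zero_iff (1 : ℝ) |>.1
      (show ((s' - s : ℝ) : AddCircle (1 : ℝ)) = 0 by
        rw [AddCircle.coe_sub, sub_eq_zero]; exact (congrArg Prod.fst h).symm)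
    have hs : s' = s + n := by simp at hn; linarith
    refine ⟨n, hs, ?_⟩
    rw [hs, key] at h
    have h2 := congrArg Prod.snd h
    simp only [twist] at h2
    have h3 := mul_right_cancel₀ (Complex.exp_ne_zero _) h2
    have h4 : v = (-1) ^ n * v' := by exact_mod_cast h3
    rw [h4, ← mul_assoc, h1', one_mul]
  · rintro ⟨n, rfl, rfl⟩
    rw [key, ← mul_assoc, h1', one_mul]

/-- The embedding of the Möbius band given by `twist`. -/
noncomputable def mobiusEmb : MobiusBand → AddCircle (1 : ℝ) × ℂ :=
  Quot.lift (fun a => twist a.1 (2 * a.2 - 1)) (by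
    rintro ⟨a, b⟩ ⟨a', b'⟩ ⟨h1, h2, h3⟩
    simp only at h1 h2 h3
    subst h1 h2 h3
    rw [twist_eq_iff]
    refine ⟨1, by simp, ?_⟩
    simp
    ring)

lemma continuous_mobiusEmb : Continuous mobiusEmb := by
  have h : Continuous fun a : unitInterval × unitInterval => twist a.1 (2 * a.2 - 1) :=
    continuous_twist.comp (f := fun a : unitInterval × unitInterval =>
      ((a.1 : ℝ), (2 * a.2 - 1 : ℝ))) (by fun_prop)
  exact continuous_coinduced_dom.2 h

lemma injective_mobiusEmb : Function.Injective mobiusEmb := by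
  rintro ⟨a, b⟩ ⟨a', b'⟩ h
  obtain ⟨n, hn, hb⟩ := (twist_eq_iff _ _ _ _).1 h
  have ha := a.2
  have ha' := a'.2
  have h1 : -1 ≤ n := by
    have : (-1 : ℝ) ≤ n := by linarith [ha.2, ha'.1]
    exact_mod_cast this
  have h2 : n ≤ 1 := by
    have : (n : ℝ) ≤ 1 := by linarith [ha.1, ha'.2]
    exact_mod_cast this
  interval_cases n
  · refine (Quot.sound ⟨?_, ?_, ?_⟩).symm
    · ext; push_cast at hn; simp only [Set.Icc.coe_zero]; linarith [ha.2, ha'.1]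
    · ext; push_cast at hn; simp only [Set.Icc.coe_one]; linarith [ha.2, ha'.1]
    · ext; simp at hb ⊢; linarith
  · have e1 : a = a' := by ext; simpa using hn.symm
    have e2 : b = b' := by ext; simp at hb; linarith
    rw [e1, e2]
  · refine Quot.sound ⟨?_, ?_, ?_⟩
    · ext; push_cast at hn; simp only [Set.Icc.coe_zero]; linarith [ha.1, ha'.2]
    · ext; push_cast at hn; simp only [Set.Icc.coe_one]; linarith [ha.1, ha'.2]
    · ext; simp at hb ⊢; linarith

lemma isClosedEmbedding_mobiusEmb : IsClosedEmbedding mobiusEmb :=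
  continuous_mobiusEmb.isClosedEmbedding injective_mobiusEmb

lemma twist_mem_range (s v : ℝ) (hv : |v| ≤ 1) : twist s v ∈ Set.range mobiusEmb := by
  have hw : |(-1) ^ ⌊s⌋ * v| ≤ 1 := by rw [abs_mul, abs_zpow]; simpa using hv
  rw [abs_le] at hw
  set w := (-1) ^ ⌊s⌋ * v with hwdef
  refine ⟨Quot.mk _ (⟨Int.fract s, Int.fract_nonneg s, (Int.fract_lt_one s).le⟩,
    ⟨(w + 1) / 2, by linarith [hw.1], by linarith [hw.2]⟩), ?_⟩
  change twist _ _ = _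
  rw [twist_eq_iff]
  refine ⟨⌊s⌋, (Int.fract_add_floor s).symm, ?_⟩
  simp only
  have : (2 * ((w + 1) / 2) - 1) = w := by ring
  rw [this, hwdef, ← mul_assoc, ← mul_zpow]
  simp

/-- The universal cover `Φ` of a Möbius band, as a map from the plane that is constant on vertical
half-lines outside of the strip `|v| ≤ 1`, with deck transformation `(s, v) ↦ (s + 1, -v)`. -/
structure MobiusCover (X : Type) [TopologicalSpace X] where
  /-- the covering map -/
  Φ : C(ℝ × ℝ, X)
  deck : ∀ s v, Φ (s + 1, -v) = Φ (s, v)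
  fiber : ∀ s v s' v', |v| ≤ 1 → |v'| ≤ 1 → Φ (s, v) = Φ (s', v') →
    ∃ n : ℤ, s' = s + n ∧ v' = (-1) ^ n * v
  lift : ∀ γ : C(ℝ, X), ∃ σ : C(ℝ, ℝ × ℝ), (∀ t, |(σ t).2| ≤ 1) ∧ ∀ t, Φ (σ t) = γ t

lemma exists_mobiusCover {X : Type} [TopologicalSpace X] (h : X ≃ₜ MobiusBand) :
    Nonempty (MobiusCover X) := by
  let e : MobiusBand ≃ₜ Set.range mobiusEmb :=
    isClosedEmbedding_mobiusEmb.isEmbedding.toHomeomorph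
  let cl : ℝ → ℝ := fun v => max (-1) (min v 1)
  have hcl : ∀ v, |cl v| ≤ 1 := fun v =>
    abs_le.2 ⟨le_max_left _ _, max_le (by norm_num) (min_le_right _ _)⟩
  have hcl' : ∀ v, |v| ≤ 1 → cl v = v := fun v hv => by
    rw [abs_le] at hv
    simp only [cl]
    rw [min_eq_left hv.2, max_eq_right hv.1]
  have hcln : ∀ v, cl (-v) = -cl v := fun v => by
    simp only [cl]
    rcases le_total v (-1) with h1 | h1
    · rw [min_eq_right (by linarith), max_eq_right (by norm_num), min_eq_left (by linarith),
        max_eq_left h1, neg_neg]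
    · rcases le_total v 1 with h2 | h2
      · rw [min_eq_left (by linarith), max_eq_right (by linarith), min_eq_left h2, max_eq_right h1]
      · rw [min_eq_left (by linarith), max_eq_left (by linarith), min_eq_right h2,
          max_eq_right (by norm_num)]
  let q : ℝ × ℝ → Set.range mobiusEmb := fun z => ⟨twist z.1 (cl z.2), twist_mem_range _ _ (hcl _)⟩
  have hq : Continuous q := Continuous.subtype_mk
    (continuous_twist.comp (f := fun z : ℝ × ℝ => (z.1, cl z.2)) (by fun_prop)) _
  let Φ : C(ℝ × ℝ, X) := ⟨fun z => h.symm (e.symm (q z)), by fun_prop⟩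
  have hΦ : ∀ z z', Φ z = Φ z' ↔ twist z.1 (cl z.2) = twist z'.1 (cl z'.2) := by
    intro z z'
    simp only [Φ, ContinuousMap.coe_mk, EmbeddingLike.apply_eq_iff_eq]
    exact Subtype.ext_iff
  have he : ∀ x z, twist z.1 (cl z.2) = mobiusEmb (h x) → Φ z = x := by
    intro x z hz
    simp only [Φ, ContinuousMap.coe_mk]
    rw [Homeomorph.symm_apply_eq, Homeomorph.symm_apply_eq]
    exact Subtype.ext hz
  have hrange : ∀ x : MobiusBand, ∃ s v, |v| ≤ 1 ∧ mobiusEmb x = twist s v := by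
    rintro ⟨a, b⟩
    refine ⟨a, 2 * b - 1, ?_, rfl⟩
    rw [abs_le]
    constructor <;> linarith [b.2.1, b.2.2]
  refine ⟨⟨Φ, fun s v => ?_, fun s v s' v' hv hv' heq => ?_, fun γ => ?_⟩⟩
  · rw [hΦ, hcln, eq_comm, twist_eq_iff]
    exact ⟨1, by simp, by simp⟩
  · rw [hΦ] at heq
    simp only [hcl' v hv, hcl' v' hv'] at heq
    exact (twist_eq_iff _ _ _ _).1 heq
  · let E : C(ℝ, AddCircle (1 : ℝ) × ℂ) :=
      ⟨fun t => mobiusEmb (h (γ t)), continuous_mobiusEmb.comp (h.continuous.comp γ.continuous)⟩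
    obtain ⟨s0, v0, -, h0⟩ := hrange (h (γ 0))
    obtain ⟨s, ⟨-, hs⟩, -⟩ := (AddCircle.isCoveringMap_coe (1 : ℝ)).existsUnique_continuousMap_lifts
      (⟨fun t => (E t).1, by fun_prop⟩ : C(ℝ, AddCircle (1 : ℝ))) 0 s0
      (congrArg Prod.fst h0).symm
    have hs' : ∀ t, ((s t : ℝ) : AddCircle (1 : ℝ)) = (E t).1 := fun t => congrFun hs t
    let v : ℝ → ℝ := fun t => ((E t).2 * Complex.exp (-(Real.pi * s t * Complex.I))).re
    have hv : ∀ t, |v t| ≤ 1 ∧ E t = twist (s t) (v t) := by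
      intro t
      obtain ⟨s1, v1, hv1, h1⟩ := hrange (h (γ t))
      obtain ⟨n, hn⟩ := AddCircle.coe_eq_zero_iff (1 : ℝ) |>.1
        (show ((s t - s1 : ℝ) : AddCircle (1 : ℝ)) = 0 by
          rw [AddCircle.coe_sub, sub_eq_zero, hs' t]; exact congrArg Prod.fst h1)
      have hst : s t = s1 + n := by simp at hn; linarith
      have h2 : twist s1 v1 = twist (s t) ((-1) ^ n * v1) := (twist_eq_iff _ _ _ _).2 ⟨n, hst, rfl⟩
      have h3 : E t = twist (s t) ((-1) ^ n * v1) := h1.trans h2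
      have h4 : v t = (-1) ^ n * v1 := by
        simp only [v, h3, twist]
        rw [mul_assoc, ← Complex.exp_add, add_neg_cancel, Complex.exp_zero, mul_one,
          Complex.ofReal_re]
      rw [h4]
      refine ⟨?_, h3⟩
      rw [abs_mul, abs_zpow]; simpa using hv1
    refine ⟨⟨fun t => (s t, v t), by fun_prop⟩, fun t => (hv t).1, fun t => he _ _ ?_⟩
    simp only [ContinuousMap.coe_mk, hcl' _ (hv t).1]
    exact (hv t).2.symm

variable {X : Type} [TopologicalSpace X]

lemma deck_zpow {P : ℝ × ℝ → Prop}
    (h : ∀ s v, P (s, v) ↔ P (s + 1, -v)) (n : ℤ) (s v : ℝ) :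
    P (s, v) ↔ P (s + n, (-1) ^ n * v) := by
  induction n using Int.induction_on with
  | zero => simp
  | succ k ih =>
    rw [ih, h]
    have : (-1 : ℝ) ^ ((k : ℤ) + 1) * v = -((-1) ^ (k : ℤ) * v) := by
      rw [zpow_add_one₀ (by norm_num)]; ring
    rw [this]; push_cast; rw [add_assoc]
  | pred k ih =>
    rw [ih, h (s + ((-(k : ℤ) - 1 : ℤ) : ℝ))]
    have : (-1 : ℝ) ^ (-(k : ℤ)) * v = -((-1) ^ (-(k : ℤ) - 1) * v) := by
      rw [zpow_sub_one₀ (by norm_num)]; ring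
    rw [this]; push_cast
    rw [show s + (-(k : ℝ) - 1) + 1 = s + -(k : ℝ) by ring]

/-- The first homology of a Möbius band is spanned by its core. -/
theorem MobiusCover.bettiOne_le_one (C : MobiusCover X) : bettiOne X ≤ 1 := by
  rw [bettiOne_eq]
  let c := pathCls C.Φ (0, 0) (1, 0)
  let V := Submodule.span (ZMod 2) {c}
  have hstep : ∀ s v, V.mkQ (pathCls C.Φ (s + 1, -v) (0, 0)) =
      V.mkQ (pathCls C.Φ (s, v) (0, 0)) := by
    intro s v
    have h1 : pathCls C.Φ (s + 1, -v) (1, 0) = pathCls C.Φ (s, v) (0, 0) := by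
      unfold pathCls
      congr 1
      ext a
      have ha : a.1 0 + a.1 1 = 1 := by simpa [Fin.sum_univ_two] using a.2.2
      simp only [ContinuousMap.comp_apply]
      rw [show segMap ((s, v) : ℝ × ℝ) (0, 0) a = (a.1 0 * s, a.1 0 * v) by simp [segMap],
        ← C.deck (a.1 0 * s) (a.1 0 * v)]
      congr 1
      simp only [segMap, ContinuousMap.coe_mk, Prod.smul_mk, smul_eq_mul, Prod.mk_add_mk]
      ext
      · simp only; linear_combination ha
      · simp
    have h2 := pathCls_add C.Φ (s + 1, -v) (1, 0) (0, 0)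
    rw [← h2, h1, map_add, pathCls_symm C.Φ (1, 0) (0, 0)]
    have : V.mkQ (pathCls C.Φ (0, 0) (1, 0)) = 0 := by
      rw [Submodule.mkQ_apply, Submodule.Quotient.mk_eq_zero]
      exact Submodule.mem_span_singleton_self _
    rw [this, add_zero]
  choose z hz using fun x => (C.lift (.const ℝ x))
  let p : X → ChainClass X ⧸ V := fun x => V.mkQ (pathCls C.Φ (z x 0) (0, 0))
  have hp : ∀ w : ℝ × ℝ, |w.2| ≤ 1 → V.mkQ (pathCls C.Φ w (0, 0)) = p (C.Φ w) := by
    intro w hw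
    have h1 := (hz (C.Φ w)).2 0
    obtain ⟨n, hn1, hn2⟩ := C.fiber (z (C.Φ w) 0).1 (z (C.Φ w) 0).2 w.1 w.2 ((hz _).1 0) hw h1
    have := (deck_zpow (P := fun u => V.mkQ (pathCls C.Φ u (0, 0)) = p (C.Φ w))
      (fun s v => by rw [hstep]) n (z (C.Φ w) 0).1 (z (C.Φ w) 0).2).1 rfl
    rw [← hn1, ← hn2] at this
    exact this
  have hle : LinearMap.ker (bdry X) ≤ V := by
    refine ker_bdry_le V p fun γ => ?_
    obtain ⟨σ, hσ, hσγ⟩ := C.lift γ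
    have e : γ = C.Φ.comp σ := by ext t; exact (hσγ t).symm
    rw [e, pathCls_comp, ← pathCls_add C.Φ (σ 0) (0, 0) (σ 1), map_add, pathCls_symm C.Φ (0, 0),
      hp _ (hσ 0), hp _ (hσ 1)]
    rfl
  have hV : Module.finrank (ZMod 2) V ≤ 1 :=
    (finrank_span_le_card {c}).trans (by simp)
  exact (Submodule.finrank_mono hle).trans hV

/-- Two continuous real functions with the same class modulo `ℤ` differ by a constant. -/
lemma sub_eq_of_coe_eq {A : Type*} [TopologicalSpace A] [PreconnectedSpace A] {f g : A → ℝ}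
    (hf : Continuous f) (hg : Continuous g)
    (h : ∀ a, (f a : AddCircle (1 : ℝ)) = g a) (a b : A) : f a - f b = g a - g b := by
  have := (AddCircle.isCoveringMap_coe (1 : ℝ)).eq_of_comp_eq (g₁ := f)
    (g₂ := fun a => g a + (f b - g b)) hf (by fun_prop) (by
      ext a
      simp only [Function.comp_apply, AddCircle.coe_add, AddCircle.coe_sub, h]
      simp) b (by ring)
  have := congrFun this a
  linarith

/-- On a Möbius band, the degrees of maps to the circle along loops form a matrix of rank at most
one, since all loops are homotopic to multiples of the core. -/
theorem MobiusCover.degree_mul_degree (C : MobiusCover X) (f : Fin 2 → C(X, AddCircle (1 : ℝ)))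
    (γ : Fin 2 → C(ℝ, X)) (hγ : ∀ j, γ j 0 = γ j 1) (c d : Fin 2 → Fin 2 → ℝ)
    (h : ∀ i j t, f i (γ j t) = ((c i j + d i j * t : ℝ) : AddCircle (1 : ℝ))) :
    d 0 0 * d 1 1 = d 0 1 * d 1 0 := by
  have hg : ∀ i, ∃ g : C(ℝ × ℝ, ℝ), ∀ z, (g z : AddCircle (1 : ℝ)) = f i (C.Φ z) := by
    intro i
    obtain ⟨r, hr⟩ := QuotientAddGroup.mk_surjective (f i (C.Φ (0, 0)))
    obtain ⟨g, ⟨-, hg⟩, -⟩ := (AddCircle.isCoveringMap_coe (1 : ℝ)).existsUnique_continuousMap_lifts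
      ((f i).comp C.Φ) (0, 0) r hr
    exact ⟨g, fun z => congrFun hg z⟩
  choose g hg using hg
  let δ : Fin 2 → ℝ := fun i => g i (1, 0) - g i (0, 0)
  have hstep : ∀ i s v, g i (s + 1, -v) = g i (s, v) + δ i := by
    intro i s v
    have := sub_eq_of_coe_eq (f := fun z : ℝ × ℝ => g i (z.1 + 1, -z.2)) (g := g i)
      (by fun_prop) (by fun_prop) (fun z => by rw [hg, hg, C.deck]) (s, v) (0, 0)
    simp only [neg_zero, zero_add] at this
    simp only [δ]
    linarith
  have hn : ∀ i (n : ℤ) s v, g i (s + n, (-1) ^ n * v) = g i (s, v) + n * δ i := by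
    intro i n s v
    have := (deck_zpow (P := fun u => g i u - u.1 * δ i = g i (s, v) - s * δ i)
      (fun s v => by rw [hstep]; constructor <;> intro h <;> linarith) n s v).1 rfl
    simp only at this
    linarith
  choose σ hσ hσγ using fun j => C.lift (γ j)
  have hN : ∀ j, ∃ n : ℤ, ∀ i, d i j = n * δ i := by
    intro j
    obtain ⟨n, h1, h2⟩ := C.fiber (σ j 0).1 (σ j 0).2 (σ j 1).1 (σ j 1).2 (hσ j 0) (hσ j 1)
      (by rw [Prod.mk.eta, Prod.mk.eta, hσγ, hσγ, hγ])
    refine ⟨n, fun i => ?_⟩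
    have e1 := hn i n (σ j 0).1 (σ j 0).2
    rw [← h1, ← h2] at e1
    have e2 := sub_eq_of_coe_eq (f := fun t : ℝ => g i (σ j t)) (g := fun t => c i j + d i j * t)
      (by fun_prop) (by fun_prop) (fun t => by rw [hg, hσγ, h]) 1 0
    simp only [Prod.mk.eta] at e1
    linarith
  obtain ⟨n0, h0⟩ := hN 0
  obtain ⟨n1, h1⟩ := hN 1
  rw [h0, h0, h1, h1]
  ring

end Mobius
/-! ### Arithmetic of pinch moves -/

section Arithmetic

/-- The integers `t` and `h` that define a pinch move satisfy `h p - t q = 1` exactly, so that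
`T(p,q)` and the resulting knot `T(r,s)` have determinant `±2`. -/
lemma pinch_spec {p q : ℕ} (hp : 0 < p) (hq : 1 < q) (hodd : Odd q) (hc : p.Coprime q) :
    (∃ ε : ℤ, (ε = 1 ∨ ε = -1) ∧ ((pinch (p, q)).1 : ℤ) * q - (pinch (p, q)).2 * p = 2 * ε) ∧
      Odd (pinch (p, q)).2 ∧ (pinch (p, q)).2 < q := by
  have : NeZero p := ⟨hp.ne'⟩
  have : NeZero q := ⟨by omega⟩
  obtain ⟨t, ht⟩ : ∃ t, t = (-(q : ZMod p)⁻¹ : ZMod p).val := ⟨_, rfl⟩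
  obtain ⟨h, hh⟩ : ∃ h, h = ((p : ZMod q)⁻¹ : ZMod q).val := ⟨_, rfl⟩
  have htp : t < p := ht ▸ ZMod.val_lt _
  have hhq : h < q := hh ▸ ZMod.val_lt _
  have h1 : ((q : ℤ) ∣ h * p - 1) := by
    rw [← ZMod.intCast_zmod_eq_zero_iff_dvd]
    push_cast
    rw [hh, ZMod.natCast_zmod_val, mul_comm, ZMod.coe_mul_inv_eq_one p hc, sub_self]
  have h2 : ((p : ℤ) ∣ t * q + 1) := by
    rw [← ZMod.intCast_zmod_eq_zero_iff_dvd]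
    push_cast
    rw [ht, ZMod.natCast_zmod_val, neg_mul, mul_comm, ZMod.coe_mul_inv_eq_one q hc.symm,
      neg_add_cancel]
  have hpos : 0 < h := by
    rcases Nat.eq_zero_or_pos h with h0 | h0
    · rw [h0] at h1
      have : (q : ℤ) ∣ 1 := by simpa using h1
      have := Int.le_of_dvd one_pos this
      omega
    · exact h0
  have hdet : (h : ℤ) * p - t * q = 1 := by
    have hd : ((p : ℤ) * q) ∣ h * p - t * q - 1 := by
      refine IsCoprime.mul_dvd (Nat.isCoprime_iff_coprime.2 hc) ?_ ?_
      · obtain ⟨k, hk⟩ := h2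
        exact ⟨h - k, by linear_combination -hk⟩
      · obtain ⟨k, hk⟩ := h1
        exact ⟨k - t, by linear_combination hk⟩
    have := Int.eq_zero_of_abs_lt_dvd hd (by
      have a1 : (t : ℤ) + 1 ≤ p := by exact_mod_cast htp
      have a2 : (h : ℤ) + 1 ≤ q := by exact_mod_cast hhq
      have a3 : (1 : ℤ) ≤ h := by exact_mod_cast hpos
      have a4 : (2 : ℤ) ≤ q := by exact_mod_cast hq
      have a5 : (0 : ℤ) ≤ t := by positivity
      have a6 : (1 : ℤ) ≤ p := by exact_mod_cast hp
      rw [abs_lt]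
      constructor <;> nlinarith)
    linarith
  obtain ⟨R, hR⟩ : ∃ R : ℤ, R = p - 2 * t := ⟨_, rfl⟩
  obtain ⟨S, hS⟩ : ∃ S : ℤ, S = q - 2 * h := ⟨_, rfl⟩
  have hpin : pinch (p, q) = (R.natAbs, S.natAbs) := by
    simp only [pinch, hR, hS, ← ht, ← hh]
  have hRS : R * q - S * p = 2 := by rw [hR, hS]; linear_combination 2 * hdet
  have hSodd : Odd S := by
    rw [hS]
    exact (Int.odd_coe_nat _ |>.2 hodd).sub_even (even_two_mul _)
  rw [hpin]
  refine ⟨?_, Int.natAbs_odd.2 hSodd, by omega⟩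
  have hp' : (1 : ℤ) ≤ p := by exact_mod_cast hp
  have hq' : (2 : ℤ) ≤ q := by exact_mod_cast hq
  rcases lt_trichotomy S 0 with hlt | h0 | hgt
  · refine ⟨-1, Or.inr rfl, ?_⟩
    have hR0 : R ≤ 0 := by
      by_contra! hcon
      nlinarith
    push_cast
    rw [abs_of_nonpos hR0, abs_of_neg hlt]
    linarith
  · rw [h0] at hSodd
    exact absurd hSodd (by decide)
  · refine ⟨1, Or.inl rfl, ?_⟩
    have hR0 : 0 ≤ R := by
      by_contra! hcon
      nlinarith
    push_cast
    rw [abs_of_nonneg hR0, abs_of_pos hgt]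
    linarith

lemma pinch_coprime {p q : ℕ} (hp : 0 < p) (hq : 1 < q) (hodd : Odd q) (hc : p.Coprime q) :
    (pinch (p, q)).1.Coprime (pinch (p, q)).2 := by
  obtain ⟨⟨ε, hε, hdet⟩, hs, -⟩ := pinch_spec hp hq hodd hc
  obtain ⟨d, hd⟩ : ∃ d, d = Nat.gcd (pinch (p, q)).1 (pinch (p, q)).2 := ⟨_, rfl⟩
  have d1 : (d : ℤ) ∣ (pinch (p, q)).1 := Int.natCast_dvd_natCast.2 (hd ▸ Nat.gcd_dvd_left _ _)
  have d2 : (d : ℤ) ∣ (pinch (p, q)).2 := Int.natCast_dvd_natCast.2 (hd ▸ Nat.gcd_dvd_right _ _)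
  have d3 : (d : ℤ) ∣ 2 := by
    have : (d : ℤ) ∣ 2 * ε := hdet ▸ dvd_sub (d1.mul_right _) (d2.mul_right _)
    rcases hε with rfl | rfl <;> simpa using this
  have d4 : d ∣ 2 := Int.natCast_dvd_natCast.1 d3
  have d5 : d ∣ (pinch (p, q)).2 := hd ▸ Nat.gcd_dvd_right _ _
  rw [Nat.Coprime, ← hd]
  rcases (Nat.dvd_prime Nat.prime_two).1 d4 with h | h
  · exact h
  · rw [h] at d5
    exact absurd hs (Nat.not_odd_iff_even.2 (even_iff_two_dvd.2 d5))

lemma pos_of_coprime {r s : ℕ} (hc : r.Coprime s) (hs : s ≠ 1) : 0 < r := by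
  rcases Nat.eq_zero_or_pos r with h | h
  · rw [h, Nat.coprime_zero_left] at hc
    exact absurd hc hs
  · exact h

lemma exists_pinchIter_eq_one (q : ℕ) : ∀ p : ℕ, Odd q → p.Coprime q →
    ∃ n, (pinchIter p q n).2 = 1 := by
  induction q using Nat.strong_induction_on with
  | _ q ih =>
    intro p hodd hc
    by_cases hq : q = 1
    · exact ⟨0, hq⟩
    have hp := pos_of_coprime hc hq
    have hq1 : 1 < q := by have := hodd.pos; omega
    obtain ⟨-, h2, h3⟩ := pinch_spec hp hq1 hodd hc
    obtain ⟨n, hn⟩ := ih _ h3 _ h2 (pinch_coprime hp hq1 hodd hc)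
    exact ⟨n + 1, hn⟩

lemma pinchIter_succ (p q k : ℕ) : pinchIter p q (k + 1) = pinch (pinchIter p q k) :=
  Function.iterate_succ_apply' _ _ _

variable {p q : ℕ}

lemma pinchIter_pinchNumber (hodd : Odd q) (hc : p.Coprime q) :
    (pinchIter p q (pinchNumber p q)).2 = 1 :=
  Nat.sInf_mem (s := {n | (pinchIter p q n).2 = 1}) (exists_pinchIter_eq_one q p hodd hc)

lemma pinchIter_ne_one {k : ℕ} (hk : k < pinchNumber p q) : (pinchIter p q k).2 ≠ 1 :=
  Nat.notMem_of_lt_sInf (s := {n | (pinchIter p q n).2 = 1}) hk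

lemma pinchNumber_pos (hq : 1 < q) (hodd : Odd q) (hc : p.Coprime q) : 0 < pinchNumber p q := by
  rw [Nat.pos_iff_ne_zero]
  intro h
  have := pinchIter_pinchNumber hodd hc
  rw [h] at this
  change q = 1 at this
  omega

lemma pinchIter_coprime (hodd : Odd q) (hc : p.Coprime q) {k : ℕ} (hk : k ≤ pinchNumber p q) :
    Odd (pinchIter p q k).2 ∧ (pinchIter p q k).1.Coprime (pinchIter p q k).2 := by
  induction k with
  | zero => exact ⟨hodd, hc⟩
  | succ k ih =>
    obtain ⟨h1, h2⟩ := ih (by omega)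
    have h3 := pinchIter_ne_one (p := p) (q := q) (k := k) (by omega)
    have h4 : 1 < (pinchIter p q k).2 := by have := h1.pos; omega
    rw [pinchIter_succ]
    exact ⟨(pinch_spec (pos_of_coprime h2 h3) h4 h1 h2).2.1,
      pinch_coprime (pos_of_coprime h2 h3) h4 h1 h2⟩

lemma pinchIter_det (hodd : Odd q) (hc : p.Coprime q) {k : ℕ} (hk : k < pinchNumber p q) :
    ∃ ε : ℤ, (ε = 1 ∨ ε = -1) ∧ ((pinchIter p q (k + 1)).1 : ℤ) * (pinchIter p q k).2 -
      (pinchIter p q (k + 1)).2 * (pinchIter p q k).1 = 2 * ε := by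
  obtain ⟨h1, h2⟩ := pinchIter_coprime hodd hc hk.le
  have h3 := pinchIter_ne_one hk
  have h4 : 1 < (pinchIter p q k).2 := by have := h1.pos; omega
  rw [pinchIter_succ]
  exact (pinch_spec (pos_of_coprime h2 h3) h4 h1 h2).1

lemma exists_eq_of_pinchNumber_eq_one (hodd : Odd q) (hc : p.Coprime q)
    (hn : pinchNumber p q = 1) :
    ∃ ε : ℤ, (ε = 1 ∨ ε = -1) ∧ (p : ℤ) = q * (pinchIter p q 1).1 + 2 * ε := by
  obtain ⟨ε, hε, h⟩ := pinchIter_det hodd hc (k := 0) (by omega)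
  have h1 := pinchIter_pinchNumber hodd hc
  rw [hn] at h1
  rw [zero_add, h1, show pinchIter p q 0 = (p, q) from rfl] at h
  refine ⟨-ε, by omega, ?_⟩
  push_cast at h
  linarith

lemma pinchNumber_eq_one {m : ℕ} {ε : ℤ} (hp : 0 < p) (hq : 3 ≤ q) (hodd : Odd q)
    (hε : ε = 1 ∨ ε = -1) (h : (p : ℤ) = q * m + 2 * ε) : pinchNumber p q = 1 := by
  have hc : p.Coprime q := by
    rw [← Nat.isCoprime_iff_coprime, h]
    have : IsCoprime (2 : ℤ) q := by
      rw [show (2 : ℤ) = ((2 : ℕ) : ℤ) from rfl, Nat.isCoprime_iff_coprime]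
      exact (Nat.coprime_two_left).2 hodd
    have h2 : IsCoprime (2 * ε) (q : ℤ) := by
      rcases hε with rfl | rfl
      · simpa using this
      · simpa using this.neg_left
    rw [add_comm]
    exact h2.add_mul_left_left _
  obtain ⟨⟨ε', hε', hdet⟩, hs, hlt⟩ := pinch_spec hp (by omega) hodd hc
  have hs1 : (pinch (p, q)).2 = 1 := by
    obtain ⟨r, hr⟩ : ∃ r : ℕ, r = (pinch (p, q)).1 := ⟨_, rfl⟩
    obtain ⟨s, hs'⟩ : ∃ s : ℕ, s = (pinch (p, q)).2 := ⟨_, rfl⟩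
    rw [← hr, ← hs', h] at hdet
    rw [← hs'] at hs hlt ⊢
    have hd : (q : ℤ) ∣ 2 * (s * ε + ε') := ⟨r - s * m, by linear_combination -hdet⟩
    have hd' : (q : ℤ) ∣ s * ε + ε' := by
      refine IsCoprime.dvd_of_dvd_mul_left ?_ hd
      rw [show (2 : ℤ) = ((2 : ℕ) : ℤ) from rfl, Nat.isCoprime_iff_coprime]
      exact (Nat.coprime_two_right).2 hodd
    have hspos := hs.pos
    obtain ⟨k, hk⟩ := hs
    obtain ⟨l, hl⟩ := hodd
    have key : (q : ℤ) ∣ s - 1 ∨ (q : ℤ) ∣ s + 1 := by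
      rcases hε with rfl | rfl <;> rcases hε' with rfl | rfl
      · right; simpa using hd'
      · left; simpa [sub_eq_add_neg] using hd'
      · left; have := (dvd_neg (α := ℤ)).2 hd'; simpa [sub_eq_add_neg, add_comm] using this
      · right; have := (dvd_neg (α := ℤ)).2 hd'; simpa [sub_eq_add_neg, add_comm] using this
    rcases key with hk' | hk'
    · have := Int.eq_zero_of_dvd_of_nonneg_of_lt (by omega) (by omega) hk'
      omega
    · have := Int.le_of_dvd (by omega) hk'
      omega
  refine le_antisymm (Nat.sInf_le hs1) (pinchNumber_pos (by omega) hodd hc)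

end Arithmetic

/-! ### Points on Clifford tori -/

section TorusPoint

lemma torusPoint_zero (ρ x y : ℝ) : torusPoint ρ x y 0 =
    ((ρ / √2 : ℝ) : ℂ) * Complex.exp ((2 * Real.pi * x : ℝ) * Complex.I) := rfl

lemma torusPoint_one (ρ x y : ℝ) : torusPoint ρ x y 1 =
    ((ρ / √2 : ℝ) : ℂ) * Complex.exp ((2 * Real.pi * y : ℝ) * Complex.I) := rfl

lemma continuous_torusPoint : Continuous fun a : ℝ × ℝ × ℝ => torusPoint a.1 a.2.1 a.2.2 := by
  unfold torusPoint
  refine (PiLp.continuous_toLp 2 _).comp (continuous_pi fun i => ?_)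
  fin_cases i <;> simp <;> fun_prop

lemma norm_torusPoint_zero (ρ x y : ℝ) : ‖torusPoint ρ x y 0‖ = |ρ| / √2 := by
  rw [torusPoint_zero, norm_mul, Complex.norm_exp_ofReal_mul_I, mul_one, Complex.norm_real,
    Real.norm_eq_abs, abs_div, abs_of_nonneg (Real.sqrt_nonneg 2)]

lemma norm_torusPoint_one (ρ x y : ℝ) : ‖torusPoint ρ x y 1‖ = |ρ| / √2 := by
  rw [torusPoint_one, norm_mul, Complex.norm_exp_ofReal_mul_I, mul_one, Complex.norm_real,
    Real.norm_eq_abs, abs_div, abs_of_nonneg (Real.sqrt_nonneg 2)]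

lemma C2.norm_sq (P : C2) : ‖P‖ ^ 2 = ‖P 0‖ ^ 2 + ‖P 1‖ ^ 2 := by
  rw [EuclideanSpace.norm_sq_eq, Fin.sum_univ_two]

lemma norm_torusPoint (ρ x y : ℝ) : ‖torusPoint ρ x y‖ = |ρ| := by
  have h : ‖torusPoint ρ x y‖ ^ 2 = |ρ| ^ 2 := by
    rw [C2.norm_sq, norm_torusPoint_zero, norm_torusPoint_one, div_pow,
      Real.sq_sqrt (by norm_num)]
    ring
  exact (pow_left_inj₀ (norm_nonneg _) (abs_nonneg _) two_ne_zero).1 h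

lemma exp_two_pi_eq_iff (x y : ℝ) :
    Complex.exp ((2 * Real.pi * x : ℝ) * Complex.I) =
      Complex.exp ((2 * Real.pi * y : ℝ) * Complex.I) ↔ ∃ n : ℤ, y = x + n := by
  rw [Complex.exp_eq_exp_iff_exists_int]
  have h2 : (2 * Real.pi * Complex.I : ℂ) ≠ 0 := Complex.two_pi_I_ne_zero
  constructor
  · rintro ⟨n, hn⟩
    refine ⟨-n, ?_⟩
    have : ((2 * Real.pi * Complex.I : ℂ)) * (x - y - n) = 0 := by
      push_cast at hn
      linear_combination hn
    have h3 := (mul_eq_zero.1 this).resolve_left h2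
    have h4 : x - y - n = 0 := by exact_mod_cast h3
    push_cast
    linarith
  · rintro ⟨n, rfl⟩
    exact ⟨-n, by push_cast; ring⟩

lemma torusPoint_eq_iff {ρ ρ' : ℝ} (hρ : 0 < ρ) (hρ' : 0 < ρ') (x y x' y' : ℝ) :
    torusPoint ρ x y = torusPoint ρ' x' y' ↔
      ρ = ρ' ∧ (∃ i : ℤ, x' = x + i) ∧ ∃ j : ℤ, y' = y + j := by
  have h2 : (0 : ℝ) < √2 := by positivity
  constructor
  · intro h
    have hn := congrArg norm h
    rw [norm_torusPoint, norm_torusPoint, abs_of_pos hρ, abs_of_pos hρ'] at hn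
    subst hn
    have hc : ((ρ / √2 : ℝ) : ℂ) ≠ 0 := by
      rw [Complex.ofReal_ne_zero]
      positivity
    have h0 := congrArg (fun P : C2 => P 0) h
    have h1 := congrArg (fun P : C2 => P 1) h
    simp only [torusPoint_zero, torusPoint_one] at h0 h1
    exact ⟨rfl, (exp_two_pi_eq_iff _ _).1 (mul_left_cancel₀ hc h0),
      (exp_two_pi_eq_iff _ _).1 (mul_left_cancel₀ hc h1)⟩
  · rintro ⟨rfl, hi, hj⟩
    unfold torusPoint
    rw [(exp_two_pi_eq_iff _ _).2 hi, (exp_two_pi_eq_iff _ _).2 hj]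

lemma norm_torusPoint_sub_sq (x y x' y' : ℝ) :
    ‖torusPoint 1 x y - torusPoint 1 x' y'‖ ^ 2 =
      2 - Real.cos (2 * Real.pi * (x - x')) - Real.cos (2 * Real.pi * (y - y')) := by
  have key : ∀ a b : ℝ, ‖((1 / √2 : ℝ) : ℂ) * Complex.exp ((a : ℝ) * Complex.I) -
      ((1 / √2 : ℝ) : ℂ) * Complex.exp ((b : ℝ) * Complex.I)‖ ^ 2 = 1 - Real.cos (a - b) := by
    intro a b
    rw [← mul_sub, norm_mul, mul_pow, Complex.norm_real, Real.norm_eq_abs, sq_abs, div_pow,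
      Real.sq_sqrt (by norm_num), Complex.sq_norm, Complex.normSq_apply, Complex.exp_mul_I,
      Complex.exp_mul_I, Real.cos_sub]
    simp only [← Complex.ofReal_cos, ← Complex.ofReal_sin, Complex.sub_re, Complex.add_re,
      Complex.ofReal_re, Complex.mul_re, Complex.I_re, Complex.I_im, Complex.ofReal_im,
      Complex.sub_im, Complex.add_im, Complex.mul_im]
    nlinarith [Real.sin_sq_add_cos_sq a, Real.sin_sq_add_cos_sq b]
  rw [C2.norm_sq, PiLp.sub_apply, PiLp.sub_apply, torusPoint_zero, torusPoint_zero, torusPoint_one,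
    torusPoint_one, key, key, ← mul_sub, ← mul_sub]
  ring

end TorusPoint

/-! ### Isometric torus knots -/

section Rigidity

open Topology

lemma continuous_torusCurve (p q : ℤ) : Continuous fun θ : ℝ => torusPoint 1 (p * θ) (q * θ) :=
  continuous_torusPoint.comp (f := fun θ : ℝ => ((1 : ℝ), (p * θ : ℝ), (q * θ : ℝ))) (by fun_prop)

lemma torusCurve_eq_iff {p q : ℤ} (h : IsCoprime p q) (s t : ℝ) :
    torusPoint 1 (p * s) (q * s) = torusPoint 1 (p * t) (q * t) ↔ ∃ n : ℤ, t = s + n := by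
  rw [torusPoint_eq_iff one_pos one_pos]
  constructor
  · rintro ⟨-, ⟨i, hi⟩, j, hj⟩
    obtain ⟨u, v, huv⟩ := h
    refine ⟨u * i + v * j, ?_⟩
    have huv' : (u * p + v * q : ℝ) = 1 := by exact_mod_cast huv
    push_cast
    linear_combination (u : ℝ) * hi + (v : ℝ) * hj - (t - s) * huv'
  · rintro ⟨n, rfl⟩
    exact ⟨rfl, ⟨p * n, by push_cast; ring⟩, q * n, by push_cast; ring⟩

/-- A curve in a torus knot lifts to the real line. -/
lemma exists_lift_torusKnot {p q : ℤ} (h : IsCoprime p q) {γ : ℝ → C2} (hγ : Continuous γ)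
    (hm : ∀ t, γ t ∈ torusKnot p q) :
    ∃ φ : ℝ → ℝ, Continuous φ ∧ ∀ t, torusPoint 1 (p * φ t) (q * φ t) = γ t := by
  let E : AddCircle (1 : ℝ) → C2 := Quotient.lift (fun θ : ℝ => torusPoint 1 (p * θ) (q * θ)) (by
    intro a b hab
    rw [torusCurve_eq_iff h]
    obtain ⟨n, hn⟩ := AddCircle.coe_eq_zero_iff (1 : ℝ) |>.1
      (show ((b - a : ℝ) : AddCircle (1 : ℝ)) = 0 by
        rw [AddCircle.coe_sub, sub_eq_zero]; exact (Quotient.sound hab).symm)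
    exact ⟨n, by simp at hn; linarith⟩)
  have hE : ∀ θ : ℝ, E θ = torusPoint 1 (p * θ) (q * θ) := fun θ => rfl
  have hEc : Continuous E := continuous_coinduced_dom.2 (continuous_torusCurve p q)
  have hEi : Function.Injective E := by
    intro a b hab
    obtain ⟨a, rfl⟩ := QuotientAddGroup.mk_surjective a
    obtain ⟨b, rfl⟩ := QuotientAddGroup.mk_surjective b
    obtain ⟨n, rfl⟩ := (torusCurve_eq_iff h _ _).1 hab
    change (a : AddCircle (1 : ℝ)) = ((a + n : ℝ) : AddCircle (1 : ℝ))
    rw [AddCircle.coe_add, left_eq_add, AddCircle.coe_eq_zero_iff]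
    exact ⟨n, by simp⟩
  have hemb : IsClosedEmbedding E := hEc.isClosedEmbedding hEi
  choose θ₀ hθ₀ using hm
  let c : ℝ → AddCircle (1 : ℝ) := fun t => (θ₀ t : AddCircle (1 : ℝ))
  have hc : ∀ t, E (c t) = γ t := fun t => hθ₀ t
  have hcc : Continuous c := by
    rw [hemb.isEmbedding.continuous_iff]
    exact hγ.congr fun t => (hc t).symm
  obtain ⟨φ, ⟨-, hφ⟩, -⟩ := (AddCircle.isCoveringMap_coe (1 : ℝ)).existsUnique_continuousMap_lifts
    (⟨c, hcc⟩ : C(ℝ, AddCircle (1 : ℝ))) 0 (θ₀ 0) rfl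
  refine ⟨φ, φ.continuous, fun t => ?_⟩
  rw [← hc, ← hE]
  exact congrArg E (congrFun hφ t)

/-- A continuous real function composed into a level set of a nonconstant sum of two cosines is
constant. -/
lemma eq_of_cos_add_cos_eq {α β : ℝ} (hβ : β ≠ 0) {ψ : ℝ → ℝ} (hψ : Continuous ψ) {c : ℝ}
    (h : ∀ t, Real.cos (α * ψ t) + Real.cos (β * ψ t) = c) (a b : ℝ) : ψ a = ψ b := by
  by_contra hne
  wlog hlt : ψ a < ψ b generalizing a b
  · exact this b a (Ne.symm hne) (lt_of_le_of_ne (not_lt.1 hlt) (Ne.symm hne))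
  have hconn : Set.Icc (ψ a) (ψ b) ⊆ Set.range ψ :=
    (isPreconnected_range hψ).Icc_subset ⟨a, rfl⟩ ⟨b, rfl⟩
  have han : AnalyticOnNhd ℝ (fun x : ℝ => Real.cos (α * x) + Real.cos (β * x)) Set.univ := by
    intro x _
    fun_prop
  have hev : (fun x : ℝ => Real.cos (α * x) + Real.cos (β * x)) =ᶠ[𝓝 ((ψ a + ψ b) / 2)]
      fun _ => c := by
    filter_upwards [Icc_mem_nhds (show ψ a < (ψ a + ψ b) / 2 by linarith)
      (show (ψ a + ψ b) / 2 < ψ b by linarith)] with x hx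
    obtain ⟨t, rfl⟩ := hconn hx
    exact h t
  have hall := han.eq_of_eventuallyEq (fun x _ => analyticAt_const) hev
  have h0 := congrFun hall 0
  have h1 := congrFun hall (Real.pi / β)
  simp only [mul_zero, Real.cos_zero] at h0
  simp only [mul_div_cancel₀ _ hβ, Real.cos_pi] at h1
  have := Real.cos_le_one (α * (Real.pi / β))
  linarith

lemma cos_second_derivative {A B A' B' a b a' b' : ℝ}
    (h : ∀ x, A * Real.cos (a * x) + B * Real.cos (b * x) =
      A' * Real.cos (a' * x) + B' * Real.cos (b' * x)) (x : ℝ) :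
    (A * a ^ 2) * Real.cos (a * x) + (B * b ^ 2) * Real.cos (b * x) =
      (A' * a' ^ 2) * Real.cos (a' * x) + (B' * b' ^ 2) * Real.cos (b' * x) := by
  have hc : ∀ k x : ℝ, HasDerivAt (fun x => Real.cos (k * x)) (-Real.sin (k * x) * k) x :=
    fun k x => by simpa using ((hasDerivAt_id x).const_mul k).cos
  have hs : ∀ k x : ℝ, HasDerivAt (fun x => -Real.sin (k * x) * k)
      (-(Real.cos (k * x) * k) * k) x :=
    fun k x => by simpa using (((hasDerivAt_id x).const_mul k).sin.neg.mul_const k)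
  have d1 : ∀ A B a b x : ℝ, HasDerivAt (fun x => A * Real.cos (a * x) + B * Real.cos (b * x))
      (A * (-Real.sin (a * x) * a) + B * (-Real.sin (b * x) * b)) x :=
    fun A B a b x => ((hc a x).const_mul A).add ((hc b x).const_mul B)
  have d2 : ∀ A B a b x : ℝ, HasDerivAt
      (fun x => A * (-Real.sin (a * x) * a) + B * (-Real.sin (b * x) * b))
      (A * (-(Real.cos (a * x) * a) * a) + B * (-(Real.cos (b * x) * b) * b)) x :=
    fun A B a b x => ((hs a x).const_mul A).add ((hs b x).const_mul B)
  have e1 : ∀ x, A * (-Real.sin (a * x) * a) + B * (-Real.sin (b * x) * b) =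
      A' * (-Real.sin (a' * x) * a') + B' * (-Real.sin (b' * x) * b') := fun x =>
    (d1 A B a b x).unique ((d1 A' B' a' b' x).congr_of_eventuallyEq (.of_forall h))
  have e2 := (d2 A B a b x).unique ((d2 A' B' a' b' x).congr_of_eventuallyEq (.of_forall e1))
  linear_combination -e2

lemma sq_eq_of_cos_add_cos_eq {a b a' b' : ℝ}
    (h : ∀ x, Real.cos (a * x) + Real.cos (b * x) = Real.cos (a' * x) + Real.cos (b' * x)) :
    (a ^ 2 = a' ^ 2 ∧ b ^ 2 = b' ^ 2) ∨ (a ^ 2 = b' ^ 2 ∧ b ^ 2 = a' ^ 2) := by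
  have h2 := cos_second_derivative (A := 1) (B := 1) (A' := 1) (B' := 1) (by simpa using h)
  have h4 := cos_second_derivative h2 0
  have h2 := h2 0
  simp only [mul_zero, Real.cos_zero] at h2 h4
  have h5 : (a ^ 2 - a' ^ 2) * (a ^ 2 - b' ^ 2) = 0 := by
    have hb : b ^ 2 = a' ^ 2 + b' ^ 2 - a ^ 2 := by linarith
    have h4' : a ^ 2 * a ^ 2 + b ^ 2 * b ^ 2 = a' ^ 2 * a' ^ 2 + b' ^ 2 * b' ^ 2 := by linarith
    rw [hb] at h4'
    nlinarith
  rcases mul_eq_zero.1 h5 with h6 | h6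
  · exact Or.inl ⟨by linarith, by linarith⟩
  · exact Or.inr ⟨by linarith, by linarith⟩

lemma natAbs_eq_of_sq_eq {p q p' q' : ℤ} (h : IsCoprime p q) (h' : IsCoprime p' q') {c : ℝ}
    (h1 : ((p' : ℝ) * c) ^ 2 = (p : ℝ) ^ 2) (h2 : ((q' : ℝ) * c) ^ 2 = (q : ℝ) ^ 2) :
    p.natAbs = p'.natAbs ∧ q.natAbs = q'.natAbs := by
  have e : ((p' * q) ^ 2 : ℤ) = (p * q') ^ 2 := by
    have : ((p' * q) ^ 2 : ℝ) = (p * q') ^ 2 := by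
      rw [mul_pow, mul_pow, ← h1, ← h2]; ring
    exact_mod_cast this
  have e' : p'.natAbs * q.natAbs = p.natAbs * q'.natAbs := by
    rw [← Int.natAbs_mul, ← Int.natAbs_mul]
    exact Int.natAbs_eq_iff_sq_eq.2 e
  rw [Int.isCoprime_iff_nat_coprime] at h h'
  have a1 : p.natAbs ∣ p'.natAbs := h.dvd_of_dvd_mul_right ⟨_, e'⟩
  have a2 : p'.natAbs ∣ p.natAbs := h'.dvd_of_dvd_mul_right ⟨_, e'.symm⟩
  have a3 : q.natAbs ∣ q'.natAbs := h.symm.dvd_of_dvd_mul_left ⟨p'.natAbs, by rw [← e']; ring⟩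
  have a4 : q'.natAbs ∣ q.natAbs := h'.symm.dvd_of_dvd_mul_left ⟨p.natAbs, by rw [e']; ring⟩
  exact ⟨Nat.dvd_antisymm a1 a2, Nat.dvd_antisymm a3 a4⟩

/-- Torus knots that agree up to an isometry have the same parameters up to order and signs. An
isometry reparametrizes one knot as the other by a map `φ` of the line for which the distance of
the points of parameters `φ (θ + h)` and `φ θ` depends only on `h`; hence `φ` is affine, and the
distance functions `2 - cos (2πph) - cos (2πqh)` can be compared. -/
theorem natAbs_eq_of_sameUpToMirror {p q p' q' : ℤ} (h : IsCoprime p q) (h' : IsCoprime p' q')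
    (hq' : q' ≠ 0) (hs : SameUpToMirror (torusKnot p q) (torusKnot p' q')) :
    (p.natAbs = p'.natAbs ∧ q.natAbs = q'.natAbs) ∨
      (p.natAbs = q'.natAbs ∧ q.natAbs = p'.natAbs) := by
  obtain ⟨g, hg⟩ := hs
  obtain ⟨φ, hφc, hφ⟩ := exists_lift_torusKnot h'
    (γ := fun θ => g (torusPoint 1 (p * θ) (q * θ)))
    (g.continuous.comp (continuous_torusCurve p q))
    (fun t => hg ▸ Set.mem_image_of_mem _ ⟨t, rfl⟩)
  have hN : ∀ s t, Real.cos (2 * Real.pi * p' * (φ s - φ t)) +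
      Real.cos (2 * Real.pi * q' * (φ s - φ t)) =
      Real.cos (2 * Real.pi * p * (s - t)) + Real.cos (2 * Real.pi * q * (s - t)) := by
    intro s t
    have e1 := norm_torusPoint_sub_sq (p' * φ s) (q' * φ s) (p' * φ t) (q' * φ t)
    have e2 := norm_torusPoint_sub_sq (p * s) (q * s) (p * t) (q * t)
    rw [hφ, hφ, ← map_sub, g.norm_map, e2] at e1
    simp only [← mul_sub, ← mul_assoc] at e1
    linarith
  have hconst : ∀ k s, φ (s + k) - φ s = φ k - φ 0 := by
    intro k s
    have hβ : 2 * Real.pi * (q' : ℝ) ≠ 0 := by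
      have : (q' : ℝ) ≠ 0 := by exact_mod_cast hq'
      positivity
    have := eq_of_cos_add_cos_eq (α := 2 * Real.pi * p') hβ (ψ := fun s => φ (s + k) - φ s)
      (by fun_prop) (fun t => by rw [hN, add_sub_cancel_left]) s 0
    simpa using this
  let L : ℝ →+ ℝ :=
    { toFun := fun k => φ k - φ 0
      map_zero' := sub_self _
      map_add' := fun a b => by have := hconst b a; linarith }
  have hL : ∀ k, φ k - φ 0 = k * (φ 1 - φ 0) := by
    intro k
    have := map_real_smul L (by change Continuous fun k => φ k - φ 0; fun_prop) k 1
    simpa [L] using this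
  have hcos : ∀ x, Real.cos (2 * Real.pi * p' * (x * (φ 1 - φ 0))) +
      Real.cos (2 * Real.pi * q' * (x * (φ 1 - φ 0))) =
      Real.cos (2 * Real.pi * p * x) + Real.cos (2 * Real.pi * q * x) := by
    intro x
    rw [← hL, hN, sub_zero]
  have hfin := sq_eq_of_cos_add_cos_eq (a := 2 * Real.pi * p' * (φ 1 - φ 0))
    (b := 2 * Real.pi * q' * (φ 1 - φ 0)) (a' := 2 * Real.pi * p) (b' := 2 * Real.pi * q)
    (fun x => by rw [← hcos]; congr 2 <;> ring)
  have hpi : (2 * Real.pi) ^ 2 ≠ 0 := by positivity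
  have key : ∀ a b : ℤ, (2 * Real.pi * a * (φ 1 - φ 0)) ^ 2 = (2 * Real.pi * b) ^ 2 →
      ((a : ℝ) * (φ 1 - φ 0)) ^ 2 = (b : ℝ) ^ 2 := by
    intro a b hab
    apply mul_left_cancel₀ hpi
    linear_combination hab
  rcases hfin with ⟨h1, h2⟩ | ⟨h1, h2⟩
  · exact Or.inl (natAbs_eq_of_sq_eq h h' (key _ _ h1) (key _ _ h2))
  · exact Or.inr (natAbs_eq_of_sq_eq h h'.symm (key _ _ h2) (key _ _ h1))

end Rigidity

/-! ### Two or more pinch moves -/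

section TwoPinches

open Topology

/-- The argument of a complex number, in full turns. -/
noncomputable def turn (z : ℂ) : AddCircle (1 : ℝ) :=
  AddCircle.homeomorphAddCircle (2 * Real.pi) 1 Real.two_pi_pos.ne' one_ne_zero
    (Complex.arg z : Real.Angle)

lemma continuousAt_turn {z : ℂ} (hz : z ≠ 0) : ContinuousAt turn z :=
  (AddCircle.homeomorphAddCircle (2 * Real.pi) 1 Real.two_pi_pos.ne'
    one_ne_zero).continuous.continuousAt.comp (Complex.continuousAt_arg_coe_angle hz)

lemma turn_mul_exp {c : ℝ} (hc : 0 < c) (x : ℝ) :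
    turn (c * Complex.exp ((2 * Real.pi * x : ℝ) * Complex.I)) = (x : AddCircle (1 : ℝ)) := by
  have h := Complex.arg_mul_cos_add_sin_mul_I_coe_angle hc ((2 * Real.pi * x : ℝ) : Real.Angle)
  rw [Real.Angle.cos_coe, Real.Angle.sin_coe, Complex.ofReal_cos, Complex.ofReal_sin,
    ← Complex.exp_mul_I] at h
  rw [turn, h]
  refine (AddCircle.homeomorphAddCircle_apply_mk _ _ _ _ _).trans ?_
  congr 1
  have := Real.pi_pos
  field_simp

/-- The class of `q x - p y` modulo `ℤ` at a point with angular coordinates `(x, y)`. -/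
noncomputable def slopeMap (c : ℕ × ℕ) (P : C2) : AddCircle (1 : ℝ) :=
  c.2 • turn (P 0) - c.1 • turn (P 1)

lemma slopeMap_torusPoint (c : ℕ × ℕ) {ρ : ℝ} (hρ : 0 < ρ) (x y : ℝ) :
    slopeMap c (torusPoint ρ x y) = ((c.2 * x - c.1 * y : ℝ) : AddCircle (1 : ℝ)) := by
  have h : 0 < ρ / √2 := by positivity
  rw [slopeMap, torusPoint_zero, torusPoint_one, turn_mul_exp h, turn_mul_exp h,
    AddCircle.coe_sub, ← nsmul_eq_mul, ← nsmul_eq_mul, AddCircle.coe_nsmul, AddCircle.coe_nsmul]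

lemma continuousAt_slopeMap (c : ℕ × ℕ) {P : C2} (h0 : P 0 ≠ 0) (h1 : P 1 ≠ 0) :
    ContinuousAt (slopeMap c) P := by
  have a0 : ContinuousAt (fun P : C2 => turn (P 0)) P :=
    (continuousAt_turn h0).comp (f := fun P : C2 => P 0) (by fun_prop)
  have a1 : ContinuousAt (fun P : C2 => turn (P 1)) P :=
    (continuousAt_turn h1).comp (f := fun P : C2 => P 1) (by fun_prop)
  exact (a0.const_smul c.2).sub (a1.const_smul c.1)

variable {p q : ℕ}

lemma mem_pinchSurface_of_half_le (hodd : Odd q) (hc : p.Coprime q) (hn : 0 < pinchNumber p q)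
    {P : C2} (hP : P ∈ pinchSurface p q) (h : 1 / 2 ≤ ‖P‖) :
    ∃ k < pinchNumber p q, ∃ u x y : ℝ, u ∈ Set.Icc 0 1 ∧
      pinchMovie (pinchIter p q k) (pinchIter p q (k + 1)) (Real.smoothTransition u) x y = 0 ∧
      P = torusPoint (1 - (k + u) / (2 * (pinchNumber p q : ℝ))) x y := by
  have hn' : (0 : ℝ) < pinchNumber p q := by exact_mod_cast hn
  rcases hP with hP | ⟨r, y, ⟨hr0, hr1⟩, rfl⟩
  · obtain ⟨k, hk, u, x, y, hu, hm, rfl⟩ := by simpa only [Set.mem_iUnion, exists_prop] using hP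
    refine ⟨k, hk, u, x, y, hu, hm, ?_⟩
    congr 1
    field_simp
    ring
  · set m := (pinchIter p q (pinchNumber p q)).1
    set G := (1 - Real.smoothTransition r) * r ^ m + Real.smoothTransition r * r
    have hτ0 := Real.smoothTransition.nonneg r
    have hτ1 := Real.smoothTransition.le_one r
    have hG0 : 0 ≤ G := add_nonneg (mul_nonneg (by linarith) (by positivity)) (by positivity)
    have hG1 : G ≤ 1 := by
      have := pow_le_one₀ hr0 hr1 (n := m)
      simp only [G]
      nlinarith
    have hr : r = 1 := by
      by_contra hne
      have hr : r < 1 := lt_of_le_of_ne hr1 hne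
      have h2 := C2.norm_sq (!₂[(((1 / 2) / √2 * G : ℝ) : ℂ) *
        Complex.exp ((2 * Real.pi * (m * y) : ℝ) * Complex.I),
        (((1 / 2) / √2 * r : ℝ) : ℂ) * Complex.exp ((2 * Real.pi * y : ℝ) * Complex.I)] : C2)
      have h3 : (1 / 2 : ℝ) ^ 2 ≤ (1 / 2 / √2 * G) ^ 2 + (1 / 2 / √2 * r) ^ 2 := by
        refine (pow_le_pow_left₀ (by norm_num) h 2).trans ?_
        rw [h2]
        simp only [Matrix.cons_val_zero, Matrix.cons_val_one, norm_mul,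
          Complex.norm_exp_ofReal_mul_I, mul_one, Complex.norm_real, Real.norm_eq_abs,
          ← abs_mul, sq_abs,
          le_refl]
      have h4 : (1 / 2 / √2 : ℝ) ^ 2 = 1 / 8 := by
        rw [div_pow, Real.sq_sqrt (by norm_num)]; norm_num
      rw [mul_pow, mul_pow, h4] at h3
      nlinarith
    refine ⟨pinchNumber p q - 1, by omega, 1, m * y, y, by simp, ?_, ?_⟩
    · rw [Nat.sub_add_cancel hn, pinchMovie, Real.smoothTransition.one,
        pinchIter_pinchNumber hodd hc]
      simp [m]
    · have : (1 - (((pinchNumber p q - 1 : ℕ) : ℝ) + 1) / (2 * (pinchNumber p q : ℝ))) = 1 / 2 := by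
        rw [Nat.cast_sub hn]
        field_simp
        push_cast
        ring
      rw [this]
      have hG : G = 1 := by simp [G, hr]
      rw [hG, hr]
      unfold torusPoint
      simp

lemma mem_pinchSurface_of_norm_eq (hodd : Odd q) (hc : p.Coprime q) (hn : 0 < pinchNumber p q)
    {P : C2} (hP : P ∈ pinchSurface p q) {k : ℕ} (hk : k ≤ pinchNumber p q)
    (h : ‖P‖ = 1 - k / (2 * (pinchNumber p q : ℝ))) : slopeMap (pinchIter p q k) P = 0 := by
  have hn' : (0 : ℝ) < pinchNumber p q := by exact_mod_cast hn
  have hk' : (k : ℝ) ≤ pinchNumber p q := by exact_mod_cast hk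
  have hhalf : ∀ v : ℝ, v ≤ pinchNumber p q → 1 / 2 ≤ 1 - v / (2 * (pinchNumber p q : ℝ)) := by
    intro v hv
    have : v / (2 * (pinchNumber p q : ℝ)) ≤ 1 / 2 := by
      rw [div_le_iff₀ (by positivity)]; linarith
    linarith
  obtain ⟨j, hj, u, x, y, ⟨hu0, hu1⟩, hm, rfl⟩ := mem_pinchSurface_of_half_le hodd hc hn hP
    (by rw [h]; exact hhalf _ hk')
  have hj' : (j : ℝ) + 1 ≤ pinchNumber p q := by exact_mod_cast hj
  have hpos := hhalf (j + u) (by linarith)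
  rw [norm_torusPoint, abs_of_nonneg (by linarith)] at h
  have hjk : (j : ℝ) + u = k := by
    have : ((j : ℝ) + u) / (2 * (pinchNumber p q : ℝ)) = k / (2 * (pinchNumber p q : ℝ)) := by
      linarith
    field_simp at this
    exact this
  rw [slopeMap_torusPoint _ (by linarith), AddCircle.coe_eq_zero_iff]
  have hsin : Real.sin (Real.pi * ((pinchIter p q k).2 * x - (pinchIter p q k).1 * y)) = 0 := by
    have h1 : j ≤ k := by
      have : (j : ℝ) ≤ k := by linarith
      exact_mod_cast this
    have h2 : k ≤ j + 1 := by
      have : (k : ℝ) ≤ j + 1 := by linarith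
      exact_mod_cast this
    obtain rfl | rfl : k = j ∨ k = j + 1 := by omega
    · have hu : u = 0 := by linarith
      rw [hu, Real.smoothTransition.zero] at hm
      simpa [pinchMovie] using hm
    · have hu : u = 1 := by push_cast at hjk; linarith
      rw [hu, Real.smoothTransition.one] at hm
      simpa [pinchMovie] using hm
  obtain ⟨i, hi⟩ := Real.sin_eq_zero_iff.1 hsin
  refine ⟨i, ?_⟩
  rw [mul_comm] at hi
  simpa using mul_left_cancel₀ Real.pi_ne_zero hi

/-- The map to the circle that is `slopeMap` outside of the `k`-th level and constant inside. -/
lemma exists_slopeMap_extension (hodd : Odd q) (hc : p.Coprime q) (hn : 0 < pinchNumber p q)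
    {k : ℕ} (hk : k ≤ pinchNumber p q) : ∃ f : C(pinchSurface p q, AddCircle (1 : ℝ)),
      ∀ P : pinchSurface p q, 1 - k / (2 * (pinchNumber p q : ℝ)) ≤ ‖(P : C2)‖ →
        f P = slopeMap (pinchIter p q k) P := by
  classical
  have hn' : (0 : ℝ) < pinchNumber p q := by exact_mod_cast hn
  have hk' : (k : ℝ) ≤ pinchNumber p q := by exact_mod_cast hk
  have hhalf : ∀ v : ℝ, v ≤ pinchNumber p q → 1 / 2 ≤ 1 - v / (2 * (pinchNumber p q : ℝ)) := by
    intro v hv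
    have : v / (2 * (pinchNumber p q : ℝ)) ≤ 1 / 2 := by
      rw [div_le_iff₀ (by positivity)]; linarith
    linarith
  refine ⟨⟨fun P => if 1 - k / (2 * (pinchNumber p q : ℝ)) ≤ ‖(P : C2)‖ then
    slopeMap (pinchIter p q k) P else 0, ?_⟩, fun P hP => if_pos hP⟩
  refine continuous_if_le continuous_const (by fun_prop) ?_ continuousOn_const ?_
  · intro P hP
    obtain ⟨j, hj, u, x, y, ⟨hu0, hu1⟩, -, hPe⟩ := mem_pinchSurface_of_half_le hodd hc hn P.2
      ((hhalf _ hk').trans hP)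
    have hj' : (j : ℝ) + 1 ≤ pinchNumber p q := by exact_mod_cast hj
    have hpos := hhalf (j + u) (by linarith)
    refine ContinuousAt.continuousWithinAt ((continuousAt_slopeMap _ ?_ ?_).comp
      continuous_subtype_val.continuousAt)
    · rw [hPe, ← norm_ne_zero_iff, norm_torusPoint_zero]
      exact div_ne_zero (abs_ne_zero.2 (by linarith)) (by positivity)
    · rw [hPe, ← norm_ne_zero_iff, norm_torusPoint_one]
      exact div_ne_zero (abs_ne_zero.2 (by linarith)) (by positivity)
  · intro P hP
    exact mem_pinchSurface_of_norm_eq hodd hc hn P.2 hk hP.symm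

lemma torusCurve_mem_pinchSurface {k : ℕ} (hk : k < pinchNumber p q) (t : ℝ) :
    torusPoint (1 - k / (2 * (pinchNumber p q : ℝ))) ((pinchIter p q k).1 * t)
      ((pinchIter p q k).2 * t) ∈ pinchSurface p q := by
  refine Or.inl (Set.mem_biUnion hk ⟨0, (pinchIter p q k).1 * t,
    (pinchIter p q k).2 * t, by simp, ?_, ?_⟩)
  · rw [pinchMovie, Real.smoothTransition.zero]
    have : Real.pi * (((pinchIter p q k).2 : ℝ) * ((pinchIter p q k).1 * t) -
      (pinchIter p q k).1 * ((pinchIter p q k).2 * t)) = 0 := by ring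
    rw [this]
    simp
  · simp

/-- After two or more pinch moves the surface is not a Möbius band: the maps `q₁ x - p₁ y` and
`q₂ x - p₂ y` to the circle, made constant inside of the levels of `T(p₁,q₁)` and `T(p₂,q₂)`, have
degrees `±2` and `0`, respectively any number and `±2`, along the curves `T(p₀,q₀)` and
`T(p₁,q₁)`. -/
theorem pinchNumber_le_one_of_isMobiusBand (hodd : Odd q) (hc : p.Coprime q)
    (h : IsMobiusBand (pinchSurface p q)) : pinchNumber p q ≤ 1 := by
  by_contra! hn
  obtain ⟨e⟩ := h
  obtain ⟨C⟩ := exists_mobiusCover e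
  have hn' : (2 : ℝ) ≤ pinchNumber p q := by exact_mod_cast hn
  have hhalf : ∀ v : ℝ, v ≤ pinchNumber p q → 1 / 2 ≤ 1 - v / (2 * (pinchNumber p q : ℝ)) := by
    intro v hv
    have : v / (2 * (pinchNumber p q : ℝ)) ≤ 1 / 2 := by
      rw [div_le_iff₀ (by positivity)]; linarith
    linarith
  choose f hf using fun i : Fin 2 => exists_slopeMap_extension hodd hc (by omega)
    (show (i : ℕ) + 1 ≤ pinchNumber p q by omega)
  let γ : Fin 2 → C(ℝ, pinchSurface p q) := fun j =>
    ⟨fun t => ⟨_, torusCurve_mem_pinchSurface (show (j : ℕ) < pinchNumber p q by omega) t⟩,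
      Continuous.subtype_mk (continuous_torusPoint.comp (f := fun t : ℝ =>
        ((1 - ((j : ℕ) : ℝ) / (2 * (pinchNumber p q : ℝ)) : ℝ), ((pinchIter p q j).1 * t : ℝ),
          ((pinchIter p q j).2 * t : ℝ))) (by fun_prop)) _⟩
  have hγ : ∀ j t, ((γ j t : pinchSurface p q) : C2) =
      torusPoint (1 - ((j : ℕ) : ℝ) / (2 * (pinchNumber p q : ℝ))) ((pinchIter p q j).1 * t)
        ((pinchIter p q j).2 * t) := fun j t => rfl
  have hjn : ∀ j : Fin 2, ((j : ℕ) : ℝ) ≤ pinchNumber p q := by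
    intro j
    have : (j : ℕ) ≤ pinchNumber p q := by omega
    exact_mod_cast this
  have hpos : ∀ j : Fin 2, 0 < 1 - ((j : ℕ) : ℝ) / (2 * (pinchNumber p q : ℝ)) := fun j =>
    lt_of_lt_of_le (by norm_num) (hhalf _ (hjn j))
  have hper : ∀ j, γ j 0 = γ j 1 := by
    intro j
    apply Subtype.ext
    rw [hγ, hγ, torusPoint_eq_iff (hpos j) (hpos j)]
    exact ⟨rfl, ⟨(pinchIter p q j).1, by simp⟩, (pinchIter p q j).2, by simp⟩
  let d : Fin 2 → Fin 2 → ℤ := fun i j => ((pinchIter p q (i + 1)).2 : ℤ) * (pinchIter p q j).1 -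
    (pinchIter p q (i + 1)).1 * (pinchIter p q j).2
  have hle : ∀ i j : Fin 2, (j : ℕ) ≤ i + 1 → ∀ t, f i (γ j t) =
      ((0 + (d i j : ℝ) * t : ℝ) : AddCircle (1 : ℝ)) := by
    intro i j hij t
    have hij' : ((j : ℕ) : ℝ) ≤ ((i + 1 : ℕ) : ℝ) := by exact_mod_cast hij
    rw [hf, hγ, slopeMap_torusPoint _ (hpos j)]
    · congr 1
      simp only [d]
      push_cast
      ring
    · rw [hγ, norm_torusPoint, abs_of_pos (hpos j)]
      gcongr
  have hdeg := C.degree_mul_degree f γ hper (fun _ _ => 0) (fun i j => d i j)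
    (fun i j t => hle i j (by omega) t)
  have h01 : d 0 1 = 0 := by simp [d]; ring
  have hdd : ∀ i : Fin 2, d i i ≠ 0 := by
    intro i
    obtain ⟨ε, hε, h1⟩ := pinchIter_det hodd hc (show (i : ℕ) < pinchNumber p q by omega)
    have : d i i = -(2 * ε) := by rw [← h1]; simp only [d]; ring
    rw [this]
    rcases hε with rfl | rfl <;> norm_num
  rw [h01, Int.cast_zero, zero_mul] at hdeg
  rcases mul_eq_zero.1 hdeg with h0 | h0
  · exact hdd 0 (by exact_mod_cast h0)
  · exact hdd 1 (by exact_mod_cast h0)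

end TwoPinches

/-! ### The time change and its inverse -/

section TimeChange

lemma expNegInvGlue_strictMonoOn : StrictMonoOn expNegInvGlue (Set.Ici 0) := by
  intro x hx y hy hxy
  have hy0 : 0 < y := lt_of_le_of_lt hx hxy
  rcases eq_or_lt_of_le (show (0 : ℝ) ≤ x from hx) with h0 | h0
  · rw [← h0, expNegInvGlue.zero]
    exact expNegInvGlue.pos_of_pos hy0
  · rw [expNegInvGlue, if_neg (not_le.2 h0), expNegInvGlue, if_neg (not_le.2 hy0)]
    exact Real.exp_lt_exp.2 (neg_lt_neg (inv_strictAnti₀ h0 hxy))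

lemma smoothTransition_strictMonoOn : StrictMonoOn Real.smoothTransition (Set.Icc 0 1) := by
  intro x hx y hy hxy
  have h1 := expNegInvGlue_strictMonoOn hx.1 hy.1 hxy
  have h2 : expNegInvGlue (1 - y) < expNegInvGlue (1 - x) :=
    expNegInvGlue_strictMonoOn (by simpa using hy.2) (by simpa using hx.2) (by linarith)
  have h3 := expNegInvGlue.nonneg x
  have h4 := expNegInvGlue.nonneg (1 - y)
  rw [Real.smoothTransition, Real.smoothTransition, div_lt_div_iff₀ (by linarith) (by linarith)]
  nlinarith

lemma exists_smoothTransition_inverse : ∃ ι : ℝ → ℝ, Continuous ι ∧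
    (∀ u ∈ Set.Icc (0 : ℝ) 1, ι (Real.smoothTransition u) = u) ∧
    (∀ l ∈ Set.Icc (0 : ℝ) 1, ι l ∈ Set.Icc (0 : ℝ) 1 ∧ Real.smoothTransition (ι l) = l) := by
  let f : Set.Icc (0 : ℝ) 1 → Set.Icc (0 : ℝ) 1 := fun u =>
    ⟨Real.smoothTransition u, Real.smoothTransition.nonneg _, Real.smoothTransition.le_one _⟩
  have hf : Continuous f :=
    Continuous.subtype_mk (Real.smoothTransition.continuous.comp continuous_subtype_val) _
  have hinj : Function.Injective f := fun u v h =>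
    Subtype.ext (smoothTransition_strictMonoOn.injOn u.2 v.2 (congrArg Subtype.val h))
  have hsurj : Function.Surjective f := by
    rintro ⟨l, hl⟩
    have := intermediate_value_Icc (zero_le_one (α := ℝ))
      Real.smoothTransition.continuous.continuousOn
    rw [Real.smoothTransition.zero, Real.smoothTransition.one] at this
    obtain ⟨u, hu, hul⟩ := this hl
    exact ⟨⟨u, hu⟩, Subtype.ext hul⟩
  let e := hf.homeoOfEquivCompactToT2 (f := Equiv.ofBijective f ⟨hinj, hsurj⟩)
  have hext : ∀ l (hl : l ∈ Set.Icc (0 : ℝ) 1),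
      Set.IccExtend zero_le_one (fun l => (e.symm l : ℝ)) l = e.symm ⟨l, hl⟩ := fun l hl =>
    Set.IccExtend_of_mem _ _ hl
  refine ⟨Set.IccExtend zero_le_one fun l => (e.symm l : ℝ), ?_, fun u hu => ?_, fun l hl => ?_⟩
  · exact (continuous_subtype_val.comp e.symm.continuous).Icc_extend'
  · rw [hext _ ⟨Real.smoothTransition.nonneg _, Real.smoothTransition.le_one _⟩]
    exact congrArg Subtype.val (e.symm_apply_apply ⟨u, hu⟩)
  · rw [hext _ hl]
    exact ⟨(e.symm ⟨l, hl⟩).2, congrArg Subtype.val (e.apply_symm_apply ⟨l, hl⟩)⟩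

end TimeChange

/-! ### Coordinates on the movie of a pinch move -/

section Octagon

/-- The nonnegative solution `S` of `S (S - k) = β`. -/
noncomputable def hyperbola (β k : ℝ) : ℝ := (k + √(k ^ 2 + 4 * β)) / 2

lemma hyperbola_eq {S l β : ℝ} (hS : 0 ≤ S) (hl : 0 ≤ l) (h : S * l = β) :
    hyperbola β (S - l) = S := by
  have : (S - l) ^ 2 + 4 * β = (S + l) ^ 2 := by rw [← h]; ring
  rw [hyperbola, this, Real.sqrt_sq (by positivity)]
  ring

lemma hyperbola_spec {β : ℝ} (hβ : 0 ≤ β) (k : ℝ) :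
    0 ≤ hyperbola β k ∧ 0 ≤ hyperbola β k - k ∧ hyperbola β k * (hyperbola β k - k) = β := by
  have h1 : √(k ^ 2 + 4 * β) ^ 2 = k ^ 2 + 4 * β := Real.sq_sqrt (by positivity)
  have h2 : |k| ≤ √(k ^ 2 + 4 * β) := Real.abs_le_sqrt (by linarith)
  rw [abs_le] at h2
  unfold hyperbola
  refine ⟨by linarith, by linarith, by nlinarith⟩

/-- The parameter of `hyperbola` as a function of `v ∈ [0,1]`. For `s ∈ [0,1]` the curve
`(1 - l) s = l β` is the hyperbola `(s + β) (1 - l) = β`, and the range of `(s + β) - (1 - l)` on it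
is from `β - 1` (for `v = 1`) to `β + 1 / (1 + β)` (for `v = 0`). -/
noncomputable def octParam (v β : ℝ) : ℝ := β - 1 + (1 - v) * (1 + 1 / (1 + |β|))

/-- The `s`-coordinate on the curve `(1 - l) s = l β`. -/
noncomputable def octSin (v β : ℝ) : ℝ := hyperbola β (octParam v β) - β

/-- The `l`-coordinate on the curve `(1 - l) s = l β`. -/
noncomputable def octTime (v β : ℝ) : ℝ := 1 - (hyperbola β (octParam v β) - octParam v β)

lemma continuous_octParam : Continuous fun z : ℝ × ℝ => octParam z.1 z.2 := by
  unfold octParam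
  have : Continuous fun z : ℝ × ℝ => 1 / (1 + |z.2|) :=
    continuous_const.div (by fun_prop) fun z => by positivity
  fun_prop

lemma continuous_hyperbola : Continuous fun z : ℝ × ℝ => hyperbola z.1 z.2 := by
  unfold hyperbola
  fun_prop

lemma continuous_octSin : Continuous fun z : ℝ × ℝ => octSin z.1 z.2 :=
  (continuous_hyperbola.comp (continuous_snd.prodMk continuous_octParam)).sub continuous_snd

lemma continuous_octTime : Continuous fun z : ℝ × ℝ => octTime z.1 z.2 :=
  continuous_const.sub ((continuous_hyperbola.comp
    (continuous_snd.prodMk continuous_octParam)).sub continuous_octParam)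

lemma oct_spec {v β : ℝ} (hβ : 0 ≤ β) (hv0 : 0 ≤ v) (hv1 : v ≤ 1) :
    octSin v β ∈ Set.Icc (0 : ℝ) 1 ∧ octTime v β ∈ Set.Icc (0 : ℝ) 1 ∧
      (1 - octTime v β) * octSin v β = octTime v β * β := by
  obtain ⟨h1, h2, h3⟩ := hyperbola_spec hβ (octParam v β)
  have hk : octParam v β = β - 1 + (1 - v) * (1 + 1 / (1 + β)) := by
    rw [octParam, abs_of_nonneg hβ]
  unfold octSin octTime
  obtain ⟨S, hS⟩ : ∃ S, S = hyperbola β (octParam v β) := ⟨_, rfl⟩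
  obtain ⟨l, hl⟩ : ∃ l, l = hyperbola β (octParam v β) - octParam v β := ⟨_, rfl⟩
  have hkl : S - l = β - 1 + (1 - v) * (1 + 1 / (1 + β)) := by rw [hS, hl, ← hk]; ring
  rw [← hl]
  rw [← hS] at h1 h3 ⊢
  rw [← hl] at h2
  rw [hS, ← hl, ← hS] at h3
  have hd : 1 / (1 + β) * (1 + β) = 1 := div_mul_cancel₀ _ (by positivity)
  obtain ⟨d, hd'⟩ : ∃ d, d = 1 / (1 + β) := ⟨_, rfl⟩
  rw [← hd'] at hkl hd
  have hdpos : 0 < d := hd' ▸ by positivity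
  have hlow : β - 1 ≤ S - l := by
    have : 0 ≤ (1 - v) * (1 + d) := mul_nonneg (by linarith) (by linarith)
    linarith
  have hup : S - l ≤ β + d := by
    have : 0 ≤ v * (1 + d) := mul_nonneg hv0 (by linarith)
    linarith
  have hSβ : β ≤ S := by
    by_contra! hcon
    have hβ' : 0 < β := lt_of_le_of_lt h1 hcon
    have : 1 < l := by
      by_contra! hl1
      nlinarith
    linarith
  have hS1 : S ≤ 1 + β := by
    by_contra! hcon
    have : l ≤ 1 - d := by
      by_contra! hl1
      have e1 : (1 - d) * (1 + β) = β := by linarith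
      have h0 : 0 ≤ 1 - d := by
        by_contra! hneg
        nlinarith
      nlinarith
    linarith
  have hl1 : l ≤ 1 := by
    by_contra! hcon
    have : S * (l - 1) ≤ 0 := by linarith
    have hS0 : S ≤ 0 := by
      by_contra! hS0
      nlinarith
    linarith
  refine ⟨⟨by linarith, by linarith⟩, ⟨by linarith, by linarith⟩, by linarith⟩

lemma oct_exists {s l β : ℝ} (hβ : 0 ≤ β) (hs : s ∈ Set.Icc (0 : ℝ) 1) (hl : l ∈ Set.Icc (0 : ℝ) 1)
    (h : (1 - l) * s = l * β) :
    ∃ v ∈ Set.Icc (0 : ℝ) 1, octSin v β = s ∧ octTime v β = l := by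
  obtain ⟨hs0, hs1⟩ := hs
  obtain ⟨hl0, hl1⟩ := hl
  have hd : 1 / (1 + β) * (1 + β) = 1 := div_mul_cancel₀ _ (by positivity)
  obtain ⟨d, hd'⟩ : ∃ d, d = 1 / (1 + β) := ⟨_, rfl⟩
  rw [← hd'] at hd
  have hdpos : 0 < d := hd' ▸ by positivity
  have hN : (0 : ℝ) < 1 + d := by linarith
  have hv : octParam (1 - (s + l) / (1 + d)) β = (s + β) - (1 - l) := by
    rw [octParam, abs_of_nonneg hβ, ← hd', sub_sub_cancel, div_mul_cancel₀ _ hN.ne']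
    ring
  have hh : hyperbola β ((s + β) - (1 - l)) = s + β :=
    hyperbola_eq (by linarith) (by linarith) (by linarith)
  refine ⟨1 - (s + l) / (1 + d), ⟨?_, ?_⟩, ?_, ?_⟩
  · have : (s + l) / (1 + d) ≤ 1 := by
      rw [div_le_one hN]
      -- `l (s + β) = s`, and `s / (s + β)` is increasing in `s`
      have h1 : l * (1 + β) ≤ 1 := by nlinarith
      have : l ≤ d := by
        by_contra! hcon
        nlinarith
      linarith
    linarith
  · have : 0 ≤ (s + l) / (1 + d) := by positivity
    linarith
  · rw [octSin, hv, hh]; ring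
  · rw [octTime, hv, hh]; ring

lemma oct_inj {v v' β : ℝ} (hs : octSin v β = octSin v' β) (hl : octTime v β = octTime v' β) :
    v = v' := by
  have : octParam v β = octParam v' β := by
    unfold octSin at hs
    unfold octTime at hl
    linarith
  unfold octParam at this
  have hN : (0 : ℝ) < 1 + 1 / (1 + |β|) := by positivity
  have := mul_right_cancel₀ hN.ne' (add_left_cancel this)
  linarith

lemma octSin_zero_left {β : ℝ} (hβ : 0 ≤ β) : octSin 0 β = 1 := by
  have h : octParam 0 β = (1 + β) - β / (1 + β) := by
    rw [octParam, abs_of_nonneg hβ]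
    field_simp
    ring
  rw [octSin, h, hyperbola_eq (by positivity) (by positivity) (by field_simp)]
  ring

lemma eq_zero_of_octSin_eq_one {v β : ℝ} (hβ : 0 ≤ β) (hv : v ∈ Set.Icc (0 : ℝ) 1)
    (h : octSin v β = 1) : v = 0 := by
  refine oct_inj (β := β) (h.trans (octSin_zero_left hβ).symm) ?_
  have h1 := (oct_spec hβ hv.1 hv.2).2.2
  have h2 := (oct_spec hβ le_rfl (zero_le_one (α := ℝ))).2.2
  rw [h] at h1
  rw [octSin_zero_left hβ] at h2
  have h3 : (1 + β) * (octTime v β - octTime 0 β) = 0 := by linarith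
  have := (mul_eq_zero.1 h3).resolve_left (by positivity)
  linarith

lemma octParam_zero_right (v : ℝ) : octParam v 0 = 1 - 2 * v := by
  rw [octParam]; norm_num; ring

lemma octSin_zero_right (v : ℝ) : octSin v 0 = max (1 - 2 * v) 0 := by
  rw [octSin, octParam_zero_right, hyperbola, mul_zero, add_zero, Real.sqrt_sq_eq_abs, sub_zero]
  rcases le_total 0 (1 - 2 * v) with h | h
  · rw [abs_of_nonneg h, max_eq_left h]; ring
  · rw [abs_of_nonpos h, max_eq_right h]; ring

lemma octTime_zero_right (v : ℝ) : octTime v 0 = min 1 (2 - 2 * v) := by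
  rw [octTime, octParam_zero_right, hyperbola, mul_zero, add_zero, Real.sqrt_sq_eq_abs]
  rcases le_total 0 (1 - 2 * v) with h | h
  · rw [abs_of_nonneg h, min_eq_left (by linarith)]; ring
  · rw [abs_of_nonpos h, min_eq_right (by linarith)]; ring

/-- The angle `a ∈ [0,1]` with `sin πa = s`, in the left half `a ≤ 1/2` for `σ ≤ 0` and in the right
half for `σ > 0`. -/
noncomputable def octAngle (σ s : ℝ) : ℝ :=
  if σ ≤ 0 then Real.arcsin s / Real.pi else 1 - Real.arcsin s / Real.pi

lemma octAngle_mem (σ : ℝ) {s : ℝ} (hs : 0 ≤ s) : octAngle σ s ∈ Set.Icc (0 : ℝ) 1 := by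
  have h1 : 0 ≤ Real.arcsin s / Real.pi := div_nonneg (Real.arcsin_nonneg.2 hs) Real.pi_pos.le
  have h2 : Real.arcsin s / Real.pi ≤ 1 := by
    rw [div_le_one Real.pi_pos]
    have := Real.arcsin_le_pi_div_two s
    linarith [Real.pi_pos]
  unfold octAngle
  split_ifs
  · exact ⟨h1, h2⟩
  · exact ⟨by linarith, by linarith⟩

lemma sin_octAngle (σ : ℝ) {s : ℝ} (hs : s ∈ Set.Icc (0 : ℝ) 1) :
    Real.sin (Real.pi * octAngle σ s) = s := by
  have h : Real.sin (Real.arcsin s) = s := Real.sin_arcsin (by linarith [hs.1]) hs.2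
  unfold octAngle
  split_ifs
  · rw [mul_div_cancel₀ _ Real.pi_ne_zero, h]
  · rw [mul_sub, mul_div_cancel₀ _ Real.pi_ne_zero, mul_one, Real.sin_pi_sub, h]

lemma octAngle_one (σ : ℝ) : octAngle σ 1 = 1 / 2 := by
  have h : Real.arcsin 1 / Real.pi = 1 / 2 := by
    rw [Real.arcsin_one]
    field_simp
  unfold octAngle
  rw [h]
  split_ifs <;> norm_num

lemma octAngle_neg (σ : ℝ) {s : ℝ} (h : σ = 0 → s = 1) : octAngle (-σ) s = 1 - octAngle σ s := by
  rcases lt_trichotomy σ 0 with h1 | h1 | h1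
  · rw [octAngle, if_neg (by linarith), octAngle, if_pos h1.le]
  · rw [h h1, octAngle_one, octAngle_one]; norm_num
  · rw [octAngle, if_pos (by linarith), octAngle, if_neg (by linarith)]; ring

lemma octAngle_sin {a : ℝ} (ha : a ∈ Set.Icc (0 : ℝ) 1) {σ : ℝ} (h1 : σ ≤ 0 → a ≤ 1 / 2)
    (h2 : 0 < σ → 1 / 2 ≤ a) : octAngle σ (Real.sin (Real.pi * a)) = a := by
  have hpi := Real.pi_pos
  unfold octAngle
  split_ifs with h
  · rw [Real.arcsin_sin, mul_div_cancel_left₀ _ hpi.ne']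
    · nlinarith [ha.1]
    · nlinarith [h1 h]
  · rw [← Real.sin_pi_sub, Real.arcsin_sin]
    · field_simp; ring
    · nlinarith [ha.2]
    · nlinarith [h2 (not_le.1 h)]

/-- The sign of `σ` is determined by the angle, except in the middle. -/
lemma eq_of_octAngle_eq {σ σ' s : ℝ} (hs : s < 1) (habs : |σ| = |σ'|)
    (h : octAngle σ s = octAngle σ' s) : σ = σ' := by
  have hlt : Real.arcsin s / Real.pi < 1 / 2 := by
    rw [div_lt_iff₀ Real.pi_pos]
    have := Real.arcsin_lt_pi_div_two.2 hs
    linarith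
  unfold octAngle at h
  split_ifs at h with h1 h2 h2
  · rw [abs_of_nonpos h1, abs_of_nonpos h2] at habs; linarith
  · linarith
  · linarith
  · rw [abs_of_pos (not_le.1 h1), abs_of_pos (not_le.1 h2)] at habs; exact habs

end Octagon

/-! ### One pinch move and a disc: the surface -/

section CappedShell

open Topology

/-- The inverse on `[0,1]` of the time change `Real.smoothTransition`. -/
noncomputable def timeInv : ℝ → ℝ := exists_smoothTransition_inverse.choose

/-- The radius of the sphere that contains the level `l` of the movie. -/
noncomputable def radius (l : ℝ) : ℝ := 1 - timeInv l / 2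

lemma continuous_radius : Continuous radius :=
  continuous_const.sub (exists_smoothTransition_inverse.choose_spec.1.div_const 2)

lemma radius_smoothTransition {u : ℝ} (hu : u ∈ Set.Icc (0 : ℝ) 1) :
    radius (Real.smoothTransition u) = 1 - u / 2 := by
  rw [radius, timeInv, exists_smoothTransition_inverse.choose_spec.2.1 u hu]

lemma exists_radius_eq {l : ℝ} (hl : l ∈ Set.Icc (0 : ℝ) 1) :
    ∃ u ∈ Set.Icc (0 : ℝ) 1, Real.smoothTransition u = l ∧ radius l = 1 - u / 2 :=
  ⟨timeInv l, (exists_smoothTransition_inverse.choose_spec.2.2 l hl).1,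
    (exists_smoothTransition_inverse.choose_spec.2.2 l hl).2, rfl⟩

lemma radius_one : radius 1 = 1 / 2 := by
  have := radius_smoothTransition (u := 1) (by simp)
  rw [Real.smoothTransition.one] at this
  rw [this]; norm_num

lemma half_le_radius {l : ℝ} (hl : l ∈ Set.Icc (0 : ℝ) 1) : 1 / 2 ≤ radius l := by
  obtain ⟨u, hu, -, h⟩ := exists_radius_eq hl
  linarith [hu.2]

lemma radius_injOn : Set.InjOn radius (Set.Icc 0 1) := by
  intro l hl l' hl' h
  obtain ⟨u, hu, rfl, h1⟩ := exists_radius_eq hl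
  obtain ⟨u', hu', rfl, h1'⟩ := exists_radius_eq hl'
  congr 1
  linarith

/-- The movie `pinchMovie` from `T(qm + 2ε, q)` to `T(m, 1)`, where `qm + 2ε` may be negative. -/
noncomputable def bandMovie (q m : ℕ) (ε : ℤ) (l x y : ℝ) : ℝ :=
  (1 - l) * Real.sin (Real.pi * (q * x - (q * m + 2 * ε) * y)) +
    l * Real.sin (Real.pi * (x - m * y))

/-- The cobordism from `T(qm + 2ε, q)` to `T(m, 1)` in the shell of radius from `1` to `1/2`. -/
def bandShell (q m : ℕ) (ε : ℤ) : Set C2 :=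
  {P | ∃ u x y : ℝ, u ∈ Set.Icc 0 1 ∧ bandMovie q m ε (Real.smoothTransition u) x y = 0 ∧
    P = torusPoint (1 - u / 2) x y}

/-- A parametrization by the unit disc of a disc with boundary `T(m,1)` on the sphere of radius
`1/2`; the function `G` is `|z|` as a function of `|w|`, up to a scale. -/
noncomputable def discPoint (m : ℕ) (G : ℝ → ℝ) (ζ : ℂ) : C2 :=
  !₂[(((1 / 2) / √2 * G ‖ζ‖ : ℝ) : ℂ) * (ζ / ‖ζ‖) ^ m, (((1 / 2) / √2 : ℝ) : ℂ) * ζ]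

/-- The cobordism `bandShell`, capped off by a disc with profile `G`. -/
def cappedShell (q m : ℕ) (ε : ℤ) (G : ℝ → ℝ) : Set C2 :=
  bandShell q m ε ∪ discPoint m G '' Metric.closedBall 0 1

lemma continuous_discPoint {m : ℕ} {G : ℝ → ℝ} (hG : Continuous G) (hG0 : m ≠ 0 → G 0 = 0) :
    Continuous (discPoint m G) := by
  unfold discPoint
  refine (PiLp.continuous_toLp 2 _).comp (continuous_pi fun i => ?_)
  fin_cases i
  · change Continuous fun ζ : ℂ => (((1 / 2) / √2 * G ‖ζ‖ : ℝ) : ℂ) * (ζ / ‖ζ‖) ^ m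
    by_cases hm : m = 0
    · subst hm
      simp only [pow_zero, mul_one]
      fun_prop
    · rw [continuous_iff_continuousAt]
      intro ζ
      by_cases hζ : ζ = 0
      · subst hζ
        have h0 : (((1 / 2) / √2 * G ‖(0 : ℂ)‖ : ℝ) : ℂ) * ((0 : ℂ) / ‖(0 : ℂ)‖) ^ m = 0 := by
          simp [hm]
        rw [ContinuousAt, h0]
        have hlim : Filter.Tendsto (fun ζ : ℂ => |(1 / 2) / √2 * G ‖ζ‖|) (𝓝 0) (𝓝 0) := by
          have hc : Continuous fun ζ : ℂ => |(1 / 2) / √2 * G ‖ζ‖| := by fun_prop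
          have := hc.tendsto 0
          rwa [norm_zero, hG0 hm, mul_zero, abs_zero] at this
        refine squeeze_zero_norm (fun ζ => ?_) hlim
        rw [norm_mul, Complex.norm_real, Real.norm_eq_abs, norm_pow, norm_div, Complex.norm_real,
          norm_norm]
        refine mul_le_of_le_one_right (abs_nonneg _) (pow_le_one₀ (by positivity) ?_)
        exact div_self_le_one _
      · have : ((‖ζ‖ : ℝ) : ℂ) ≠ 0 := by simpa using hζ
        fun_prop (disch := assumption)
  · change Continuous fun ζ : ℂ => (((1 / 2) / √2 : ℝ) : ℂ) * ζ
    fun_prop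

lemma discPoint_injective (m : ℕ) (G : ℝ → ℝ) : Function.Injective (discPoint m G) := by
  intro ζ ζ' h
  have h1 : (((1 / 2) / √2 : ℝ) : ℂ) * ζ = (((1 / 2) / √2 : ℝ) : ℂ) * ζ' :=
    congrArg (fun P : C2 => P 1) h
  refine mul_left_cancel₀ ?_ h1
  rw [Complex.ofReal_ne_zero]
  positivity

lemma norm_discPoint_one (m : ℕ) (G : ℝ → ℝ) (ζ : ℂ) :
    ‖discPoint m G ζ 1‖ = (1 / 2) / √2 * ‖ζ‖ := by
  change ‖(((1 / 2) / √2 : ℝ) : ℂ) * ζ‖ = _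
  rw [norm_mul, Complex.norm_real, Real.norm_of_nonneg (by positivity)]

/-- The boundary of the disc and the cone over it. -/
lemma smul_discPoint_exp (m : ℕ) {G : ℝ → ℝ} (hG1 : G 1 = 1) (R y : ℝ) (B : ℤ) :
    (2 * R) • discPoint m G (Complex.exp ((2 * Real.pi * y : ℝ) * Complex.I)) =
      torusPoint R (B + m * y) y := by
  have hexp : Complex.exp ((2 * Real.pi * y : ℝ) * Complex.I) ^ m =
      Complex.exp ((2 * Real.pi * (B + m * y) : ℝ) * Complex.I) := by
    rw [← Complex.exp_nat_mul]
    have := (exp_two_pi_eq_iff (m * y) (B + m * y)).2 ⟨B, by ring⟩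
    rw [← this]
    congr 1
    push_cast
    ring
  ext i
  fin_cases i
  · change (2 * R) • ((((1 / 2) / √2 * G ‖_‖ : ℝ) : ℂ) * (_ / ‖_‖) ^ m) = _
    rw [Complex.norm_exp_ofReal_mul_I, hG1, Complex.ofReal_one, div_one, hexp, Complex.real_smul]
    change _ = ((R / √2 : ℝ) : ℂ) * _
    rw [← mul_assoc, ← Complex.ofReal_mul]
    congr 2
    ring
  · change (2 * R) • ((((1 / 2) / √2 : ℝ) : ℂ) * _) = ((R / √2 : ℝ) : ℂ) * _
    rw [Complex.real_smul, ← mul_assoc, ← Complex.ofReal_mul]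
    congr 2
    ring

/-- The angular coordinate `y` at which `q x - (qm + 2ε) y = A` and `x - m y = B`. -/
noncomputable def slopeY (q : ℕ) (ε : ℤ) (A B : ℝ) : ℝ := ε * (q * B - A) / 2

/-- The point of the shell with `q x - (qm + 2ε) y = A` and `x - m y = B`. -/
noncomputable def slopePoint (q m : ℕ) (ε : ℤ) (l A B : ℝ) : C2 :=
  torusPoint (radius l) (B + m * slopeY q ε A B) (slopeY q ε A B)

variable {q m : ℕ} {ε : ℤ}

lemma sq_eq_one_of_sign (hε : ε = 1 ∨ ε = -1) : (ε : ℝ) * ε = 1 := by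
  rcases hε with rfl | rfl <;> norm_num

lemma slope_eq (hε : ε = 1 ∨ ε = -1) (A B : ℝ) :
    q * (B + m * slopeY q ε A B) - (q * m + 2 * ε) * slopeY q ε A B = A := by
  rw [slopeY]
  linear_combination (A - q * B) * sq_eq_one_of_sign hε

lemma bandMovie_slope (hε : ε = 1 ∨ ε = -1) (l A B : ℝ) :
    bandMovie q m ε l (B + m * slopeY q ε A B) (slopeY q ε A B) =
      (1 - l) * Real.sin (Real.pi * A) + l * Real.sin (Real.pi * B) := by
  rw [bandMovie, slope_eq hε, add_sub_cancel_right]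

lemma slopeY_of_slope (hε : ε = 1 ∨ ε = -1) (x y : ℝ) :
    slopeY q ε (q * x - (q * m + 2 * ε) * y) (x - m * y) = y := by
  rw [slopeY]
  linear_combination y * sq_eq_one_of_sign hε

/-- The angular coordinates `(A, B)` matter only up to the lattice of integer vectors whose
entries have the same parity. -/
lemma slopePoint_eq_iff (hq : Odd q) (hε : ε = 1 ∨ ε = -1) {l l' : ℝ}
    (hl : l ∈ Set.Icc (0 : ℝ) 1) (hl' : l' ∈ Set.Icc (0 : ℝ) 1) (A B A' B' : ℝ) :
    slopePoint q m ε l A B = slopePoint q m ε l' A' B' ↔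
      l = l' ∧ ∃ i j : ℤ, Even (i + j) ∧ A' = A + i ∧ B' = B + j := by
  have h1 := half_le_radius hl
  have h2 := half_le_radius hl'
  rw [slopePoint, slopePoint, torusPoint_eq_iff (by linarith) (by linarith)]
  constructor
  · rintro ⟨hR, ⟨i, hi⟩, j, hj⟩
    refine ⟨radius_injOn hl hl' hR, q * i - (q * m + 2 * ε) * j, i - m * j, ?_, ?_, ?_⟩
    · obtain ⟨k, hk⟩ := hq
      refine ⟨k * i + i - (k * m + m + ε) * j, ?_⟩
      rw [hk]; push_cast; ring
    · have e1 := slope_eq (q := q) (m := m) hε A B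
      have e2 := slope_eq (q := q) (m := m) hε A' B'
      rw [hi, hj] at e2
      push_cast
      linear_combination e1 - e2
    · push_cast
      linear_combination hi - m * hj
  · rintro ⟨rfl, i, j, ⟨k, hk⟩, rfl, rfl⟩
    obtain ⟨n, hn⟩ := hq
    have hk' : (i : ℝ) = 2 * k - j := by
      have : (i : ℝ) + j = k + k := by exact_mod_cast hk
      linarith
    have hn' : (q : ℝ) = 2 * n + 1 := by exact_mod_cast hn
    have hy : slopeY q ε (A + i) (B + j) = slopeY q ε A B + (ε * (n * j + j - k) : ℤ) := by
      push_cast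
      rw [slopeY, slopeY, hk', hn']
      ring
    refine ⟨rfl, ⟨j + m * (ε * (n * j + j - k)), ?_⟩, ε * (n * j + j - k), hy⟩
    rw [hy]; push_cast; ring

lemma exp_slopeY (hq : Odd q) (hε : ε = 1 ∨ ε = -1) (a : ℝ) :
    Complex.exp ((2 * Real.pi * slopeY q ε a 1 : ℝ) * Complex.I) =
      ⟨-Real.cos (Real.pi * a), ε * Real.sin (Real.pi * a)⟩ ∧
    Complex.exp ((2 * Real.pi * slopeY q ε a 2 : ℝ) * Complex.I) =
      ⟨Real.cos (Real.pi * a), -(ε * Real.sin (Real.pi * a))⟩ := by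
  obtain ⟨n, hn⟩ := hq
  have hn' : (q : ℝ) = 2 * n + 1 := by exact_mod_cast hn
  have key : ∀ θ : ℝ, Complex.exp ((θ : ℝ) * Complex.I) = ⟨Real.cos θ, Real.sin θ⟩ := by
    intro θ
    apply Complex.ext
    · simp [Complex.exp_ofReal_mul_I_re]
    · simp [Complex.exp_ofReal_mul_I_im]
  have per : ∀ (θ : ℝ) (k : ℤ), Real.cos (θ + k * (2 * Real.pi)) = Real.cos θ ∧
      Real.sin (θ + k * (2 * Real.pi)) = Real.sin θ := fun θ k =>
    ⟨Real.cos_add_int_mul_two_pi θ k, Real.sin_add_int_mul_two_pi θ k⟩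
  rw [key, key, slopeY, slopeY, hn']
  rcases hε with rfl | rfl
  · constructor
    · have e : 2 * Real.pi * (((1 : ℤ) : ℝ) * ((2 * (n : ℝ) + 1) * 1 - a) / 2) =
        (Real.pi - Real.pi * a) + (n : ℤ) * (2 * Real.pi) := by push_cast; ring
      rw [e, (per _ _).1, (per _ _).2, Real.cos_pi_sub, Real.sin_pi_sub]
      simp
    · have e : 2 * Real.pi * (((1 : ℤ) : ℝ) * ((2 * (n : ℝ) + 1) * 2 - a) / 2) =
        -(Real.pi * a) + ((2 * n + 1 : ℕ) : ℤ) * (2 * Real.pi) := by push_cast; ring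
      rw [e, (per _ _).1, (per _ _).2, Real.cos_neg, Real.sin_neg]
      simp
  · constructor
    · have e : 2 * Real.pi * (((-1 : ℤ) : ℝ) * ((2 * (n : ℝ) + 1) * 1 - a) / 2) =
        (Real.pi * a + Real.pi) + (-(n + 1 : ℕ) : ℤ) * (2 * Real.pi) := by push_cast; ring
      rw [e, (per _ _).1, (per _ _).2, Real.cos_add_pi, Real.sin_add_pi]
      simp
    · have e : 2 * Real.pi * (((-1 : ℤ) : ℝ) * ((2 * (n : ℝ) + 1) * 2 - a) / 2) =
        (Real.pi * a) + (-(2 * n + 1 : ℕ) : ℤ) * (2 * Real.pi) := by push_cast; ring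
      rw [e, (per _ _).1, (per _ _).2]
      simp

/-- A point of the shell has coordinates `A = a` and `B = b + 1` in a unit square, where both terms
of the movie have opposite signs. -/
lemma exists_slopePoint (hq : Odd q) (hε : ε = 1 ∨ ε = -1) {P : C2} (hP : P ∈ bandShell q m ε) :
    ∃ a ∈ Set.Icc (0 : ℝ) 1, ∃ b ∈ Set.Icc (0 : ℝ) 1, ∃ l ∈ Set.Icc (0 : ℝ) 1,
      (1 - l) * Real.sin (Real.pi * a) = l * Real.sin (Real.pi * b) ∧
        P = slopePoint q m ε l a (b + 1) := by
  obtain ⟨u, x, y, hu, hm, rfl⟩ := hP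
  set l := Real.smoothTransition u with hl
  have hlI : l ∈ Set.Icc (0 : ℝ) 1 :=
    ⟨Real.smoothTransition.nonneg _, Real.smoothTransition.le_one _⟩
  obtain ⟨A, hA⟩ : ∃ A, A = q * x - (q * m + 2 * ε) * y := ⟨_, rfl⟩
  obtain ⟨B, hB⟩ : ∃ B, B = x - m * y := ⟨_, rfl⟩
  have hP : torusPoint (1 - u / 2) x y = slopePoint q m ε l A B := by
    rw [slopePoint, hl, radius_smoothTransition hu, hA, hB, slopeY_of_slope hε, sub_add_cancel]
  have hm' : (1 - l) * Real.sin (Real.pi * A) + l * Real.sin (Real.pi * B) = 0 := by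
    rw [hA, hB]; exact hm
  have hsin : ∀ (t : ℝ) (n : ℤ), Real.sin (Real.pi * (t + n)) =
      (-1) ^ n * Real.sin (Real.pi * t) := by
    intro t n
    rw [mul_add, mul_comm Real.pi (n : ℝ), Real.sin_add_int_mul_pi]
  -- translations by the lattice
  have key : ∀ (a b : ℝ) (i j : ℤ), Even (i + j) → A = a + i → B = b + 1 + j →
      a ∈ Set.Icc (0 : ℝ) 1 → b ∈ Set.Icc (0 : ℝ) 1 →
      (1 - l) * Real.sin (Real.pi * a) = l * Real.sin (Real.pi * b) →
      ∃ a ∈ Set.Icc (0 : ℝ) 1, ∃ b ∈ Set.Icc (0 : ℝ) 1, ∃ l ∈ Set.Icc (0 : ℝ) 1,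
        (1 - l) * Real.sin (Real.pi * a) = l * Real.sin (Real.pi * b) ∧
          torusPoint (1 - u / 2) x y = slopePoint q m ε l a (b + 1) := by
    intro a b i j hij hAa hBb ha hb h
    refine ⟨a, ha, b, hb, l, hlI, h, hP.trans ?_⟩
    exact ((slopePoint_eq_iff hq hε hlI hlI _ _ _ _).2 ⟨rfl, i, j, hij, hAa, hBb⟩).symm
  obtain ⟨i, hi⟩ : ∃ i, i = ⌊A⌋ := ⟨_, rfl⟩
  obtain ⟨j, hj⟩ : ∃ j, j = ⌊B - 1⌋ := ⟨_, rfl⟩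
  obtain ⟨a, ha⟩ : ∃ a, a = Int.fract A := ⟨_, rfl⟩
  obtain ⟨b, hb⟩ : ∃ b, b = Int.fract (B - 1) := ⟨_, rfl⟩
  have hAa : A = a + i := by rw [ha, hi, Int.fract_add_floor]
  have hBb : B = b + 1 + j := by
    have := Int.fract_add_floor (B - 1)
    rw [← hb, ← hj] at this
    linarith
  have ha0 : 0 ≤ a := ha ▸ Int.fract_nonneg _
  have ha1 : a < 1 := ha ▸ Int.fract_lt_one _
  have hb0 : 0 ≤ b := hb ▸ Int.fract_nonneg _
  have hb1 : b < 1 := hb ▸ Int.fract_lt_one _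
  have hsa : 0 ≤ Real.sin (Real.pi * a) :=
    Real.sin_nonneg_of_nonneg_of_le_pi (by positivity) (by nlinarith [Real.pi_pos])
  have hsb : 0 ≤ Real.sin (Real.pi * b) :=
    Real.sin_nonneg_of_nonneg_of_le_pi (by positivity) (by nlinarith [Real.pi_pos])
  have hm2 : (1 - l) * ((-1) ^ i * Real.sin (Real.pi * a)) =
      l * ((-1) ^ j * Real.sin (Real.pi * b)) := by
    have e := hsin (b + 1) j
    rw [mul_add Real.pi b 1, mul_one, Real.sin_add_pi] at e
    rw [hAa, hBb, hsin, e] at hm'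
    linarith
  have hsq : ∀ n : ℤ, ((-1 : ℝ) ^ n) * (-1) ^ n = 1 := fun n => by
    rw [← mul_zpow]; simp
  rcases Int.even_or_odd (i + j) with hij | hij
  · refine key a b i j hij hAa hBb ⟨ha0, ha1.le⟩ ⟨hb0, hb1.le⟩ ?_
    have hji : ((-1 : ℝ) ^ i) * (-1) ^ j = 1 := by
      rw [← zpow_add₀ (by norm_num)]; exact hij.neg_one_zpow
    linear_combination ((-1 : ℝ) ^ i) * hm2 + (l * Real.sin (Real.pi * b)) * hji -
      ((1 - l) * Real.sin (Real.pi * a)) * hsq i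
  · have hji : ((-1 : ℝ) ^ i) * (-1) ^ j = -1 := by
      rw [← zpow_add₀ (by norm_num)]; exact hij.neg_one_zpow
    have h0 : (1 - l) * Real.sin (Real.pi * a) + l * Real.sin (Real.pi * b) = 0 := by
      linear_combination ((-1 : ℝ) ^ i) * hm2 + (l * Real.sin (Real.pi * b)) * hji -
        ((1 - l) * Real.sin (Real.pi * a)) * hsq i
    have h1 : 0 ≤ (1 - l) * Real.sin (Real.pi * a) := mul_nonneg (by linarith [hlI.2]) hsa
    have h2 : 0 ≤ l * Real.sin (Real.pi * b) := mul_nonneg hlI.1 hsb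
    have h3 : (1 - l) * Real.sin (Real.pi * a) = 0 := by linarith
    have h4 : l * Real.sin (Real.pi * b) = 0 := by linarith
    have hzero : ∀ t : ℝ, 0 ≤ t → t < 1 → Real.sin (Real.pi * t) = 0 → t = 0 := by
      intro t ht0 ht1 ht
      by_contra hne
      have : 0 < t := lt_of_le_of_ne ht0 (Ne.symm hne)
      have := Real.sin_pos_of_pos_of_lt_pi (x := Real.pi * t) (by positivity)
        (by nlinarith [Real.pi_pos])
      linarith
    by_cases hA0 : Real.sin (Real.pi * a) = 0
    · have := hzero a ha0 ha1 hA0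
      refine key 1 b (i - 1) j ?_ ?_ hBb (by simp) ⟨hb0, hb1.le⟩ ?_
      · have := hij.sub_odd odd_one
        rwa [show i + j - 1 = i - 1 + j by ring] at this
      · push_cast; linarith
      · simp [h4]
    · have hl1 : l = 1 := by
        have := (mul_eq_zero.1 h3).resolve_right hA0
        linarith
      have hB0 : Real.sin (Real.pi * b) = 0 := by rw [hl1] at h4; linarith
      have := hzero b hb0 hb1 hB0
      refine key a 1 i (j - 1) ?_ hAa ?_ ⟨ha0, ha1.le⟩ (by simp) ?_
      · have := hij.sub_odd odd_one
        rwa [show i + j - 1 = i + (j - 1) by ring] at this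
      · push_cast; linarith
      · simp [h3]

lemma slopePoint_mem (hε : ε = 1 ∨ ε = -1) {l a b : ℝ} (hl : l ∈ Set.Icc (0 : ℝ) 1)
    (h : (1 - l) * Real.sin (Real.pi * a) = l * Real.sin (Real.pi * b)) :
    slopePoint q m ε l a (b + 1) ∈ bandShell q m ε := by
  obtain ⟨u, hu, hul, hr⟩ := exists_radius_eq hl
  refine ⟨u, _, _, hu, ?_, by rw [slopePoint, hr]⟩
  rw [hul, bandMovie_slope hε, h, mul_add, mul_one, Real.sin_add_pi]
  ring

end CappedShell

/-! ### One pinch move and a disc: the homeomorphism with a Möbius band -/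

section BandMap

open Topology

/-- The half-height `sin πa` over `σ` of the unit disc, which is zero for `|σ| ≥ 1/2`. -/
noncomputable def discHeight (σ : ℝ) : ℝ := octSin |σ| 0

/-- The angle over `σ` on the boundary of the disc. -/
noncomputable def discAngle (σ : ℝ) : ℝ := octAngle σ (discHeight σ)

/-- The point of the unit disc over `σ`, at depth `-y`. -/
noncomputable def discCoord (ε : ℤ) (σ y : ℝ) : ℂ :=
  ⟨-Real.cos (Real.pi * discAngle σ), ε * (discHeight σ + y)⟩

/-- `sin πb` on the movie, extended by a nonnegative function. -/
noncomputable def octBeta (b : ℝ) : ℝ := |Real.sin (Real.pi * b)|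

/-- The cut open Möbius band, mapped onto the surface. The region `0 ≤ y ≤ 1` is the square
`(a, b) ∈ [0,1]²`, with corners blown up, in which the movie takes place; `y = b`, and `σ` is a
coordinate on the level curves of `b`. The sides `b = 0` and `b = 1` are glued to the lower and the
upper half of the boundary of the unit disc. So the two halves of the disc are put below and above,
with `y` from `-sin πa` to `0` and from `1` to `1 + sin πa`. The factor `2 * radius` makes the
formulas agree at `y = 0` and at `y = 1` also at the corners `|σ| ≥ 1/2`, where
the time of the movie varies. -/
noncomputable def bandPoint (q m : ℕ) (ε : ℤ) (G : ℝ → ℝ) (σ y : ℝ) : C2 :=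
  if y ≤ 0 then (2 * radius (octTime |σ| 0)) • discPoint m G (discCoord ε σ y)
  else if y ≤ 1 then slopePoint q m ε (octTime |σ| (octBeta y))
    (octAngle σ (octSin |σ| (octBeta y))) (y + 1)
  else (2 * radius (octTime |σ| 0)) • discPoint m G (-discCoord ε σ (1 - y))

lemma octBeta_nonneg (b : ℝ) : 0 ≤ octBeta b := abs_nonneg _

lemma octBeta_eq {b : ℝ} (hb : b ∈ Set.Icc (0 : ℝ) 1) : octBeta b = Real.sin (Real.pi * b) :=
  abs_of_nonneg (Real.sin_nonneg_of_nonneg_of_le_pi (mul_nonneg Real.pi_pos.le hb.1)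
    (mul_le_of_le_one_right Real.pi_pos.le hb.2))

lemma octBeta_zero : octBeta 0 = 0 := by simp [octBeta]

lemma octBeta_one : octBeta 1 = 0 := by simp [octBeta]

lemma discHeight_eq (σ : ℝ) : discHeight σ = max (1 - 2 * |σ|) 0 := octSin_zero_right _

variable {σ σ' y y' : ℝ}

lemma discHeight_mem (hσ : |σ| ≤ 1) : discHeight σ ∈ Set.Icc (0 : ℝ) 1 :=
  (oct_spec le_rfl (abs_nonneg σ) hσ).1

lemma sin_discAngle (hσ : |σ| ≤ 1) : Real.sin (Real.pi * discAngle σ) = discHeight σ :=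
  sin_octAngle _ (discHeight_mem hσ)

lemma discAngle_mem (hσ : |σ| ≤ 1) : discAngle σ ∈ Set.Icc (0 : ℝ) 1 :=
  octAngle_mem _ (discHeight_mem hσ).1

lemma discHeight_neg (σ : ℝ) : discHeight (-σ) = discHeight σ := by
  rw [discHeight, discHeight, abs_neg]

lemma discAngle_neg (σ : ℝ) : discAngle (-σ) = 1 - discAngle σ := by
  rw [discAngle, discAngle, discHeight_neg]
  refine octAngle_neg σ fun h => ?_
  rw [h, discHeight_eq]; simp

lemma octTime_eq_one (h : |σ| ≤ 1 / 2) : octTime |σ| 0 = 1 := by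
  rw [octTime_zero_right, min_eq_left (by linarith)]

lemma abs_lt_of_discHeight_pos (h : 0 < discHeight σ) : discHeight σ = 1 - 2 * |σ| := by
  rw [discHeight_eq] at h ⊢
  rcases lt_max_iff.1 h with h | h
  · exact max_eq_left h.le
  · exact absurd h (lt_irrefl _)

/-- For a positive height, `σ` is determined by the height and the angle. -/
lemma eq_of_discAngle_eq (h : 0 < discHeight σ) (hh : discHeight σ = discHeight σ')
    (ha : discAngle σ = discAngle σ') : σ = σ' := by
  have h1 := abs_lt_of_discHeight_pos h
  have h2 := abs_lt_of_discHeight_pos (hh ▸ h)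
  have habs : |σ| = |σ'| := by linarith
  by_cases hlt : discHeight σ < 1
  · refine eq_of_octAngle_eq hlt habs ?_
    rw [discAngle, discAngle, ← hh] at ha
    exact ha
  · have h0 : |σ| = 0 := le_antisymm (by linarith) (abs_nonneg _)
    have h0' : |σ'| = 0 := habs ▸ h0
    rw [abs_eq_zero.1 h0, abs_eq_zero.1 h0']

variable {q m : ℕ} {ε : ℤ} {G : ℝ → ℝ}

lemma smul_discPoint_lower (hq : Odd q) (hε : ε = 1 ∨ ε = -1) (hG1 : G 1 = 1) (hσ : |σ| ≤ 1)
    (l : ℝ) : (2 * radius l) • discPoint m G (discCoord ε σ 0) =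
      slopePoint q m ε l (discAngle σ) (0 + 1) := by
  have h : discCoord ε σ 0 =
      Complex.exp ((2 * Real.pi * slopeY q ε (discAngle σ) 1 : ℝ) * Complex.I) := by
    rw [(exp_slopeY hq hε _).1, discCoord, sin_discAngle hσ, add_zero]
  rw [h, smul_discPoint_exp m hG1 _ _ 1, slopePoint]
  norm_num

lemma smul_discPoint_upper (hq : Odd q) (hε : ε = 1 ∨ ε = -1) (hG1 : G 1 = 1) (hσ : |σ| ≤ 1)
    (l : ℝ) : (2 * radius l) • discPoint m G (-discCoord ε σ 0) =
      slopePoint q m ε l (discAngle σ) (1 + 1) := by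
  have h : -discCoord ε σ 0 =
      Complex.exp ((2 * Real.pi * slopeY q ε (discAngle σ) 2 : ℝ) * Complex.I) := by
    rw [(exp_slopeY hq hε _).2, discCoord, sin_discAngle hσ, add_zero]
    apply Complex.ext <;> simp
  rw [h, smul_discPoint_exp m hG1 _ _ 2, slopePoint]
  norm_num

lemma bandPoint_lower (hy : y ≤ 0) : bandPoint q m ε G σ y =
    (2 * radius (octTime |σ| 0)) • discPoint m G (discCoord ε σ y) := if_pos hy

lemma bandPoint_middle (hq : Odd q) (hε : ε = 1 ∨ ε = -1) (hG1 : G 1 = 1) (hσ : |σ| ≤ 1)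
    (hy0 : 0 ≤ y) (hy1 : y ≤ 1) : bandPoint q m ε G σ y =
      slopePoint q m ε (octTime |σ| (octBeta y)) (octAngle σ (octSin |σ| (octBeta y))) (y + 1) := by
  rcases eq_or_lt_of_le hy0 with rfl | hy0
  · rw [bandPoint_lower le_rfl, smul_discPoint_lower hq hε hG1 hσ, octBeta_zero]
    rfl
  · rw [bandPoint, if_neg (not_le.2 hy0), if_pos hy1]

lemma bandPoint_upper (hq : Odd q) (hε : ε = 1 ∨ ε = -1) (hG1 : G 1 = 1) (hσ : |σ| ≤ 1)
    (hy : 1 ≤ y) : bandPoint q m ε G σ y =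
      (2 * radius (octTime |σ| 0)) • discPoint m G (-discCoord ε σ (1 - y)) := by
  rcases eq_or_lt_of_le hy with rfl | hy
  · rw [bandPoint_middle hq hε hG1 hσ zero_le_one le_rfl, sub_self,
      smul_discPoint_upper hq hε hG1 hσ, octBeta_one]
    rfl
  · rw [bandPoint, if_neg (by linarith), if_neg (by linarith)]

/-- The points of the cut open Möbius band that lie strictly inside the disc. -/
lemma norm_discCoord_lt (hε : ε = 1 ∨ ε = -1) (hσ : |σ| ≤ 1) (hy : y < 0)
    (hy' : -discHeight σ ≤ y) : ‖discCoord ε σ y‖ < 1 := by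
  have h1 := sin_discAngle hσ
  have h2 := Real.sin_sq_add_cos_sq (Real.pi * discAngle σ)
  have h3 : ‖discCoord ε σ y‖ ^ 2 < 1 := by
    rw [Complex.sq_norm, Complex.normSq_apply, discCoord]
    simp only
    have h4 := sq_eq_one_of_sign hε
    have h5 : ε * (discHeight σ + y) * (ε * (discHeight σ + y)) = (discHeight σ + y) ^ 2 := by
      linear_combination (discHeight σ + y) ^ 2 * h4
    rw [h5]
    rw [h1] at h2
    nlinarith
  nlinarith [norm_nonneg (discCoord ε σ y)]

lemma two_mul_radius_smul (h : |σ| ≤ 1 / 2) (P : C2) :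
    (2 * radius (octTime |σ| 0)) • P = P := by
  rw [octTime_eq_one h, radius_one]
  norm_num

lemma abs_le_half_of_neg (hy : y < 0) (hy' : -discHeight σ ≤ y) : |σ| ≤ 1 / 2 := by
  have := abs_lt_of_discHeight_pos (σ := σ) (by linarith)
  linarith

lemma octTime_mem (hσ : |σ| ≤ 1) (b : ℝ) : octTime |σ| (octBeta b) ∈ Set.Icc (0 : ℝ) 1 :=
  (oct_spec (octBeta_nonneg b) (abs_nonneg σ) hσ).2.1

lemma octSin_mem (hσ : |σ| ≤ 1) (b : ℝ) : octSin |σ| (octBeta b) ∈ Set.Icc (0 : ℝ) 1 :=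
  (oct_spec (octBeta_nonneg b) (abs_nonneg σ) hσ).1

lemma slopePoint_mem_shell (hε : ε = 1 ∨ ε = -1) (hσ : |σ| ≤ 1) (hy : y ∈ Set.Icc (0 : ℝ) 1) :
    slopePoint q m ε (octTime |σ| (octBeta y)) (octAngle σ (octSin |σ| (octBeta y))) (y + 1) ∈
      bandShell q m ε := by
  refine slopePoint_mem hε (octTime_mem hσ y) ?_
  rw [sin_octAngle _ (octSin_mem hσ y), ← octBeta_eq hy]
  exact (oct_spec (octBeta_nonneg y) (abs_nonneg σ) hσ).2.2

lemma bandPoint_mem (hq : Odd q) (hε : ε = 1 ∨ ε = -1) (hG1 : G 1 = 1) (hσ : |σ| ≤ 1)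
    (hy : -discHeight σ ≤ y) (hy' : y ≤ 1 + discHeight σ) :
    bandPoint q m ε G σ y ∈ cappedShell q m ε G := by
  rcases lt_or_ge y 0 with h0 | h0
  · rw [bandPoint_lower h0.le, two_mul_radius_smul (abs_le_half_of_neg h0 hy)]
    exact Or.inr ⟨_, mem_closedBall_zero_iff.2 (norm_discCoord_lt hε hσ h0 hy).le, rfl⟩
  rcases le_or_gt y 1 with h1 | h1
  · rw [bandPoint_middle hq hε hG1 hσ h0 h1]
    exact Or.inl (slopePoint_mem_shell hε hσ ⟨h0, h1⟩)
  · rw [bandPoint_upper hq hε hG1 hσ h1.le,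
      two_mul_radius_smul (abs_le_half_of_neg (y := 1 - y) (by linarith) (by linarith))]
    refine Or.inr ⟨_, mem_closedBall_zero_iff.2 ?_, rfl⟩
    rw [norm_neg]
    exact (norm_discCoord_lt hε hσ (by linarith) (by linarith)).le

lemma half_of_sin_eq_one {a : ℝ} (ha : a ∈ Set.Icc (0 : ℝ) 1) (h : Real.sin (Real.pi * a) = 1) :
    a = 1 / 2 := by
  rcases le_total a (1 / 2) with h1 | h1
  · have := octAngle_sin ha (σ := 0) (fun _ => h1) (by simp)
    rw [h, octAngle_one] at this
    exact this.symm
  · have := octAngle_sin ha (σ := 1) (by norm_num) (fun _ => h1)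
    rw [h, octAngle_one] at this
    exact this.symm

lemma exists_octAngle {a v : ℝ} (ha : a ∈ Set.Icc (0 : ℝ) 1) (hv : 0 ≤ v)
    (h : v = 0 → Real.sin (Real.pi * a) = 1) :
    ∃ σ, |σ| = v ∧ octAngle σ (Real.sin (Real.pi * a)) = a := by
  rcases eq_or_lt_of_le hv with rfl | hv'
  · exact ⟨0, abs_zero, by rw [h rfl, octAngle_one, half_of_sin_eq_one ha (h rfl)]⟩
  rcases le_total a (1 / 2) with h1 | h1
  · exact ⟨-v, by rw [abs_neg, abs_of_nonneg hv],
      octAngle_sin ha (fun _ => h1) (fun h => absurd h (by linarith))⟩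
  · exact ⟨v, abs_of_nonneg hv, octAngle_sin ha (fun h => absurd h (by linarith)) (fun _ => h1)⟩

/-- The half of the unit disc that is put below. -/
lemma exists_discCoord (hε : ε = 1 ∨ ε = -1) {ζ : ℂ} (hζ : ‖ζ‖ ≤ 1) (him : 0 ≤ ε * ζ.im) :
    ∃ σ y, |σ| ≤ 1 / 2 ∧ y ≤ 0 ∧ -discHeight σ ≤ y ∧ discCoord ε σ y = ζ := by
  have hn : ζ.re ^ 2 + ζ.im ^ 2 ≤ 1 := by
    have := Complex.sq_norm ζ
    rw [Complex.normSq_apply] at this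
    nlinarith [norm_nonneg ζ]
  have hre : -1 ≤ -ζ.re ∧ -ζ.re ≤ 1 := by constructor <;> nlinarith [sq_nonneg ζ.im]
  have hpi := Real.pi_pos
  obtain ⟨a, ha⟩ : ∃ a, a = Real.arccos (-ζ.re) / Real.pi := ⟨_, rfl⟩
  have hpa : Real.pi * a = Real.arccos (-ζ.re) := by rw [ha]; field_simp
  have haI : a ∈ Set.Icc (0 : ℝ) 1 := by
    rw [ha]
    exact ⟨div_nonneg (Real.arccos_nonneg _) hpi.le,
      (div_le_one hpi).2 (Real.arccos_le_pi _)⟩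
  have hcos : Real.cos (Real.pi * a) = -ζ.re := by rw [hpa, Real.cos_arccos hre.1 hre.2]
  obtain ⟨h, hh⟩ : ∃ h, h = Real.sin (Real.pi * a) := ⟨_, rfl⟩
  have hh0 : 0 ≤ h := by
    rw [hh, hpa, Real.sin_arccos]; positivity
  have hh1 : h ≤ 1 := hh ▸ Real.sin_le_one _
  have hsc := Real.sin_sq_add_cos_sq (Real.pi * a)
  rw [hcos, ← hh] at hsc
  obtain ⟨σ, hσ, hoct⟩ := exists_octAngle haI (v := (1 - h) / 2) (by linarith)
    (fun h0 => by rw [← hh]; linarith)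
  have hdh : discHeight σ = h := by
    rw [discHeight_eq, hσ, max_eq_left (by linarith)]; ring
  have hda : discAngle σ = a := by rw [discAngle, hdh, hh, hoct]
  have hsq := sq_eq_one_of_sign hε
  refine ⟨σ, ε * ζ.im - h, by linarith, ?_, by linarith, ?_⟩
  · have : (ε * ζ.im) ^ 2 ≤ h ^ 2 := by nlinarith
    have := abs_le_of_sq_le_sq this hh0
    linarith [(abs_le.1 this).2]
  · rw [discCoord, hdh, hda, hcos]
    apply Complex.ext
    · simp
    · simp only
      linear_combination ζ.im * hsq

lemma exists_bandPoint (hq : Odd q) (hε : ε = 1 ∨ ε = -1) (hG1 : G 1 = 1) {P : C2}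
    (hP : P ∈ cappedShell q m ε G) :
    ∃ σ y, |σ| ≤ 1 ∧ -discHeight σ ≤ y ∧ y ≤ 1 + discHeight σ ∧ bandPoint q m ε G σ y = P := by
  rcases hP with hP | ⟨ζ, hζ, rfl⟩
  · obtain ⟨a, ha, b, hb, l, hl, h, rfl⟩ := exists_slopePoint hq hε hP
    have hs : Real.sin (Real.pi * a) ∈ Set.Icc (0 : ℝ) 1 :=
      ⟨Real.sin_nonneg_of_nonneg_of_le_pi (mul_nonneg Real.pi_pos.le ha.1)
        (mul_le_of_le_one_right Real.pi_pos.le ha.2), Real.sin_le_one _⟩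
    rw [← octBeta_eq hb] at h
    obtain ⟨v, hv, hvs, hvl⟩ := oct_exists (octBeta_nonneg b) hs hl h
    obtain ⟨σ, hσ, hoct⟩ := exists_octAngle ha hv.1 (fun h0 => by
      rw [← hvs, h0, octSin_zero_left (octBeta_nonneg b)])
    have hσ1 : |σ| ≤ 1 := hσ ▸ hv.2
    have hd := (discHeight_mem hσ1).1
    refine ⟨σ, b, hσ1, by linarith [hb.1], by linarith [hb.2], ?_⟩
    rw [bandPoint_middle hq hε hG1 hσ1 hb.1 hb.2, hσ, hvs, hvl, hoct]
  · rw [mem_closedBall_zero_iff] at hζ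
    rcases le_total 0 (ε * ζ.im) with h0 | h0
    · obtain ⟨σ, y, hσ, hy, hy', rfl⟩ := exists_discCoord hε hζ h0
      have hd := (discHeight_mem (σ := σ) (by linarith)).1
      refine ⟨σ, y, by linarith, hy', by linarith, ?_⟩
      rw [bandPoint_lower hy, two_mul_radius_smul hσ]
    · obtain ⟨σ, y, hσ, hy, hy', h⟩ := exists_discCoord hε (ζ := -ζ) (by rwa [norm_neg])
        (by rw [Complex.neg_im]; linarith)
      have hd := (discHeight_mem (σ := σ) (by linarith)).1
      refine ⟨σ, 1 - y, by linarith, by linarith, by linarith, ?_⟩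
      rw [bandPoint_upper hq hε hG1 (by linarith) (by linarith), two_mul_radius_smul hσ,
        sub_sub_cancel, h, neg_neg]

/-- The bottom and the top of the cut open Möbius band. -/
lemma bandPoint_bottom (hq : Odd q) (hε : ε = 1 ∨ ε = -1) (hG1 : G 1 = 1) (hσ : |σ| ≤ 1) :
    bandPoint q m ε G σ (-discHeight σ) = bandPoint q m ε G (-σ) (1 + discHeight σ) := by
  have hd := (discHeight_mem hσ).1
  rw [bandPoint_lower (by linarith), bandPoint_upper hq hε hG1 (by rwa [abs_neg]) (by linarith),
    abs_neg]
  congr 2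
  rw [discCoord, discCoord, discAngle_neg, discHeight_neg]
  apply Complex.ext
  · simp [mul_sub, Real.cos_pi_sub]
  · simp

lemma discCoord_inj (hε : ε = 1 ∨ ε = -1) (hσ : |σ| ≤ 1) (hσ' : |σ'| ≤ 1) (hy : y < 0)
    (hy1 : -discHeight σ ≤ y) (h : discCoord ε σ y = discCoord ε σ' y') : σ = σ' ∧ y = y' := by
  have hre : -Real.cos (Real.pi * discAngle σ) = -Real.cos (Real.pi * discAngle σ') :=
    congrArg Complex.re h
  have him : (ε : ℝ) * (discHeight σ + y) = ε * (discHeight σ' + y') := congrArg Complex.im h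
  have hpi := Real.pi_pos
  have h1 := discAngle_mem hσ
  have h2 := discAngle_mem hσ'
  have ha : discAngle σ = discAngle σ' := by
    have := Real.injOn_cos ⟨by nlinarith [h1.1], by nlinarith [h1.2]⟩
      ⟨by nlinarith [h2.1], by nlinarith [h2.2]⟩ (neg_injective hre)
    exact mul_left_cancel₀ hpi.ne' this
  have hh : discHeight σ = discHeight σ' := by
    rw [← sin_discAngle hσ, ← sin_discAngle hσ', ha]
  have hε0 : (ε : ℝ) ≠ 0 := fun h0 => by
    have := sq_eq_one_of_sign hε
    rw [h0] at this
    norm_num at this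
  have := mul_left_cancel₀ hε0 him
  exact ⟨eq_of_discAngle_eq (by linarith) hh ha, by linarith⟩

lemma discCoord_eq_neg (hε : ε = 1 ∨ ε = -1) (hσ : |σ| ≤ 1) (hσ' : |σ'| ≤ 1) (hy : y < 0)
    (hy1 : -discHeight σ ≤ y) (hy1' : -discHeight σ' ≤ y')
    (h : discCoord ε σ y = -discCoord ε σ' y') :
    σ' = -σ ∧ y = -discHeight σ ∧ y' = -discHeight σ' := by
  have him : (ε : ℝ) * (discHeight σ + y) = -(ε * (discHeight σ' + y')) := congrArg Complex.im h
  have hε0 : (ε : ℝ) ≠ 0 := fun h0 => by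
    have := sq_eq_one_of_sign hε
    rw [h0] at this
    norm_num at this
  rw [← mul_neg] at him
  have := mul_left_cancel₀ hε0 him
  have e1 : y = -discHeight σ := by linarith
  have e2 : y' = -discHeight σ' := by linarith
  refine ⟨?_, e1, e2⟩
  have hneg : discCoord ε σ y = discCoord ε (-σ') (-discHeight (-σ')) := by
    rw [h, e2, discCoord, discCoord, discAngle_neg]
    apply Complex.ext
    · simp [mul_sub, Real.cos_pi_sub]
    · simp
  have := (discCoord_inj hε hσ (by rwa [abs_neg]) hy hy1 hneg).1
  rw [this, neg_neg]

lemma norm_slopePoint_one {l : ℝ} (hl : l ∈ Set.Icc (0 : ℝ) 1) (A B : ℝ) :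
    (1 / 2) / √2 ≤ ‖slopePoint q m ε l A B 1‖ := by
  have := half_le_radius hl
  rw [slopePoint, norm_torusPoint_one, abs_of_nonneg (by linarith)]
  gcongr

lemma discPoint_ne_slopePoint {l : ℝ} (hl : l ∈ Set.Icc (0 : ℝ) 1) (A B : ℝ) {ζ : ℂ}
    (hζ : ‖ζ‖ < 1) : discPoint m G ζ ≠ slopePoint q m ε l A B := by
  intro h
  have h1 := norm_slopePoint_one (q := q) (m := m) (ε := ε) hl A B
  rw [← h, norm_discPoint_one] at h1
  have : (0 : ℝ) < (1 / 2) / √2 := by positivity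
  nlinarith

/-- The points with `0 ≤ y ≤ 1` are identified only in opposite corners. -/
lemma slopePoint_inj (hq : Odd q) (hε : ε = 1 ∨ ε = -1) (hσ : |σ| ≤ 1) (hσ' : |σ'| ≤ 1)
    (hy : y ∈ Set.Icc (0 : ℝ) 1) (hy' : y' ∈ Set.Icc (0 : ℝ) 1)
    (h : slopePoint q m ε (octTime |σ| (octBeta y)) (octAngle σ (octSin |σ| (octBeta y))) (y + 1) =
      slopePoint q m ε (octTime |σ'| (octBeta y')) (octAngle σ' (octSin |σ'| (octBeta y')))
        (y' + 1)) :
    (σ = σ' ∧ y = y') ∨ (σ' = -σ ∧ discHeight σ = 0 ∧ ((y = 0 ∧ y' = 1) ∨ (y = 1 ∧ y' = 0))) := by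
  obtain ⟨hl, i, j, hij, ha, hb⟩ := (slopePoint_eq_iff hq hε (octTime_mem hσ y)
    (octTime_mem hσ' y') _ _ _ _).1 h
  have hs := octSin_mem hσ y
  have hs' := octSin_mem hσ' y'
  have hsin := sin_octAngle σ hs
  have hsin' := sin_octAngle σ' hs'
  have haI := octAngle_mem σ hs.1
  have haI' := octAngle_mem σ' hs'.1
  obtain ⟨a, hadef⟩ : ∃ a, a = octAngle σ (octSin |σ| (octBeta y)) := ⟨_, rfl⟩
  obtain ⟨a', hadef'⟩ : ∃ a', a' = octAngle σ' (octSin |σ'| (octBeta y')) := ⟨_, rfl⟩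
  rw [← hadef] at hsin haI ha
  rw [← hadef'] at hsin' haI' ha
  have hi1 : -1 ≤ i := by
    have : (-1 : ℝ) ≤ i := by linarith [haI.2, haI'.1]
    exact_mod_cast this
  have hi2 : i ≤ 1 := by
    have : (i : ℝ) ≤ 1 := by linarith [haI.1, haI'.2]
    exact_mod_cast this
  have hj1 : -1 ≤ j := by
    have : (-1 : ℝ) ≤ j := by linarith [hy.2, hy'.1]
    exact_mod_cast this
  have hj2 : j ≤ 1 := by
    have : (j : ℝ) ≤ 1 := by linarith [hy.1, hy'.2]
    exact_mod_cast this
  by_cases hi0 : i = 0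
  · have hj0 : j = 0 := by
      obtain ⟨k, hk⟩ := hij
      omega
    left
    rw [hi0, Int.cast_zero, add_zero] at ha
    rw [hj0, Int.cast_zero, add_zero] at hb
    have hyy : y = y' := by linarith
    subst hyy
    have hss : octSin |σ| (octBeta y) = octSin |σ'| (octBeta y) := by rw [← hsin, ← hsin', ha]
    have habs := oct_inj hss hl
    refine ⟨?_, rfl⟩
    rcases eq_or_lt_of_le hs.2 with h1 | h1
    · have h0 := eq_zero_of_octSin_eq_one (octBeta_nonneg y) ⟨abs_nonneg σ, hσ⟩ h1
      have h0' : |σ'| = 0 := habs ▸ h0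
      rw [abs_eq_zero.1 h0, abs_eq_zero.1 h0']
    · refine eq_of_octAngle_eq h1 habs ?_
      rw [← hadef]
      rw [← hss] at hadef'
      rw [← hadef', ha]
  · right
    have hj0 : j ≠ 0 := by
      obtain ⟨k, hk⟩ := hij
      omega
    have hcorner : (a = 0 ∧ a' = 1) ∨ (a = 1 ∧ a' = 0) := by
      have : i = 1 ∨ i = -1 := by omega
      rcases this with rfl | rfl
      · left; push_cast at ha; constructor <;> linarith [haI.1, haI'.2]
      · right; push_cast at ha; constructor <;> linarith [haI.2, haI'.1]
    have hcorner' : (y = 0 ∧ y' = 1) ∨ (y = 1 ∧ y' = 0) := by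
      have : j = 1 ∨ j = -1 := by omega
      rcases this with rfl | rfl
      · left; push_cast at hb; constructor <;> linarith [hy.1, hy'.2]
      · right; push_cast at hb; constructor <;> linarith [hy.2, hy'.1]
    have hβ : octBeta y = 0 ∧ octBeta y' = 0 := by
      rcases hcorner' with ⟨h1, h2⟩ | ⟨h1, h2⟩ <;> rw [h1, h2] <;>
        simp [octBeta_zero, octBeta_one]
    rw [hβ.1] at hsin hadef hl
    rw [hβ.2] at hsin' hadef' hl
    have hs0 : discHeight σ = 0 := by
      rw [discHeight, ← hsin]
      rcases hcorner with ⟨h1, -⟩ | ⟨h1, -⟩ <;> rw [h1] <;> simp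
    have hs0' : discHeight σ' = 0 := by
      rw [discHeight, ← hsin']
      rcases hcorner with ⟨-, h1⟩ | ⟨-, h1⟩ <;> rw [h1] <;> simp
    have habs : |σ| = |σ'| := oct_inj (hs0.trans hs0'.symm) hl
    refine ⟨?_, hs0, hcorner'⟩
    have h1 : a' = 1 - a := by rcases hcorner with ⟨h1, h2⟩ | ⟨h1, h2⟩ <;> rw [h1, h2] <;> norm_num
    have h2 := discAngle_neg σ
    rw [discAngle, discAngle, discHeight_neg, hs0] at h2
    rw [show octSin |σ| 0 = 0 from hs0] at hadef
    rw [show octSin |σ'| 0 = 0 from hs0'] at hadef'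
    refine eq_of_octAngle_eq (s := 0) zero_lt_one (by rw [abs_neg, habs]) ?_
    rw [h2, ← hadef, ← hadef', h1]

/-- The points identified by `bandPoint` are those on the bottom and on the top. -/
lemma bandPoint_inj (hq : Odd q) (hε : ε = 1 ∨ ε = -1) (hG1 : G 1 = 1) (hσ : |σ| ≤ 1)
    (hσ' : |σ'| ≤ 1) (hy0 : -discHeight σ ≤ y) (hy1 : y ≤ 1 + discHeight σ)
    (hy0' : -discHeight σ' ≤ y') (hy1' : y' ≤ 1 + discHeight σ')
    (h : bandPoint q m ε G σ y = bandPoint q m ε G σ' y') :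
    (σ = σ' ∧ y = y') ∨ (σ' = -σ ∧ ((y = -discHeight σ ∧ y' = 1 + discHeight σ') ∨
      (y = 1 + discHeight σ ∧ y' = -discHeight σ'))) := by
  have low : ∀ {σ y : ℝ}, y < 0 → -discHeight σ ≤ y →
      bandPoint q m ε G σ y = discPoint m G (discCoord ε σ y) := fun {σ y} hy hy' => by
    rw [bandPoint_lower hy.le, two_mul_radius_smul (abs_le_half_of_neg hy hy')]
  have up : ∀ {σ y : ℝ}, |σ| ≤ 1 → 1 < y → y ≤ 1 + discHeight σ →
      bandPoint q m ε G σ y = discPoint m G (-discCoord ε σ (1 - y)) := fun {σ y} hσ hy hy' => by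
    rw [bandPoint_upper hq hε hG1 hσ hy.le,
      two_mul_radius_smul (abs_le_half_of_neg (y := 1 - y) (by linarith) (by linarith))]
  have mid : ∀ {σ y : ℝ}, |σ| ≤ 1 → 0 ≤ y → y ≤ 1 → ∃ l ∈ Set.Icc (0 : ℝ) 1, ∃ A B,
      bandPoint q m ε G σ y = slopePoint q m ε l A B := fun {σ y} hσ h0 h1 =>
    ⟨_, octTime_mem hσ y, _, _, bandPoint_middle hq hε hG1 hσ h0 h1⟩
  have lt_low : ∀ {σ y : ℝ}, |σ| ≤ 1 → y < 0 → -discHeight σ ≤ y → ‖discCoord ε σ y‖ < 1 :=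
    fun hσ hy hy' => norm_discCoord_lt hε hσ hy hy'
  have lt_up : ∀ {σ y : ℝ}, |σ| ≤ 1 → 1 < y → y ≤ 1 + discHeight σ →
      ‖-discCoord ε σ (1 - y)‖ < 1 := fun hσ hy hy' => by
    rw [norm_neg]; exact norm_discCoord_lt hε hσ (by linarith) (by linarith)
  rcases lt_or_ge y 0 with h1 | h1
  · rw [low h1 hy0] at h
    rcases lt_or_ge y' 0 with h1' | h1'
    · rw [low h1' hy0'] at h
      exact Or.inl (discCoord_inj hε hσ hσ' h1 hy0 (discPoint_injective m G h))
    rcases le_or_gt y' 1 with h2' | h2'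
    · obtain ⟨l, hl, A, B, hAB⟩ := mid hσ' h1' h2'
      rw [hAB] at h
      exact absurd h (discPoint_ne_slopePoint hl A B (lt_low hσ h1 hy0))
    · rw [up hσ' h2' hy1'] at h
      obtain ⟨e1, e2, e3⟩ := discCoord_eq_neg hε hσ hσ' h1 hy0 (by linarith)
        (discPoint_injective m G h)
      exact Or.inr ⟨e1, Or.inl ⟨e2, by linarith⟩⟩
  rcases le_or_gt y 1 with h2 | h2
  · obtain ⟨l, hl, A, B, hAB⟩ := mid hσ h1 h2
    rcases lt_or_ge y' 0 with h1' | h1'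
    · rw [hAB, low h1' hy0'] at h
      exact absurd h.symm (discPoint_ne_slopePoint hl A B (lt_low hσ' h1' hy0'))
    rcases le_or_gt y' 1 with h2' | h2'
    · rw [bandPoint_middle hq hε hG1 hσ h1 h2, bandPoint_middle hq hε hG1 hσ' h1' h2'] at h
      rcases slopePoint_inj hq hε hσ hσ' ⟨h1, h2⟩ ⟨h1', h2'⟩ h with h | ⟨e1, e2, e3⟩
      · exact Or.inl h
      · refine Or.inr ⟨e1, ?_⟩
        rw [e1, discHeight_neg, e2, neg_zero, add_zero]
        exact e3
    · rw [hAB, up hσ' h2' hy1'] at h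
      exact absurd h.symm (discPoint_ne_slopePoint hl A B (lt_up hσ' h2' hy1'))
  · rw [up hσ h2 hy1] at h
    rcases lt_or_ge y' 0 with h1' | h1'
    · rw [low h1' hy0'] at h
      obtain ⟨e1, e2, e3⟩ := discCoord_eq_neg hε hσ' hσ h1' hy0' (by linarith)
        (discPoint_injective m G h.symm)
      exact Or.inr ⟨by rw [e1, neg_neg], Or.inr ⟨by linarith, e2⟩⟩
    rcases le_or_gt y' 1 with h2' | h2'
    · obtain ⟨l, hl, A, B, hAB⟩ := mid hσ' h1' h2'
      rw [hAB] at h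
      exact absurd h (discPoint_ne_slopePoint hl A B (lt_up hσ h2 hy1))
    · rw [up hσ' h2' hy1'] at h
      obtain ⟨e1, e2⟩ := discCoord_inj hε hσ hσ' (y := 1 - y) (by linarith) (by linarith)
        (neg_injective (discPoint_injective m G h))
      exact Or.inl ⟨e1, by linarith⟩

end BandMap

section BandHomeomorph

open Topology

variable {X : Type*} [TopologicalSpace X]

lemma continuous_octAngle {σ s : X → ℝ} (hσ : Continuous σ) (hs : Continuous s)
    (h : ∀ x, σ x = 0 → s x = 1) : Continuous fun x => octAngle (σ x) (s x) := by
  have hc : Continuous fun x => Real.arcsin (s x) / Real.pi :=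
    (Real.continuous_arcsin.comp hs).div_const _
  refine Continuous.if_le hc (continuous_const.sub hc) hσ continuous_const fun x hx => ?_
  rw [h x hx, Real.arcsin_one]
  field_simp
  norm_num

lemma continuous_discHeight : Continuous discHeight :=
  continuous_octSin.comp (f := fun σ : ℝ => (|σ|, (0 : ℝ))) (by fun_prop)

lemma continuous_discAngle : Continuous discAngle := by
  refine continuous_octAngle continuous_id continuous_discHeight fun σ hσ => ?_
  rw [show σ = 0 from hσ, discHeight_eq]
  simp

lemma continuous_discCoord (ε : ℤ) : Continuous fun z : ℝ × ℝ => discCoord ε z.1 z.2 := by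
  have h1 := continuous_discAngle
  have h2 := continuous_discHeight
  have : (fun z : ℝ × ℝ => discCoord ε z.1 z.2) = fun z : ℝ × ℝ =>
      ((-Real.cos (Real.pi * discAngle z.1) : ℝ) : ℂ) +
        ((ε * (discHeight z.1 + z.2) : ℝ) : ℂ) * Complex.I := by
    ext z
    apply Complex.ext
    · simp only [discCoord, Complex.add_re, Complex.ofReal_re, Complex.re_ofReal_mul, Complex.I_re,
        mul_zero, add_zero]
    · simp only [discCoord, Complex.add_im, Complex.ofReal_im, Complex.im_ofReal_mul, Complex.I_im,
        mul_one, zero_add]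
  rw [this]
  fun_prop

variable {q m : ℕ} {ε : ℤ} {G : ℝ → ℝ}

lemma continuous_slopePoint {l A B : X → ℝ} (hl : Continuous l) (hA : Continuous A)
    (hB : Continuous B) : Continuous fun x => slopePoint q m ε (l x) (A x) (B x) := by
  have hrad := continuous_radius
  have hY : Continuous fun x => slopeY q ε (A x) (B x) := by unfold slopeY; fun_prop
  exact continuous_torusPoint.comp (f := fun x => (radius (l x),
    (B x + m * slopeY q ε (A x) (B x)), slopeY q ε (A x) (B x))) (by fun_prop)

lemma continuous_bandPoint (hq : Odd q) (hε : ε = 1 ∨ ε = -1) (hG : Continuous G) (hG1 : G 1 = 1)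
    (hG0 : m ≠ 0 → G 0 = 0) {σ y : X → ℝ} (hσ : Continuous σ) (hy : Continuous y)
    (hσ1 : ∀ x, |σ x| ≤ 1) : Continuous fun x => bandPoint q m ε G (σ x) (y x) := by
  have hdisc := continuous_discPoint (m := m) hG hG0
  have hrad := continuous_radius
  have hcoord := continuous_discCoord ε
  have hbeta : Continuous fun x => octBeta (y x) := by unfold octBeta; fun_prop
  have htime : Continuous fun x => octTime |σ x| (octBeta (y x)) :=
    continuous_octTime.comp (f := fun x => (|σ x|, octBeta (y x))) (by fun_prop)
  have hsin : Continuous fun x => octSin |σ x| (octBeta (y x)) :=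
    continuous_octSin.comp (f := fun x => (|σ x|, octBeta (y x))) (by fun_prop)
  have hang := continuous_octAngle hσ hsin fun x hx => by
    rw [hx, abs_zero, octSin_zero_left (octBeta_nonneg _)]
  have hslope : Continuous fun x => slopePoint q m ε (octTime |σ x| (octBeta (y x)))
      (octAngle (σ x) (octSin |σ x| (octBeta (y x)))) (y x + 1) :=
    continuous_slopePoint htime hang (hy.add continuous_const)
  have hr : Continuous fun x => 2 * radius (octTime |σ x| 0) := by
    have : Continuous fun x => octTime |σ x| 0 :=
      continuous_octTime.comp (f := fun x => (|σ x|, (0 : ℝ))) (by fun_prop)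
    fun_prop
  have hd1 : Continuous fun x => discPoint m G (discCoord ε (σ x) (y x)) :=
    hdisc.comp (hcoord.comp (f := fun x => (σ x, y x)) (by fun_prop))
  have hd2 : Continuous fun x => discPoint m G (-discCoord ε (σ x) (1 - y x)) :=
    hdisc.comp (hcoord.comp (f := fun x => (σ x, 1 - y x)) (by fun_prop)).neg
  have hlow := hr.smul hd1
  have hup := hr.smul hd2
  refine Continuous.if_le hlow (Continuous.if_le hslope hup hy continuous_const ?_) hy
    continuous_const ?_
  · intro x hx
    have e1 := bandPoint_middle (m := m) hq hε hG1 (hσ1 x) (y := y x) (by linarith) hx.le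
    have e2 := bandPoint_upper (m := m) hq hε hG1 (hσ1 x) (y := y x) hx.ge
    exact e1.symm.trans e2
  · intro x hx
    have e1 := bandPoint_lower (q := q) (m := m) (ε := ε) (G := G) (σ := σ x) hx.le
    have e2 := bandPoint_middle (m := m) hq hε hG1 (hσ1 x) (y := y x) hx.ge (by linarith)
    rw [← e1, e2, if_pos (by linarith)]

/-- One pinch move followed by a disc gives a Möbius band. -/
theorem isMobiusBand_cappedShell (hq : Odd q) (hε : ε = 1 ∨ ε = -1) (hG : Continuous G)
    (hG1 : G 1 = 1) (hG0 : m ≠ 0 → G 0 = 0) : IsMobiusBand (cappedShell q m ε G) := by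
  let s : unitInterval × unitInterval → ℝ := fun a => 2 * a.2 - 1
  let y : unitInterval × unitInterval → ℝ := fun a =>
    -discHeight (s a) + a.1 * (1 + 2 * discHeight (s a))
  have hs : ∀ a, |s a| ≤ 1 := fun a => by
    rw [abs_le]
    constructor <;> simp only [s] <;> linarith [a.2.2.1, a.2.2.2]
  have hd : ∀ a, 0 ≤ discHeight (s a) := fun a => (discHeight_mem (hs a)).1
  have hy0 : ∀ a, -discHeight (s a) ≤ y a := fun a => by
    have : 0 ≤ (a.1 : ℝ) * (1 + 2 * discHeight (s a)) := mul_nonneg a.1.2.1 (by linarith [hd a])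
    simp only [y]; linarith
  have hy1 : ∀ a, y a ≤ 1 + discHeight (s a) := fun a => by
    have : (a.1 : ℝ) * (1 + 2 * discHeight (s a)) ≤ 1 + 2 * discHeight (s a) :=
      mul_le_of_le_one_left (by linarith [hd a]) a.1.2.2
    simp only [y]; linarith
  let f : unitInterval × unitInterval → cappedShell q m ε G := fun a =>
    ⟨bandPoint q m ε G (s a) (y a), bandPoint_mem hq hε hG1 (hs a) (hy0 a) (hy1 a)⟩
  have hf : Continuous f := by
    refine Continuous.subtype_mk (continuous_bandPoint hq hε hG hG1 hG0 (by fun_prop) ?_ hs) _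
    have := continuous_discHeight
    fun_prop
  have hrel : ∀ a b : unitInterval × unitInterval,
      (a.1 = 0 ∧ b.1 = 1 ∧ b.2 = unitInterval.symm a.2) → f a = f b := by
    rintro ⟨a1, a2⟩ ⟨b1, b2⟩ ⟨h1, h2, h3⟩
    simp only at h1 h2 h3
    subst h1 h2 h3
    have hsb : s ((1 : unitInterval), unitInterval.symm a2) = -s ((0 : unitInterval), a2) := by
      simp only [s, unitInterval.coe_symm_eq]; ring
    apply Subtype.ext
    change bandPoint q m ε G (s _) (y _) = bandPoint q m ε G (s _) (y _)
    have e1 : y ((0 : unitInterval), a2) = -discHeight (s ((0 : unitInterval), a2)) := by simp [y]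
    have e2 : y ((1 : unitInterval), unitInterval.symm a2) =
        1 + discHeight (s ((0 : unitInterval), a2)) := by
      simp only [y, hsb, discHeight_neg, Set.Icc.coe_one]; ring
    rw [e1, e2, hsb]
    exact bandPoint_bottom hq hε hG1 (hs _)
  let F : MobiusBand → cappedShell q m ε G := Quot.lift f hrel
  have hF : Continuous F := continuous_coinduced_dom.2 hf
  have hinj : Function.Injective F := by
    rintro ⟨a⟩ ⟨b⟩ h
    have h' : bandPoint q m ε G (s a) (y a) = bandPoint q m ε G (s b) (y b) :=
      congrArg Subtype.val h
    have hseq : ∀ {a b : unitInterval × unitInterval}, s a = s b → a.2 = b.2 := by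
      intro a b h
      simp only [s] at h
      exact Subtype.ext (by linarith)
    have hsneg : ∀ {a b : unitInterval × unitInterval}, s b = -s a →
        b.2 = unitInterval.symm a.2 := by
      intro a b h
      simp only [s] at h
      refine Subtype.ext ?_
      rw [unitInterval.coe_symm_eq]
      linarith
    have hbot : ∀ {a : unitInterval × unitInterval}, y a = -discHeight (s a) → a.1 = 0 := by
      intro a h
      simp only [y] at h
      have : (a.1 : ℝ) * (1 + 2 * discHeight (s a)) = 0 := by linarith
      exact Subtype.ext ((mul_eq_zero.1 this).resolve_right (by linarith [hd a]))
    have htop : ∀ {a : unitInterval × unitInterval}, y a = 1 + discHeight (s a) → a.1 = 1 := by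
      intro a h
      simp only [y] at h
      have : ((a.1 : ℝ) - 1) * (1 + 2 * discHeight (s a)) = 0 := by linarith
      have := (mul_eq_zero.1 this).resolve_right (by linarith [hd a])
      exact Subtype.ext (by simp only [Set.Icc.coe_one]; linarith)
    rcases bandPoint_inj hq hε hG1 (hs a) (hs b) (hy0 a) (hy1 a) (hy0 b) (hy1 b) h' with
      ⟨h1, h2⟩ | ⟨h1, ⟨h2, h3⟩ | ⟨h2, h3⟩⟩
    · have e2 := hseq h1
      have e1 : a.1 = b.1 := by
        simp only [y, ← h1] at h2
        have : ((a.1 : ℝ) - b.1) * (1 + 2 * discHeight (s a)) = 0 := by linarith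
        have := (mul_eq_zero.1 this).resolve_right (by linarith [hd a])
        exact Subtype.ext (by linarith)
      rw [Prod.ext e1 e2]
    · exact Quot.sound ⟨hbot h2, htop h3, hsneg h1⟩
    · exact (Quot.sound ⟨hbot h3, htop h2, hsneg (by rw [h1, neg_neg])⟩).symm
  have hsurj : Function.Surjective F := by
    rintro ⟨P, hP⟩
    obtain ⟨σ, z, hσ, hz0, hz1, rfl⟩ := exists_bandPoint hq hε hG1 hP
    have hdσ := (discHeight_mem hσ).1
    have hD : 0 < 1 + 2 * discHeight σ := by linarith
    rw [abs_le] at hσ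
    have key : ∀ a, s a = σ → (a.1 : ℝ) * (1 + 2 * discHeight σ) = z + discHeight σ →
        F (Quot.mk _ a) = ⟨bandPoint q m ε G σ z, hP⟩ := by
      intro a h1 h2
      apply Subtype.ext
      change bandPoint q m ε G (s a) (-discHeight (s a) + a.1 * (1 + 2 * discHeight (s a))) = _
      rw [h1, h2, neg_add_eq_sub, add_sub_cancel_right]
    obtain ⟨t, ht⟩ : ∃ t : unitInterval, (t : ℝ) = (z + discHeight σ) / (1 + 2 * discHeight σ) :=
      ⟨⟨_, div_nonneg (by linarith) hD.le, by rw [div_le_one hD]; linarith⟩, rfl⟩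
    obtain ⟨v, hv⟩ : ∃ v : unitInterval, (v : ℝ) = (σ + 1) / 2 :=
      ⟨⟨_, by linarith, by linarith⟩, rfl⟩
    refine ⟨Quot.mk _ (t, v), key (t, v) ?_ ?_⟩
    · simp only [s, hv]; ring
    · rw [ht, div_mul_cancel₀ _ hD.ne']
  exact ⟨(hF.homeoOfEquivCompactToT2 (f := Equiv.ofBijective F ⟨hinj, hsurj⟩)).symm⟩

/-- The disc `unknotDisk` in terms of `discPoint`. -/
lemma unknotDisk_eq (m : ℕ) : unknotDisk m = discPoint m (fun r =>
    (1 - Real.smoothTransition r) * r ^ m + Real.smoothTransition r * r) ''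
      Metric.closedBall 0 1 := by
  have key : ∀ r y : ℝ, 0 ≤ r → discPoint m (fun r =>
      (1 - Real.smoothTransition r) * r ^ m + Real.smoothTransition r * r)
        (r * Complex.exp ((2 * Real.pi * y : ℝ) * Complex.I)) =
      !₂[(((1 / 2) / √2 * ((1 - Real.smoothTransition r) * r ^ m + Real.smoothTransition r * r)
              : ℝ) : ℂ) * Complex.exp ((2 * Real.pi * (m * y) : ℝ) * Complex.I),
           (((1 / 2) / √2 * r : ℝ) : ℂ) * Complex.exp ((2 * Real.pi * y : ℝ) * Complex.I)] := by
    intro r y hr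
    have hn : ‖(r : ℂ) * Complex.exp ((2 * Real.pi * y : ℝ) * Complex.I)‖ = r := by
      rw [norm_mul, Complex.norm_exp_ofReal_mul_I, mul_one, Complex.norm_real,
        Real.norm_of_nonneg hr]
    have hexp : Complex.exp ((2 * Real.pi * (m * y) : ℝ) * Complex.I) =
        Complex.exp ((2 * Real.pi * y : ℝ) * Complex.I) ^ m := by
      rw [← Complex.exp_nat_mul]
      congr 1
      push_cast
      ring
    unfold discPoint
    rw [hn]
    ext i
    fin_cases i
    · simp only [Fin.zero_eta, Matrix.cons_val_zero]
      rcases eq_or_lt_of_le hr with rfl | hr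
      · rcases Nat.eq_zero_or_pos m with rfl | hm
        · simp
        · simp [hm.ne']
      · have : (r : ℂ) ≠ 0 := by exact_mod_cast hr.ne'
        rw [hexp, mul_div_cancel_left₀ _ this]
    · simp only [Fin.mk_one, Matrix.cons_val_one]
      push_cast
      ring
  ext P
  constructor
  · rintro ⟨r, y, hr, rfl⟩
    refine ⟨_, ?_, key r y hr.1⟩
    rw [mem_closedBall_zero_iff, norm_mul, Complex.norm_exp_ofReal_mul_I, mul_one,
      Complex.norm_real, Real.norm_of_nonneg hr.1]
    exact hr.2
  · rintro ⟨ζ, hζ, rfl⟩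
    rw [mem_closedBall_zero_iff] at hζ
    refine ⟨‖ζ‖, ζ.arg / (2 * Real.pi), ⟨norm_nonneg _, hζ⟩, ?_⟩
    rw [← key _ _ (norm_nonneg _), mul_div_cancel₀ _ Real.two_pi_pos.ne',
      Complex.norm_mul_exp_arg_mul_I]

/-- A single pinch move gives a Möbius band. -/
theorem isMobiusBand_pinchSurface {p q : ℕ} (hodd : Odd q) (hc : p.Coprime q)
    (hn : pinchNumber p q = 1) : IsMobiusBand (pinchSurface p q) := by
  obtain ⟨ε, hε, hp⟩ := exists_eq_of_pinchNumber_eq_one hodd hc hn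
  have h1 := pinchIter_pinchNumber hodd hc
  rw [hn] at h1
  obtain ⟨m, hm⟩ : ∃ m, m = (pinchIter p q 1).1 := ⟨_, rfl⟩
  rw [← hm] at hp
  have hp' : (p : ℝ) = q * m + 2 * ε := by exact_mod_cast hp
  have hS : pinchSurface p q = cappedShell q m ε (fun r =>
      (1 - Real.smoothTransition r) * r ^ m + Real.smoothTransition r * r) := by
    rw [pinchSurface, cappedShell, hn, ← unknotDisk_eq, ← hm]
    congr 1
    ext P
    simp only [Set.mem_iUnion, Set.mem_Iio, Nat.lt_one_iff, exists_prop, exists_eq_left]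
    refine exists_congr fun u => exists_congr fun x => exists_congr fun y => ?_
    rw [zero_add, show pinchIter p q 0 = (p, q) from rfl,
      show pinchIter p q 1 = (m, 1) from Prod.ext hm.symm h1]
    have e1 : pinchMovie (p, q) (m, 1) (Real.smoothTransition u) x y =
        bandMovie q m ε (Real.smoothTransition u) x y := by
      simp only [pinchMovie, bandMovie, hp', Nat.cast_one, one_mul]
    have e2 : (1 - u) * (1 - ((0 : ℕ) : ℝ) / (2 * ((1 : ℕ) : ℝ))) +
        u * (1 - (((0 : ℕ) : ℝ) + 1) / (2 * ((1 : ℕ) : ℝ))) = 1 - u / 2 := by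
      push_cast; ring
    rw [e1, e2]
  rw [hS]
  have := Real.smoothTransition.continuous
  refine isMobiusBand_cappedShell hodd hε (by fun_prop) (by simp) fun hm0 => ?_
  simp [hm0]

end BandHomeomorph

/-! ### Slice charts from defining functions -/

section SliceChart

open Topology

lemma finrank_dual_C2 : Module.finrank ℝ (C2 →L[ℝ] ℝ) = 4 := by
  have h1 : Module.finrank ℝ C2 = 4 := by
    rw [finrank_real_of_complex]
    simp [C2]
  have h2 : Module.finrank ℝ (C2 →ₗ[ℝ] ℝ) = 4 := by
    rw [Module.finrank_linearMap_self, h1]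
  rw [← h2]
  exact (LinearMap.toContinuousLinearMap (𝕜 := ℝ) (E := C2) (F' := ℝ)).finrank_eq.symm

/-- Independent functionals are linear coordinates. -/
lemma exists_equiv_of_linearIndependent {L : Fin 4 → C2 →L[ℝ] ℝ} (h : LinearIndependent ℝ L) :
    ∃ e : C2 ≃L[ℝ] (Fin 4 → ℝ), (e : C2 →L[ℝ] (Fin 4 → ℝ)) = ContinuousLinearMap.pi L := by
  have hspan : Submodule.span ℝ (Set.range L) = ⊤ :=
    h.span_eq_top_of_card_eq_finrank (by rw [finrank_dual_C2, Fintype.card_fin])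
  have hinj : Function.Injective (ContinuousLinearMap.pi L : C2 →ₗ[ℝ] (Fin 4 → ℝ)) := by
    rw [← LinearMap.ker_eq_bot, LinearMap.ker_eq_bot']
    intro v hv
    have hv' : ∀ i, L i v = 0 := fun i => congrFun hv i
    refine SeparatingDual.eq_zero_of_forall_dual_eq_zero (R := ℝ) fun ℓ => ?_
    have hℓ : ℓ ∈ Submodule.span ℝ (Set.range L) := hspan ▸ Submodule.mem_top
    induction hℓ using Submodule.span_induction with
    | mem x hx => obtain ⟨i, rfl⟩ := hx; exact hv' i
    | zero => rfl
    | add x y _ _ hx hy => simp [hx, hy]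
    | smul a x _ hx => simp [hx]
  have hrank : Module.finrank ℝ C2 = Module.finrank ℝ (Fin 4 → ℝ) := by
    rw [finrank_real_of_complex]
    simp [C2]
  let e := LinearEquiv.ofInjectiveOfFinrankEq
    (ContinuousLinearMap.pi L : C2 →ₗ[ℝ] (Fin 4 → ℝ)) hinj hrank
  refine ⟨e.toContinuousLinearEquiv, ?_⟩
  ext v i
  rfl

/-- The inverse function theorem, for an open set on which the map and its inverse are smooth. -/
lemma exists_smooth_openPartialHomeomorph {F : C2 → Fin 4 → ℝ} {U : Set C2} (hU : IsOpen U) {P : C2}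
    (hP : P ∈ U) (hF : ContDiffOn ℝ ∞ F U) (e : C2 ≃L[ℝ] (Fin 4 → ℝ))
    (he : HasFDerivAt F (e : C2 →L[ℝ] (Fin 4 → ℝ)) P) :
    ∃ φ : OpenPartialHomeomorph C2 (Fin 4 → ℝ), P ∈ φ.source ∧ φ.source ⊆ U ∧ (∀ x, φ x = F x) ∧
      ContDiffOn ℝ ∞ φ φ.source ∧ ContDiffOn ℝ ∞ φ.symm φ.target := by
  have hFat : ∀ x ∈ U, ContDiffAt ℝ ∞ F x := fun x hx => hF.contDiffAt (hU.mem_nhds hx)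
  let φ₀ := (hFat P hP).toOpenPartialHomeomorph F he (by simp)
  have hdc : ContinuousOn (fderiv ℝ F) U := hF.continuousOn_fderiv_of_isOpen hU (by simp)
  have hopen := ContinuousLinearEquiv.isOpen (𝕜 := ℝ) (E := C2) (F := Fin 4 → ℝ)
  have hV := hdc.isOpen_inter_preimage hU hopen
  set V := U ∩ fderiv ℝ F ⁻¹' Set.range ((↑) : (C2 ≃L[ℝ] (Fin 4 → ℝ)) → C2 →L[ℝ] (Fin 4 → ℝ))
  have hPV : P ∈ V := ⟨hP, e, he.fderiv.symm⟩
  have hPφ : P ∈ φ₀.source := (hFat P hP).mem_toOpenPartialHomeomorph_source he (by simp)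
  refine ⟨φ₀.restrOpen V hV, ⟨hPφ, hPV⟩, fun x hx => hx.2.1, fun x => rfl,
    hF.mono fun x hx => hx.2.1, ?_⟩
  intro y hy
  refine ContDiffAt.contDiffWithinAt ?_
  have hx := (φ₀.restrOpen V hV).map_target hy
  obtain ⟨hxU, e', he'⟩ := hx.2
  refine (φ₀.restrOpen V hV).contDiffAt_symm (f₀' := e') hy ?_ (hFat _ hxU)
  rw [he']
  exact ((hFat _ hxU).differentiableAt (by simp)).hasFDerivAt

variable {S U : Set C2} {f g : C2 → ℝ} {P : C2}

lemma exists_isSliceChart_of_functions {F : Fin 4 → C2 → ℝ} (hU : IsOpen U) (hP : P ∈ U)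
    (hF : ∀ i, ContDiffOn ℝ ∞ (F i) U) (hind : LinearIndependent ℝ fun i => fderiv ℝ (F i) P)
    (hball : ∀ x ∈ U, x ∈ B4 ↔ 0 ≤ F 0 x)
    (hmem : ∀ x ∈ U, x ∈ S ↔ x ∈ B4 ∧ F 2 x = 0 ∧ F 3 x = 0) :
    ∃ φ, IsSliceChart S φ ∧ P ∈ φ.source := by
  obtain ⟨e, he⟩ := exists_equiv_of_linearIndependent hind
  have hd : HasFDerivAt (fun x i => F i x) (e : C2 →L[ℝ] (Fin 4 → ℝ)) P := by
    rw [he, hasFDerivAt_pi]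
    exact fun i => (((hF i).contDiffAt (hU.mem_nhds hP)).differentiableAt (by simp)).hasFDerivAt
  obtain ⟨φ, h1, h2, h3, h4, h5⟩ :=
    exists_smooth_openPartialHomeomorph hU hP (contDiffOn_pi.2 hF) e hd
  refine ⟨φ, ⟨h4, h5, fun x hx => ?_, fun x hx => ?_⟩, h1⟩
  · rw [h3]; exact hball x (h2 hx)
  · rw [h3, hmem x (h2 hx), hball x (h2 hx)]

lemma exists_linearIndependent_vecCons {n : ℕ} {L : Fin n → C2 →L[ℝ] ℝ}
    (h : LinearIndependent ℝ L) (hn : n < 4) :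
    ∃ ℓ, LinearIndependent ℝ (Matrix.vecCons ℓ L) :=
  exists_linearIndependent_cons_of_lt_finrank h (by rwa [finrank_dual_C2])

lemma exists_isSliceChart_interior (hU : IsOpen U) (hP : P ∈ U) (hn : ‖P‖ < 1)
    (hf : ContDiffOn ℝ ∞ f U) (hg : ContDiffOn ℝ ∞ g U)
    (hmem : ∀ x ∈ U, x ∈ S ↔ x ∈ B4 ∧ f x = 0 ∧ g x = 0)
    (hind : LinearIndependent ℝ ![fderiv ℝ f P, fderiv ℝ g P]) :
    ∃ φ, IsSliceChart S φ ∧ P ∈ φ.source := by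
  obtain ⟨ℓ₁, h1⟩ := exists_linearIndependent_vecCons hind (by norm_num)
  obtain ⟨ℓ₀, h0⟩ := exists_linearIndependent_vecCons h1 (by norm_num)
  let F0 : C2 → ℝ := fun x => ℓ₀ x + (1 - ℓ₀ P)
  have hF0 : ContDiff ℝ ∞ F0 := ℓ₀.contDiff.add contDiff_const
  let V := U ∩ (Metric.ball 0 1 ∩ {x | 0 < F0 x})
  have hV : IsOpen V :=
    hU.inter (Metric.isOpen_ball.inter (isOpen_lt continuous_const hF0.continuous))
  refine exists_isSliceChart_of_functions (U := V) (F := ![F0, ℓ₁, f, g]) hV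
    ⟨hP, by simpa using hn, by simp [F0]⟩ ?_ ?_ ?_ ?_
  · intro i
    fin_cases i
    · exact hF0.contDiffOn
    · exact ℓ₁.contDiff.contDiffOn
    · exact hf.mono Set.inter_subset_left
    · exact hg.mono Set.inter_subset_left
  · convert h0 using 1
    ext1 i
    fin_cases i
    · change fderiv ℝ (fun x => ℓ₀ x + (1 - ℓ₀ P)) P = ℓ₀
      rw [fderiv_add_const]
      exact ℓ₀.fderiv
    · exact ℓ₁.fderiv
    · rfl
    · rfl
  · intro x hx
    have hb : x ∈ B4 := Metric.ball_subset_closedBall hx.2.1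
    have h0 : 0 < F0 x := hx.2.2
    exact ⟨fun _ => h0.le, fun _ => hb⟩
  · intro x hx
    exact hmem x hx.1

lemma exists_isSliceChart_boundary (hU : IsOpen U) (hP : P ∈ U)
    (hf : ContDiffOn ℝ ∞ f U) (hg : ContDiffOn ℝ ∞ g U)
    (hmem : ∀ x ∈ U, x ∈ S ↔ x ∈ B4 ∧ f x = 0 ∧ g x = 0)
    (hind : LinearIndependent ℝ ![fderiv ℝ (fun x : C2 => 1 - ‖x‖ ^ 2) P,
      fderiv ℝ f P, fderiv ℝ g P]) :
    ∃ φ, IsSliceChart S φ ∧ P ∈ φ.source := by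
  obtain ⟨ℓ, h1⟩ := exists_linearIndependent_vecCons hind (by norm_num)
  refine exists_isSliceChart_of_functions (F := ![fun x : C2 => 1 - ‖x‖ ^ 2, ℓ, f, g]) hU hP
    ?_ ?_ ?_ hmem
  · intro i
    fin_cases i
    · exact (contDiff_const.sub (contDiff_norm_sq ℝ)).contDiffOn
    · exact ℓ.contDiff.contDiffOn
    · exact hf
    · exact hg
  · convert h1.comp (Equiv.swap (0 : Fin 4) 1) (Equiv.injective _) using 1
    ext1 i
    fin_cases i
    · rfl
    · exact ℓ.fderiv
    · rfl
    · rfl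
  · intro x _
    change x ∈ B4 ↔ 0 ≤ 1 - ‖x‖ ^ 2
    rw [B4, mem_closedBall_zero_iff]
    constructor
    · intro h; nlinarith [norm_nonneg x]
    · intro h; nlinarith [norm_nonneg x]

end SliceChart

/-! ### A smooth Möbius band with boundary `T(qm ± 2, q)` -/

section SmoothBand

open Topology

/-- A profile for the disc that is `r ^ m` for `r ≤ 1/2`, so that the disc is a graph there, and `r`
for `r ≥ 3/4`. -/
noncomputable def smoothProfile (m : ℕ) (r : ℝ) : ℝ :=
  (1 - Real.smoothTransition (4 * r - 2)) * r ^ m + Real.smoothTransition (4 * r - 2) * r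

/-- The surface of one pinch move from `T(qm + 2ε, q)` to the unknot `T(m, 1)`, with a disc that is
smooth at its centre. -/
noncomputable def smoothBand (q m : ℕ) (ε : ℤ) : Set C2 := cappedShell q m ε (smoothProfile m)

lemma contDiff_smoothProfile (m : ℕ) : ContDiff ℝ ∞ (smoothProfile m) := by
  have h : ContDiff ℝ ∞ fun r : ℝ => Real.smoothTransition (4 * r - 2) :=
    Real.smoothTransition.contDiff.comp (by fun_prop)
  unfold smoothProfile
  fun_prop

lemma smoothProfile_of_le {m : ℕ} {r : ℝ} (h : r ≤ 1 / 2) : smoothProfile m r = r ^ m := by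
  rw [smoothProfile, Real.smoothTransition.zero_of_nonpos (by linarith)]
  ring

lemma smoothProfile_of_ge {m : ℕ} {r : ℝ} (h : 3 / 4 ≤ r) : smoothProfile m r = r := by
  rw [smoothProfile, Real.smoothTransition.one_of_one_le (by linarith)]
  ring

lemma smoothProfile_pos {m : ℕ} {r : ℝ} (h : 0 < r) : 0 < smoothProfile m r := by
  have h0 := Real.smoothTransition.nonneg (4 * r - 2)
  have h1 := Real.smoothTransition.le_one (4 * r - 2)
  have h2 : 0 < r ^ m := by positivity
  unfold smoothProfile
  rcases eq_or_lt_of_le h0 with h3 | h3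
  · rw [← h3]; simpa using h2
  · have := mul_pos h3 h
    have := mul_nonneg (sub_nonneg.2 h1) h2.le
    linarith

lemma smoothProfile_le_one {m : ℕ} {r : ℝ} (h0 : 0 ≤ r) (h1 : r ≤ 1) : smoothProfile m r ≤ 1 := by
  have h2 := Real.smoothTransition.nonneg (4 * r - 2)
  have h3 := Real.smoothTransition.le_one (4 * r - 2)
  have h4 : r ^ m ≤ 1 := pow_le_one₀ h0 h1
  unfold smoothProfile
  nlinarith

/-- The point with polar coordinates `(α/√2, 2πx)` and `(β/√2, 2πy)`. -/
noncomputable def polarPoint (α x β y : ℝ) : C2 :=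
  !₂[((α / √2 : ℝ) : ℂ) * Complex.exp ((2 * Real.pi * x : ℝ) * Complex.I),
     ((β / √2 : ℝ) : ℂ) * Complex.exp ((2 * Real.pi * y : ℝ) * Complex.I)]

lemma torusPoint_eq_polarPoint (ρ x y : ℝ) : torusPoint ρ x y = polarPoint ρ x ρ y := rfl

lemma polarPoint_zero (α x β y : ℝ) : polarPoint α x β y 0 =
    ((α / √2 : ℝ) : ℂ) * Complex.exp ((2 * Real.pi * x : ℝ) * Complex.I) := rfl

lemma polarPoint_one (α x β y : ℝ) : polarPoint α x β y 1 =
    ((β / √2 : ℝ) : ℂ) * Complex.exp ((2 * Real.pi * y : ℝ) * Complex.I) := rfl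

lemma norm_polarPoint_zero (α x β y : ℝ) : ‖polarPoint α x β y 0‖ = |α| / √2 :=
  norm_torusPoint_zero α x y

lemma norm_polarPoint_one (α x β y : ℝ) : ‖polarPoint α x β y 1‖ = |β| / √2 :=
  norm_torusPoint_one β x y

lemma norm_polarPoint_sq (α x β y : ℝ) : ‖polarPoint α x β y‖ ^ 2 = (α ^ 2 + β ^ 2) / 2 := by
  rw [C2.norm_sq, norm_polarPoint_zero, norm_polarPoint_one, div_pow, div_pow,
    Real.sq_sqrt (by norm_num), sq_abs, sq_abs]
  ring

lemma mul_exp_eq_iff {a b : ℝ} (ha : 0 < a) (hb : 0 < b) (x y : ℝ) :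
    ((a / √2 : ℝ) : ℂ) * Complex.exp ((2 * Real.pi * x : ℝ) * Complex.I) =
      ((b / √2 : ℝ) : ℂ) * Complex.exp ((2 * Real.pi * y : ℝ) * Complex.I) ↔
    a = b ∧ ∃ i : ℤ, y = x + i := by
  have h2 : (0 : ℝ) < √2 := by positivity
  constructor
  · intro h
    have hn := congrArg norm h
    rw [norm_mul, norm_mul, Complex.norm_exp_ofReal_mul_I, Complex.norm_exp_ofReal_mul_I,
      Complex.norm_real, Complex.norm_real, Real.norm_of_nonneg (by positivity),
      Real.norm_of_nonneg (by positivity), mul_one, mul_one] at hn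
    have hab : a = b := by field_simp at hn; exact hn
    subst hab
    have hc : ((a / √2 : ℝ) : ℂ) ≠ 0 := by
      rw [Complex.ofReal_ne_zero]
      positivity
    exact ⟨rfl, (exp_two_pi_eq_iff _ _).1 (mul_left_cancel₀ hc h)⟩
  · rintro ⟨rfl, h⟩
    rw [(exp_two_pi_eq_iff _ _).2 h]

lemma polarPoint_eq_iff {α β α' β' : ℝ} (hα : 0 < α) (hβ : 0 < β) (hα' : 0 < α') (hβ' : 0 < β')
    (x y x' y' : ℝ) : polarPoint α x β y = polarPoint α' x' β' y' ↔
      (α = α' ∧ ∃ i : ℤ, x' = x + i) ∧ β = β' ∧ ∃ j : ℤ, y' = y + j := by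
  rw [← mul_exp_eq_iff hα hα', ← mul_exp_eq_iff hβ hβ']
  constructor
  · exact fun h => ⟨congrArg (fun P : C2 => P 0) h, congrArg (fun P : C2 => P 1) h⟩
  · rintro ⟨h0, h1⟩
    rw [polarPoint, polarPoint, h0, h1]

lemma exists_polarPoint {P : C2} (h0 : P 0 ≠ 0) (h1 : P 1 ≠ 0) :
    ∃ α x β y, 0 < α ∧ 0 < β ∧ P = polarPoint α x β y := by
  have h2 : (0 : ℝ) < √2 := by positivity
  have key : ∀ z : ℂ, z = ((‖z‖ * √2 / √2 : ℝ) : ℂ) *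
      Complex.exp ((2 * Real.pi * (z.arg / (2 * Real.pi)) : ℝ) * Complex.I) := by
    intro z
    rw [mul_div_cancel₀ _ (by positivity), mul_div_assoc, div_self h2.ne', mul_one]
    exact (Complex.norm_mul_exp_arg_mul_I z).symm
  refine ⟨‖P 0‖ * √2, (P 0).arg / (2 * Real.pi), ‖P 1‖ * √2, (P 1).arg / (2 * Real.pi),
    by positivity, by positivity, ?_⟩
  ext i
  fin_cases i
  · exact key _
  · exact key _

lemma discPoint_eq_polarPoint (m : ℕ) (G : ℝ → ℝ) {r : ℝ} (hr : 0 < r) (y : ℝ) :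
    discPoint m G (r * Complex.exp ((2 * Real.pi * y : ℝ) * Complex.I)) =
      polarPoint (G r / 2) (m * y) (r / 2) y := by
  have hn : ‖(r : ℂ) * Complex.exp ((2 * Real.pi * y : ℝ) * Complex.I)‖ = r := by
    rw [norm_mul, Complex.norm_exp_ofReal_mul_I, mul_one, Complex.norm_real,
      Real.norm_of_nonneg hr.le]
  have hexp : Complex.exp ((2 * Real.pi * (m * y) : ℝ) * Complex.I) =
      Complex.exp ((2 * Real.pi * y : ℝ) * Complex.I) ^ m := by
    rw [← Complex.exp_nat_mul]
    congr 1
    push_cast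
    ring
  have hr' : (r : ℂ) ≠ 0 := by exact_mod_cast hr.ne'
  unfold discPoint polarPoint
  rw [hn, mul_div_cancel_left₀ _ hr', hexp]
  ext i
  fin_cases i
  · simp only [Fin.zero_eta, Matrix.cons_val_zero]
    congr 2
    ring
  · simp only [Fin.mk_one, Matrix.cons_val_one]
    push_cast
    ring

variable {q m : ℕ} {ε : ℤ}

/-- The level of the movie as a function of the radius, and its extension beyond the shell. -/
noncomputable def radialLevel (β : ℝ) : ℝ := Real.smoothTransition (2 * (1 - β))

/-- `α` as a function of `β` on the surface, in the coordinates `polarPoint`. -/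
noncomputable def radialProfile (m : ℕ) (β : ℝ) : ℝ := smoothProfile m (2 * β) / 2

lemma radialProfile_of_ge {β : ℝ} (h : 3 / 8 ≤ β) : radialProfile m β = β := by
  rw [radialProfile, smoothProfile_of_ge (by linarith)]
  ring

lemma contDiff_radialLevel : ContDiff ℝ ∞ radialLevel :=
  Real.smoothTransition.contDiff.comp (by fun_prop)

lemma contDiff_radialProfile (m : ℕ) : ContDiff ℝ ∞ (radialProfile m) :=
  ((contDiff_smoothProfile m).comp (by fun_prop)).div_const 2

lemma bandMovie_add_int (hq : Odd q) (l x y : ℝ) (i j : ℤ) :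
    bandMovie q m ε l (x + i) (y + j) = 0 ↔ bandMovie q m ε l x y = 0 := by
  have hsin : ∀ (t : ℝ) (n : ℤ), Real.sin (Real.pi * (t + n)) =
      (-1) ^ n * Real.sin (Real.pi * t) := by
    intro t n
    rw [mul_add, mul_comm Real.pi (n : ℝ), Real.sin_add_int_mul_pi]
  have e1 : (q * (x + i) - (q * m + 2 * ε) * (y + j) : ℝ) =
      (q * x - (q * m + 2 * ε) * y) + (q * i - (q * m + 2 * ε) * j : ℤ) := by push_cast; ring
  have e2 : (x + i - m * (y + j) : ℝ) = (x - m * y) + (i - m * j : ℤ) := by push_cast; ring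
  have hpar : ((-1 : ℝ)) ^ (q * i - (q * m + 2 * ε) * j : ℤ) = (-1) ^ (i - m * j : ℤ) := by
    obtain ⟨k, hk⟩ := hq
    have : (q * i - (q * m + 2 * ε) * j : ℤ) = (i - m * j) + 2 * (k * i - (k * m + ε) * j) := by
      rw [hk]; push_cast; ring
    rw [this, zpow_add₀ (by norm_num), zpow_mul]
    norm_num
  rw [bandMovie, e1, e2, hsin, hsin, hpar, bandMovie]
  have hne : ((-1 : ℝ)) ^ (i - m * j : ℤ) ≠ 0 := zpow_ne_zero _ (by norm_num)
  constructor
  · intro h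
    apply mul_left_cancel₀ hne
    linear_combination h
  · intro h
    linear_combination ((-1 : ℝ)) ^ (i - m * j : ℤ) * h

/-- The equations of the surface in polar coordinates. -/
lemma polarPoint_mem_smoothBand (hq : Odd q) {α β : ℝ} (hα : 0 < α) (hβ : 0 < β) (x y : ℝ) :
    polarPoint α x β y ∈ smoothBand q m ε ↔ polarPoint α x β y ∈ B4 ∧ α = radialProfile m β ∧
      bandMovie q m ε (radialLevel β) x y = 0 := by
  have h2 : (0 : ℝ) < √2 := by positivity
  have hB4 : polarPoint α x β y ∈ B4 ↔ α ^ 2 + β ^ 2 ≤ 2 := by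
    have h1 := norm_polarPoint_sq α x β y
    rw [B4, mem_closedBall_zero_iff]
    constructor
    · intro h; nlinarith [norm_nonneg (polarPoint α x β y)]
    · intro h; nlinarith [norm_nonneg (polarPoint α x β y)]
  have hdisc : ∀ {β : ℝ}, β ≤ 1 / 2 → radialLevel β = 1 := fun h =>
    Real.smoothTransition.one_of_one_le (by linarith)
  constructor
  · rintro (⟨u, x', y', hu, hm, hP⟩ | ⟨ζ, hζ, hP⟩)
    · rw [torusPoint_eq_polarPoint,
        polarPoint_eq_iff hα hβ (by linarith [hu.2]) (by linarith [hu.2])] at hP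
      obtain ⟨⟨rfl, i, rfl⟩, rfl, j, rfl⟩ := hP
      refine ⟨hB4.2 (by nlinarith [hu.1, hu.2]),
        (radialProfile_of_ge (by linarith [hu.2])).symm, ?_⟩
      rw [bandMovie_add_int hq] at hm
      rwa [radialLevel, show 2 * (1 - (1 - u / 2)) = u by ring]
    · rw [mem_closedBall_zero_iff] at hζ
      have hr : 0 < ‖ζ‖ := by
        rw [norm_pos_iff]
        intro h0
        have h1 := congrArg (fun P : C2 => ‖P 1‖) hP
        simp only [norm_discPoint_one, norm_polarPoint_one, h0, norm_zero, mul_zero] at h1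
        have := div_pos (abs_pos.2 hβ.ne') h2
        linarith
      have hζe : ζ = (‖ζ‖ : ℂ) * Complex.exp ((2 * Real.pi * (ζ.arg / (2 * Real.pi)) : ℝ) *
          Complex.I) := by
        rw [mul_div_cancel₀ _ (by positivity)]
        exact (Complex.norm_mul_exp_arg_mul_I ζ).symm
      rw [hζe, discPoint_eq_polarPoint m _ hr,
        polarPoint_eq_iff (half_pos (smoothProfile_pos hr)) (half_pos hr) hα hβ] at hP
      obtain ⟨⟨rfl, i, rfl⟩, rfl, j, rfl⟩ := hP
      have hG := smoothProfile_le_one (m := m) (norm_nonneg ζ) hζ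
      have hG0 := smoothProfile_pos (m := m) hr
      refine ⟨hB4.2 (by nlinarith), ?_, ?_⟩
      · rw [radialProfile, mul_div_cancel₀ _ two_ne_zero]
      · rw [bandMovie_add_int hq, hdisc (by linarith), bandMovie]
        simp
  · rintro ⟨hb, hαβ, hm⟩
    rcases le_or_gt β (1 / 2) with h | h
    · right
      rw [hdisc h, bandMovie, sub_self, zero_mul, zero_add, one_mul] at hm
      obtain ⟨n, hn⟩ := Real.sin_eq_zero_iff.1 hm
      have hn' : x = m * y + n := by
        rw [mul_comm] at hn
        have := mul_left_cancel₀ Real.pi_ne_zero hn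
        linarith
      refine ⟨((2 * β : ℝ) : ℂ) * Complex.exp ((2 * Real.pi * y : ℝ) * Complex.I), ?_, ?_⟩
      · rw [mem_closedBall_zero_iff, norm_mul, Complex.norm_exp_ofReal_mul_I, mul_one,
          Complex.norm_real, Real.norm_of_nonneg (by positivity)]
        linarith
      · rw [discPoint_eq_polarPoint m _ (by positivity),
          polarPoint_eq_iff (half_pos (smoothProfile_pos (by positivity))) (by positivity) hα hβ]
        exact ⟨⟨hαβ.symm, n, hn'⟩, by ring, 0, by simp⟩
    · left
      rw [radialProfile_of_ge (by linarith)] at hαβ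
      subst hαβ
      rw [hB4] at hb
      refine ⟨2 * (1 - α), x, y, ⟨by nlinarith, by linarith⟩, hm, ?_⟩
      rw [torusPoint_eq_polarPoint, show 1 - 2 * (1 - α) / 2 = α by ring]

lemma norm_le_half_discPoint {ζ : ℂ} (hζ : ‖ζ‖ ≤ 1) :
    ‖discPoint m (smoothProfile m) ζ‖ ≤ 1 / 2 := by
  have h0 : ‖discPoint m (smoothProfile m) ζ 0‖ ≤ (1 / 2) / √2 := by
    change ‖(((1 / 2) / √2 * smoothProfile m ‖ζ‖ : ℝ) : ℂ) * (ζ / ‖ζ‖) ^ m‖ ≤ _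
    have hG0 : 0 ≤ smoothProfile m ‖ζ‖ := by
      rcases eq_or_lt_of_le (norm_nonneg ζ) with h | h
      · rw [← h, smoothProfile_of_le (by norm_num)]
        positivity
      · exact (smoothProfile_pos h).le
    have hG1 := smoothProfile_le_one (m := m) (norm_nonneg ζ) hζ
    rw [norm_mul, Complex.norm_real, Real.norm_of_nonneg (by positivity), norm_pow, norm_div,
      Complex.norm_real, norm_norm]
    have h1 : (‖ζ‖ / ‖ζ‖) ^ m ≤ 1 := pow_le_one₀ (by positivity) (div_self_le_one _)
    have h2 : 0 ≤ (‖ζ‖ / ‖ζ‖) ^ m := by positivity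
    calc (1 / 2) / √2 * smoothProfile m ‖ζ‖ * (‖ζ‖ / ‖ζ‖) ^ m
        ≤ (1 / 2) / √2 * 1 * 1 := by gcongr
      _ = _ := by ring
  have h1 : ‖discPoint m (smoothProfile m) ζ 1‖ ≤ (1 / 2) / √2 := by
    rw [norm_discPoint_one]
    exact mul_le_of_le_one_right (by positivity) hζ
  have h2 := C2.norm_sq (discPoint m (smoothProfile m) ζ)
  have h3 : ((1 / 2) / √2) ^ 2 = 1 / 8 := by
    rw [div_pow, Real.sq_sqrt (by norm_num)]; norm_num
  have h4 : ‖discPoint m (smoothProfile m) ζ‖ ^ 2 ≤ (1 / 2) ^ 2 := by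
    rw [h2]
    have := pow_le_pow_left₀ (norm_nonneg _) h0 2
    have := pow_le_pow_left₀ (norm_nonneg _) h1 2
    linarith
  exact abs_le_of_sq_le_sq' h4 (by norm_num) |>.2

lemma smoothBand_subset : smoothBand q m ε ⊆ B4 := by
  rintro P (⟨u, x, y, hu, -, rfl⟩ | ⟨ζ, hζ, rfl⟩)
  · rw [B4, mem_closedBall_zero_iff, norm_torusPoint, abs_of_nonneg (by linarith [hu.2])]
    linarith [hu.1]
  · rw [mem_closedBall_zero_iff] at hζ
    rw [B4, mem_closedBall_zero_iff]
    linarith [norm_le_half_discPoint (m := m) hζ]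

/-- The boundary of the surface. -/
lemma smoothBand_inter_S3 (hq : Odd q) (hε : ε = 1 ∨ ε = -1) :
    smoothBand q m ε ∩ S3 = torusKnot (q * m + 2 * ε) q := by
  ext P
  constructor
  · rintro ⟨⟨u, x, y, hu, hm, rfl⟩ | ⟨ζ, hζ, rfl⟩, hS⟩
    · rw [S3, mem_sphere_zero_iff_norm, norm_torusPoint, abs_of_nonneg (by linarith [hu.2])] at hS
      have hu0 : u = 0 := by linarith
      subst hu0
      rw [Real.smoothTransition.zero, bandMovie, zero_mul, add_zero, sub_zero, one_mul] at hm
      obtain ⟨n, hn⟩ := Real.sin_eq_zero_iff.1 hm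
      rw [mul_comm] at hn
      have hn' := mul_left_cancel₀ Real.pi_ne_zero hn
      -- Bézout coefficients of `q` and `qm + 2ε`
      obtain ⟨k, hk⟩ := hq
      have hq0 : (q : ℝ) ≠ 0 := by
        have : q ≠ 0 := by omega
        exact_mod_cast this
      have hk' : (q : ℝ) = 2 * k + 1 := by exact_mod_cast hk
      have hε2 := sq_eq_one_of_sign hε
      refine ⟨(y - (n * ε * k : ℤ)) / q, ?_⟩
      rw [torusPoint_eq_iff one_pos (by norm_num)]
      refine ⟨by norm_num, ⟨n * (1 + ε * k * m), ?_⟩, n * ε * k, ?_⟩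
      · have hbez : (q : ℝ) * (1 + ε * k * m) - (q * m + 2 * ε) * (ε * k) = 1 := by
          linear_combination hk' - 2 * k * hε2
        have : (q : ℝ) * x = (q * m + 2 * ε) * (y - n * ε * k) + q * (n * (1 + ε * k * m)) := by
          linear_combination -hn' - n * hbez
        push_cast
        field_simp
        linear_combination this
      · push_cast
        field_simp
        ring
    · rw [mem_closedBall_zero_iff] at hζ
      rw [S3, mem_sphere_zero_iff_norm] at hS
      linarith [norm_le_half_discPoint (m := m) hζ]
  · rintro ⟨θ, rfl⟩
    refine ⟨Or.inl ⟨0, _, _, by simp, ?_, by simp; rfl⟩, ?_⟩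
    · rw [Real.smoothTransition.zero, bandMovie]
      ring_nf
      simp
    · rw [S3, mem_sphere_zero_iff_norm, norm_torusPoint, abs_one]

lemma smoothProfile_one (m : ℕ) : smoothProfile m 1 = 1 := smoothProfile_of_ge (by norm_num)

lemma isMobiusBand_smoothBand (hq : Odd q) (hε : ε = 1 ∨ ε = -1) :
    IsMobiusBand (smoothBand q m ε) :=
  isMobiusBand_cappedShell hq hε (contDiff_smoothProfile m).continuous (smoothProfile_one m)
    fun hm => by rw [smoothProfile_of_le (by norm_num), zero_pow hm]

lemma isCompact_of_isMobiusBand {S : Set C2} (h : IsMobiusBand S) : IsCompact S := by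
  obtain ⟨e⟩ := h
  have := e.symm.compactSpace
  exact isCompact_iff_compactSpace.2 this

lemma isConnected_of_isMobiusBand {S : Set C2} (h : IsMobiusBand S) : IsConnected S := by
  obtain ⟨e⟩ := h
  have : ConnectedSpace MobiusBand :=
    Quot.mk_surjective.connectedSpace continuous_quot_mk
  have : ConnectedSpace S := e.symm.surjective.connectedSpace e.symm.continuous
  exact isConnected_iff_connectedSpace.2 this

/-- Near the core of the disc the surface is a graph. -/
lemma mem_smoothBand_of_norm_lt {P : C2} (hP : ‖P 1‖ < (1 / 4) / √2) :
    P ∈ smoothBand q m ε ↔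
      P 0 = (((1 / 2) / √2 : ℝ) : ℂ) * (P 1 / (((1 / 2) / √2 : ℝ) : ℂ)) ^ m := by
  have h2 : (0 : ℝ) < √2 := by positivity
  have hc : (((1 / 2) / √2 : ℝ) : ℂ) ≠ 0 := by
    rw [Complex.ofReal_ne_zero]; positivity
  have hgraph : ∀ ζ : ℂ, ‖ζ‖ ≤ 1 / 2 → discPoint m (smoothProfile m) ζ 0 =
      (((1 / 2) / √2 : ℝ) : ℂ) * ζ ^ m := by
    intro ζ hζ
    change (((1 / 2) / √2 * smoothProfile m ‖ζ‖ : ℝ) : ℂ) * (ζ / ‖ζ‖) ^ m = _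
    rw [smoothProfile_of_le hζ]
    by_cases h0 : ζ = 0
    · rcases Nat.eq_zero_or_pos m with rfl | hm
      · simp
      · simp [h0, hm.ne']
    · have : ((‖ζ‖ : ℝ) : ℂ) ≠ 0 := by simpa using h0
      push_cast
      rw [div_pow, mul_assoc, mul_div_cancel₀ _ (pow_ne_zero _ this)]
  constructor
  · rintro (⟨u, x, y, hu, -, rfl⟩ | ⟨ζ, -, rfl⟩)
    · exfalso
      rw [norm_torusPoint_one, abs_of_nonneg (by linarith [hu.2]), div_lt_div_iff_of_pos_right h2]
        at hP
      linarith [hu.2]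
    · rw [norm_discPoint_one] at hP
      have hζ : ‖ζ‖ ≤ 1 / 2 := by
        field_simp at hP
        linarith
      rw [hgraph ζ hζ]
      change _ = _ * ((((1 / 2) / √2 : ℝ) : ℂ) * ζ / _) ^ m
      rw [mul_div_cancel_left₀ _ hc]
  · intro h
    have hζ : ‖P 1 / (((1 / 2) / √2 : ℝ) : ℂ)‖ ≤ 1 / 2 := by
      rw [norm_div, Complex.norm_real, Real.norm_of_nonneg (by positivity),
        div_le_iff₀ (by positivity)]
      refine hP.le.trans (le_of_eq ?_)
      ring
    refine Or.inr ⟨P 1 / (((1 / 2) / √2 : ℝ) : ℂ), mem_closedBall_zero_iff.2 (by linarith), ?_⟩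
    ext i
    fin_cases i
    · exact (hgraph _ hζ).trans h.symm
    · change (((1 / 2) / √2 : ℝ) : ℂ) * (P 1 / (((1 / 2) / √2 : ℝ) : ℂ)) = P 1
      rw [mul_div_cancel₀ _ hc]

lemma ne_zero_of_mem_smoothBand {P : C2} (hS : P ∈ smoothBand q m ε) (h1 : P 1 ≠ 0) : P 0 ≠ 0 := by
  have h2 : (0 : ℝ) < √2 := by positivity
  rcases hS with ⟨u, x, y, hu, -, rfl⟩ | ⟨ζ, -, rfl⟩
  · rw [← norm_ne_zero_iff, norm_torusPoint_zero]
    exact div_ne_zero (abs_ne_zero.2 (by linarith [hu.2])) h2.ne'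
  · have hζ : ζ ≠ 0 := by
      rintro rfl
      apply h1
      change (((1 / 2) / √2 : ℝ) : ℂ) * 0 = 0
      rw [mul_zero]
    have hn : 0 < ‖ζ‖ := norm_pos_iff.2 hζ
    change (((1 / 2) / √2 * smoothProfile m ‖ζ‖ : ℝ) : ℂ) * (ζ / ‖ζ‖) ^ m ≠ 0
    have h3 : ((‖ζ‖ : ℝ) : ℂ) ≠ 0 := by exact_mod_cast hn.ne'
    refine mul_ne_zero ?_ (pow_ne_zero _ (div_ne_zero hζ h3))
    rw [Complex.ofReal_ne_zero]
    exact (mul_pos (by positivity) (smoothProfile_pos hn)).ne'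

end SmoothBand

/-! ### The equations of the surface in local polar coordinates -/

section LocalCoordinates

open Topology

lemma hasDerivAt_smoothTransition_half : HasDerivAt Real.smoothTransition 2 (1 / 2) := by
  have hg : HasDerivAt expNegInvGlue (4 * Real.exp (-2)) (1 / 2) := by
    have h1 : HasDerivAt (fun x : ℝ => Real.exp (-x⁻¹)) (4 * Real.exp (-2)) (1 / 2) := by
      have : HasDerivAt (fun x : ℝ => Real.exp (-x⁻¹)) (Real.exp (-(1 / 2)⁻¹) * -(-((1 / 2) ^ 2)⁻¹))
          (1 / 2) := ((hasDerivAt_inv (x := (1 / 2 : ℝ)) (by norm_num)).neg).exp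
      refine this.congr_deriv ?_
      norm_num
      ring
    refine h1.congr_of_eventuallyEq ?_
    filter_upwards [lt_mem_nhds (show (0 : ℝ) < 1 / 2 by norm_num)] with x hx
    rw [expNegInvGlue, if_neg (not_le.2 hx)]
  have hval : expNegInvGlue (1 / 2) = Real.exp (-2) := by
    rw [expNegInvGlue, if_neg (by norm_num)]
    norm_num
  have hg1 : HasDerivAt (fun x => expNegInvGlue (1 - x)) (-(4 * Real.exp (-2))) (1 / 2) := by
    have hg' : HasDerivAt expNegInvGlue (4 * Real.exp (-2)) (1 - 1 / 2) := by
      rw [show (1 : ℝ) - 1 / 2 = 1 / 2 by norm_num]; exact hg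
    exact hg'.comp_const_sub 1 (1 / 2)
  have hE := Real.exp_pos (-2)
  have hd : expNegInvGlue (1 / 2) + expNegInvGlue (1 - 1 / 2) = 2 * Real.exp (-2) := by
    rw [show (1 : ℝ) - 1 / 2 = 1 / 2 by norm_num, hval]; ring
  refine (hg.div (hg.add hg1) (by
    change expNegInvGlue (1 / 2) + expNegInvGlue (1 - 1 / 2) ≠ 0
    rw [hd]; positivity)).congr_deriv ?_
  change (4 * Real.exp (-2) * (expNegInvGlue (1 / 2) + expNegInvGlue (1 - 1 / 2)) -
    expNegInvGlue (1 / 2) * (4 * Real.exp (-2) + -(4 * Real.exp (-2)))) /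
    (expNegInvGlue (1 / 2) + expNegInvGlue (1 - 1 / 2)) ^ 2 = 2
  rw [hd, hval]
  field_simp
  ring

lemma smoothTransition_half : Real.smoothTransition (1 / 2) = 1 / 2 := by
  have hE : 0 < expNegInvGlue (1 / 2) := expNegInvGlue.pos_of_pos (by norm_num)
  rw [Real.smoothTransition, show (1 : ℝ) - 1 / 2 = 1 / 2 by norm_num]
  field_simp
  norm_num

lemma eq_of_smoothTransition_eq_half {u : ℝ} (h : Real.smoothTransition u = 1 / 2) : u = 1 / 2 := by
  have h0 : 0 ≤ u := by
    by_contra! hu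
    rw [Real.smoothTransition.zero_of_nonpos hu.le] at h
    norm_num at h
  have h1 : u ≤ 1 := by
    by_contra! hu
    rw [Real.smoothTransition.one_of_one_le hu.le] at h
    norm_num at h
  exact smoothTransition_strictMonoOn.injOn ⟨h0, h1⟩ (by norm_num)
    (h.trans smoothTransition_half.symm)

/-- The modulus near `z₀` with `|z₀| = α₀/√2`, up to the factor `√2`. -/
noncomputable def localModulus (α₀ : ℝ) (z₀ z : ℂ) : ℝ := α₀ * Real.exp (Complex.log (z / z₀)).re

/-- The branch near `z₀` of the argument, in full turns, with the value `x₀` at `z₀`. -/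
noncomputable def localTurn (x₀ : ℝ) (z₀ z : ℂ) : ℝ :=
  x₀ + (Complex.log (z / z₀)).im / (2 * Real.pi)

lemma eq_localModulus_mul_exp {α₀ x₀ : ℝ} (hα₀ : 0 < α₀) {z₀ z : ℂ}
    (hz₀ : z₀ = ((α₀ / √2 : ℝ) : ℂ) * Complex.exp ((2 * Real.pi * x₀ : ℝ) * Complex.I))
    (hz : z / z₀ ∈ Complex.slitPlane) :
    z = ((localModulus α₀ z₀ z / √2 : ℝ) : ℂ) *
      Complex.exp ((2 * Real.pi * localTurn x₀ z₀ z : ℝ) * Complex.I) := by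
  have hne : z₀ ≠ 0 := by
    rw [hz₀]
    refine mul_ne_zero ?_ (Complex.exp_ne_zero _)
    rw [Complex.ofReal_ne_zero]
    positivity
  obtain ⟨w, hw⟩ : ∃ w, w = Complex.log (z / z₀) := ⟨_, rfl⟩
  have h1 : z = z₀ * Complex.exp w := by
    rw [hw, Complex.exp_log (Complex.slitPlane_ne_zero hz), mul_div_cancel₀ _ hne]
  rw [localModulus, localTurn, ← hw]
  rw [h1]
  nth_rewrite 1 [hz₀]
  have h2 : Complex.exp w = (Real.exp w.re : ℂ) * Complex.exp ((w.im : ℝ) * Complex.I) := by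
    rw [Complex.ofReal_exp, ← Complex.exp_add, Complex.re_add_im]
  have h3 : (2 * Real.pi * (x₀ + w.im / (2 * Real.pi)) : ℝ) = 2 * Real.pi * x₀ + w.im := by
    have := Real.pi_pos
    field_simp
  rw [h2, h3, Complex.ofReal_add, add_mul, Complex.exp_add]
  push_cast
  ring

lemma local_of_polar {α₀ x₀ α x : ℝ} (hα₀ : 0 < α₀) {z₀ : ℂ}
    (hz₀ : z₀ = ((α₀ / √2 : ℝ) : ℂ) * Complex.exp ((2 * Real.pi * x₀ : ℝ) * Complex.I))
    (hα : 0 < α) (hx : |x - x₀| < 1 / 2) :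
    localModulus α₀ z₀ (((α / √2 : ℝ) : ℂ) * Complex.exp ((2 * Real.pi * x : ℝ) * Complex.I)) = α ∧
    localTurn x₀ z₀ (((α / √2 : ℝ) : ℂ) * Complex.exp ((2 * Real.pi * x : ℝ) * Complex.I)) = x := by
  have hpi := Real.pi_pos
  have h2 : (0 : ℝ) < √2 := by positivity
  have hq : (((α / √2 : ℝ) : ℂ) * Complex.exp ((2 * Real.pi * x : ℝ) * Complex.I)) / z₀ =
      Complex.exp ((Real.log (α / α₀) : ℝ) + (2 * Real.pi * (x - x₀) : ℝ) * Complex.I) := by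
    rw [Complex.exp_add, ← Complex.ofReal_exp, Real.exp_log (by positivity), hz₀]
    have e : ((2 * Real.pi * (x - x₀) : ℝ) : ℂ) * Complex.I =
        (2 * Real.pi * x : ℝ) * Complex.I - (2 * Real.pi * x₀ : ℝ) * Complex.I := by
      push_cast; ring
    rw [e, Complex.exp_sub]
    have h3 : ((α₀ : ℝ) : ℂ) ≠ 0 := by exact_mod_cast hα₀.ne'
    have h4 : ((√2 : ℝ) : ℂ) ≠ 0 := by exact_mod_cast h2.ne'
    push_cast
    field_simp
  rw [abs_lt] at hx
  have hlog : Complex.log ((((α / √2 : ℝ) : ℂ) *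
      Complex.exp ((2 * Real.pi * x : ℝ) * Complex.I)) / z₀) =
      (Real.log (α / α₀) : ℝ) + (2 * Real.pi * (x - x₀) : ℝ) * Complex.I := by
    rw [hq, Complex.log_exp]
    · rw [Complex.add_im, Complex.ofReal_im, Complex.im_ofReal_mul, Complex.I_im]
      nlinarith
    · rw [Complex.add_im, Complex.ofReal_im, Complex.im_ofReal_mul, Complex.I_im]
      nlinarith
  rw [localModulus, localTurn, hlog]
  constructor
  · rw [Complex.add_re, Complex.ofReal_re, Complex.re_ofReal_mul, Complex.I_re, mul_zero, add_zero,
      Real.exp_log (by positivity), mul_div_cancel₀ _ hα₀.ne']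
  · rw [Complex.add_im, Complex.ofReal_im, Complex.im_ofReal_mul, Complex.I_im]
    field_simp
    ring

lemma contDiffAt_log_div {z₀ z : ℂ} (hz : z / z₀ ∈ Complex.slitPlane) :
    ContDiffAt ℝ ∞ (fun z : ℂ => Complex.log (z / z₀)) z := by
  have h1 : ContDiffAt ℝ ∞ Complex.log (z / z₀) := (Complex.contDiffAt_log hz).restrict_scalars ℝ
  exact h1.comp z (contDiffAt_id.mul contDiffAt_const)

lemma contDiffAt_localModulus (α₀ : ℝ) {z₀ z : ℂ} (hz : z / z₀ ∈ Complex.slitPlane) :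
    ContDiffAt ℝ ∞ (localModulus α₀ z₀) z := by
  have h1 : ContDiffAt ℝ ∞ (fun z : ℂ => (Complex.log (z / z₀)).re) z :=
    (Complex.reCLM.contDiff.contDiffAt).comp z (contDiffAt_log_div hz)
  exact contDiffAt_const.mul h1.exp

lemma contDiffAt_localTurn (x₀ : ℝ) {z₀ z : ℂ} (hz : z / z₀ ∈ Complex.slitPlane) :
    ContDiffAt ℝ ∞ (localTurn x₀ z₀) z := by
  have h1 : ContDiffAt ℝ ∞ (fun z : ℂ => (Complex.log (z / z₀)).im) z :=
    (Complex.imCLM.contDiff.contDiffAt).comp z (contDiffAt_log_div hz)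
  exact contDiffAt_const.add (h1.div_const _)

/-- A velocity vector tests the derivatives of functions. -/
lemma exists_velocity {κ : ℝ → C2} (hκ : DifferentiableAt ℝ κ 0) : ∃ v : C2, ∀ (F : C2 → ℝ) (d : ℝ),
    DifferentiableAt ℝ F (κ 0) → HasDerivAt (fun t => F (κ t)) d 0 → fderiv ℝ F (κ 0) v = d :=
  ⟨deriv κ 0, fun _ _ hF hd =>
    (hF.hasFDerivAt.comp_hasDerivAt 0 hκ.hasDerivAt).unique hd⟩

lemma differentiableAt_C2 {E : Type*} [NormedAddCommGroup E] [NormedSpace ℝ E] {κ : E → C2} {t : E}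
    (h0 : DifferentiableAt ℝ (fun t => κ t 0) t) (h1 : DifferentiableAt ℝ (fun t => κ t 1) t) :
    DifferentiableAt ℝ κ t := by
  rw [differentiableAt_piLp]
  intro i
  fin_cases i
  · exact h0
  · exact h1

lemma differentiableAt_polarPoint {a x b y : ℝ → ℝ} {t : ℝ} (ha : DifferentiableAt ℝ a t)
    (hx : DifferentiableAt ℝ x t) (hb : DifferentiableAt ℝ b t) (hy : DifferentiableAt ℝ y t) :
    DifferentiableAt ℝ (fun t => polarPoint (a t) (x t) (b t) (y t)) t := by
  have key : ∀ {a x : ℝ → ℝ}, DifferentiableAt ℝ a t → DifferentiableAt ℝ x t →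
      DifferentiableAt ℝ (fun t => ((a t / √2 : ℝ) : ℂ) *
        Complex.exp ((2 * Real.pi * x t : ℝ) * Complex.I)) t := by
    intro a x ha hx
    have h1 : DifferentiableAt ℝ (fun t => ((a t / √2 : ℝ) : ℂ)) t :=
      Complex.ofRealCLM.differentiableAt.comp t (ha.div_const _)
    have h2 : DifferentiableAt ℝ (fun t => ((2 * Real.pi * x t : ℝ) : ℂ)) t :=
      Complex.ofRealCLM.differentiableAt.comp t (hx.const_mul _)
    exact h1.mul (h2.mul_const _).cexp
  exact differentiableAt_C2 (key ha hx) (key hb hy)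

variable {q m : ℕ} {ε : ℤ}

lemma contDiff_bandMovie : ContDiff ℝ ∞ fun z : ℝ × ℝ × ℝ => bandMovie q m ε z.1 z.2.1 z.2.2 := by
  unfold bandMovie
  fun_prop

/-- The equation `α = radialProfile β` near a point. -/
noncomputable def radialEquation (m : ℕ) (α₀ β₀ : ℝ) (P₀ P : C2) : ℝ :=
  localModulus α₀ (P₀ 0) (P 0) - radialProfile m (localModulus β₀ (P₀ 1) (P 1))

/-- The equation of the movie near a point. -/
noncomputable def movieEquation (q m : ℕ) (ε : ℤ) (x₀ β₀ y₀ : ℝ) (P₀ P : C2) : ℝ :=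
  bandMovie q m ε (radialLevel (localModulus β₀ (P₀ 1) (P 1))) (localTurn x₀ (P₀ 0) (P 0))
    (localTurn y₀ (P₀ 1) (P 1))

/-- The domain of the local polar coordinates. -/
def polarDomain (P₀ : C2) : Set C2 :=
  {P | P 0 / P₀ 0 ∈ Complex.slitPlane ∧ P 1 / P₀ 1 ∈ Complex.slitPlane}

lemma isOpen_polarDomain (P₀ : C2) : IsOpen (polarDomain P₀) :=
  (Complex.isOpen_slitPlane.preimage (f := fun P : C2 => P 0 / P₀ 0) (by fun_prop)).inter
    (Complex.isOpen_slitPlane.preimage (f := fun P : C2 => P 1 / P₀ 1) (by fun_prop))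

lemma contDiff_coord (i : Fin 2) : ContDiff ℝ ∞ fun P : C2 => P i :=
  ((PiLp.proj 2 (fun _ : Fin 2 => ℂ) i : C2 →L[ℂ] ℂ).restrictScalars ℝ).contDiff

lemma contDiffOn_radialEquation (m : ℕ) (α₀ β₀ : ℝ) (P₀ : C2) :
    ContDiffOn ℝ ∞ (radialEquation m α₀ β₀ P₀) (polarDomain P₀) := by
  intro P hP
  refine ContDiffAt.contDiffWithinAt ?_
  have h0 := (contDiffAt_localModulus α₀ hP.1).comp P (contDiff_coord 0).contDiffAt
  have h1 := (contDiffAt_localModulus β₀ hP.2).comp P (contDiff_coord 1).contDiffAt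
  exact h0.sub ((contDiff_radialProfile m).contDiffAt.comp P h1)

lemma contDiffOn_movieEquation (x₀ β₀ y₀ : ℝ) (P₀ : C2) :
    ContDiffOn ℝ ∞ (movieEquation q m ε x₀ β₀ y₀ P₀) (polarDomain P₀) := by
  intro P hP
  refine ContDiffAt.contDiffWithinAt ?_
  have h0 := (contDiffAt_localTurn x₀ hP.1).comp P (contDiff_coord 0).contDiffAt
  have h1 := (contDiffAt_localTurn y₀ hP.2).comp P (contDiff_coord 1).contDiffAt
  have h2 := (contDiffAt_localModulus β₀ hP.2).comp P (contDiff_coord 1).contDiffAt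
  have h3 := contDiff_radialLevel.contDiffAt.comp P h2
  exact (contDiff_bandMovie (q := q) (m := m) (ε := ε)).contDiffAt.comp P (h3.prodMk (h0.prodMk h1))

section AtPoint

variable {α₀ x₀ β₀ y₀ : ℝ}

lemma mem_polarDomain (hα₀ : 0 < α₀) (hβ₀ : 0 < β₀) :
    polarPoint α₀ x₀ β₀ y₀ ∈ polarDomain (polarPoint α₀ x₀ β₀ y₀) := by
  have key : ∀ {a x : ℝ}, 0 < a → ((a / √2 : ℝ) : ℂ) *
      Complex.exp ((2 * Real.pi * x : ℝ) * Complex.I) ≠ 0 := by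
    intro a x ha
    refine mul_ne_zero ?_ (Complex.exp_ne_zero _)
    rw [Complex.ofReal_ne_zero]
    positivity
  constructor
  · have h : polarPoint α₀ x₀ β₀ y₀ 0 ≠ 0 := key hα₀
    change _ / _ ∈ _
    rw [div_self h]
    exact Complex.one_mem_slitPlane
  · have h : polarPoint α₀ x₀ β₀ y₀ 1 ≠ 0 := key hβ₀
    change _ / _ ∈ _
    rw [div_self h]
    exact Complex.one_mem_slitPlane

lemma mem_smoothBand_iff_equations (hq : Odd q) (hα₀ : 0 < α₀) (hβ₀ : 0 < β₀) {P : C2}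
    (hP : P ∈ polarDomain (polarPoint α₀ x₀ β₀ y₀)) :
    P ∈ smoothBand q m ε ↔ P ∈ B4 ∧
      radialEquation m α₀ β₀ (polarPoint α₀ x₀ β₀ y₀) P = 0 ∧
      movieEquation q m ε x₀ β₀ y₀ (polarPoint α₀ x₀ β₀ y₀) P = 0 := by
  have h0 := eq_localModulus_mul_exp hα₀ (polarPoint_zero α₀ x₀ β₀ y₀) hP.1
  have h1 := eq_localModulus_mul_exp hβ₀ (polarPoint_one α₀ x₀ β₀ y₀) hP.2
  have hPe : P = polarPoint (localModulus α₀ (polarPoint α₀ x₀ β₀ y₀ 0) (P 0))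
      (localTurn x₀ (polarPoint α₀ x₀ β₀ y₀ 0) (P 0))
      (localModulus β₀ (polarPoint α₀ x₀ β₀ y₀ 1) (P 1))
      (localTurn y₀ (polarPoint α₀ x₀ β₀ y₀ 1) (P 1)) := by
    ext i
    fin_cases i
    · exact h0
    · exact h1
  have := polarPoint_mem_smoothBand (q := q) (m := m) (ε := ε) hq
    (α := localModulus α₀ (polarPoint α₀ x₀ β₀ y₀ 0) (P 0))
    (β := localModulus β₀ (polarPoint α₀ x₀ β₀ y₀ 1) (P 1))
    (mul_pos hα₀ (Real.exp_pos _)) (mul_pos hβ₀ (Real.exp_pos _))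
    (localTurn x₀ (polarPoint α₀ x₀ β₀ y₀ 0) (P 0)) (localTurn y₀ (polarPoint α₀ x₀ β₀ y₀ 1) (P 1))
  rw [← hPe] at this
  rw [this, radialEquation, movieEquation, sub_eq_zero]

/-- The derivatives of the defining functions in the direction of a curve. -/
lemma exists_fderiv_eq (hα₀ : 0 < α₀) (hβ₀ : 0 < β₀) {a x b y : ℝ → ℝ}
    (ha : DifferentiableAt ℝ a 0) (hx : DifferentiableAt ℝ x 0) (hb : DifferentiableAt ℝ b 0)
    (hy : DifferentiableAt ℝ y 0) (ha0 : a 0 = α₀) (hx0 : x 0 = x₀) (hb0 : b 0 = β₀)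
    (hy0 : y 0 = y₀) {dN df dg : ℝ}
    (hN : HasDerivAt (fun t => 1 - (a t ^ 2 + b t ^ 2) / 2) dN 0)
    (hf : HasDerivAt (fun t => a t - radialProfile m (b t)) df 0)
    (hg : HasDerivAt (fun t => bandMovie q m ε (radialLevel (b t)) (x t) (y t)) dg 0) :
    ∃ v : C2, fderiv ℝ (fun P : C2 => 1 - ‖P‖ ^ 2) (polarPoint α₀ x₀ β₀ y₀) v = dN ∧
      fderiv ℝ (radialEquation m α₀ β₀ (polarPoint α₀ x₀ β₀ y₀)) (polarPoint α₀ x₀ β₀ y₀) v = df ∧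
      fderiv ℝ (movieEquation q m ε x₀ β₀ y₀ (polarPoint α₀ x₀ β₀ y₀))
        (polarPoint α₀ x₀ β₀ y₀) v = dg := by
  obtain ⟨v, hv⟩ := exists_velocity (differentiableAt_polarPoint ha hx hb hy)
  simp only [ha0, hx0, hb0, hy0] at hv
  have hU := (isOpen_polarDomain (polarPoint α₀ x₀ β₀ y₀)).mem_nhds (mem_polarDomain hα₀ hβ₀)
  have hloc : ∀ᶠ t in 𝓝 (0 : ℝ), (0 < a t ∧ 0 < b t) ∧ |x t - x₀| < 1 / 2 ∧ |y t - y₀| < 1 / 2 := by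
    refine ((ha.continuousAt.eventually (lt_mem_nhds (by rw [ha0]; exact hα₀))).and
      (hb.continuousAt.eventually (lt_mem_nhds (by rw [hb0]; exact hβ₀)))).and (.and ?_ ?_)
    · exact (hx.continuousAt.sub continuousAt_const).abs.eventually
        (gt_mem_nhds (by change |x 0 - x₀| < 1 / 2; rw [hx0]; norm_num))
    · exact (hy.continuousAt.sub continuousAt_const).abs.eventually
        (gt_mem_nhds (by change |y 0 - y₀| < 1 / 2; rw [hy0]; norm_num))
  refine ⟨v, hv _ _ ?_ ?_, hv _ _ ?_ ?_, hv _ _ ?_ ?_⟩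
  · exact ((contDiff_const.sub (contDiff_norm_sq ℝ)).differentiable (n := 1)
      (by simp)).differentiableAt
  · simpa only [norm_polarPoint_sq] using hN
  · exact ((contDiffOn_radialEquation m α₀ β₀ _).contDiffAt hU).differentiableAt (by simp)
  · refine hf.congr_of_eventuallyEq ?_
    filter_upwards [hloc] with t ht
    rw [radialEquation, polarPoint_zero (a t), polarPoint_one (a t),
      (local_of_polar hα₀ (polarPoint_zero α₀ x₀ β₀ y₀) ht.1.1 ht.2.1).1,
      (local_of_polar hβ₀ (polarPoint_one α₀ x₀ β₀ y₀) ht.1.2 ht.2.2).1]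
  · exact ((contDiffOn_movieEquation _ _ _ _).contDiffAt hU).differentiableAt (by simp)
  · refine hg.congr_of_eventuallyEq ?_
    filter_upwards [hloc] with t ht
    rw [movieEquation, polarPoint_zero (a t), polarPoint_one (a t),
      (local_of_polar hα₀ (polarPoint_zero α₀ x₀ β₀ y₀) ht.1.1 ht.2.1).2,
      (local_of_polar hβ₀ (polarPoint_one α₀ x₀ β₀ y₀) ht.1.2 ht.2.2).1,
      (local_of_polar hβ₀ (polarPoint_one α₀ x₀ β₀ y₀) ht.1.2 ht.2.2).2]

end AtPoint

end LocalCoordinates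

/-! ### The surface is smoothly and properly embedded -/

section ProperSurface

open Topology

variable {q m : ℕ} {ε : ℤ}

lemma linearIndependent_pair_of_apply {E : Type*} [NormedAddCommGroup E] [NormedSpace ℝ E]
    {f g : E →L[ℝ] ℝ} {v w : E} (hfv : f v ≠ 0) (hgv : g v = 0) (hgw : g w ≠ 0) :
    LinearIndependent ℝ ![f, g] := by
  rw [LinearIndependent.pair_iff]
  intro s t h
  have h1 : s * f v + t * g v = 0 := DFunLike.congr_fun h v
  have h2 : s * f w + t * g w = 0 := DFunLike.congr_fun h w
  rw [hgv, mul_zero, add_zero] at h1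
  have hs := (mul_eq_zero.1 h1).resolve_right hfv
  rw [hs, zero_mul, zero_add] at h2
  exact ⟨hs, (mul_eq_zero.1 h2).resolve_right hgw⟩

lemma linearIndependent_triple_of_apply {E : Type*} [NormedAddCommGroup E] [NormedSpace ℝ E]
    {N f g : E →L[ℝ] ℝ} {u v w : E} (hNu : N u = 0) (hfu : f u = 0) (hgu : g u ≠ 0)
    (hNv : N v ≠ 0) (hfv : f v = 0) (hfw : f w ≠ 0) :
    LinearIndependent ℝ ![N, f, g] := by
  rw [Fintype.linearIndependent_iff]
  intro c h
  have h' : ∀ z, c 0 * N z + c 1 * f z + c 2 * g z = 0 := by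
    intro z
    have := DFunLike.congr_fun h z
    rw [Fin.sum_univ_three] at this
    exact this
  have h1 := h' u
  rw [hNu, hfu, mul_zero, mul_zero, zero_add, zero_add] at h1
  have hc2 := (mul_eq_zero.1 h1).resolve_right hgu
  have h2 := h' v
  rw [hfv, hc2, mul_zero, zero_mul, add_zero, add_zero] at h2
  have hc0 := (mul_eq_zero.1 h2).resolve_right hNv
  have h3 := h' w
  rw [hc0, hc2, zero_mul, zero_mul, add_zero, zero_add] at h3
  have hc1 := (mul_eq_zero.1 h3).resolve_right hfw
  intro i
  fin_cases i
  · exact hc0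
  · exact hc1
  · exact hc2

lemma hasDerivAt_bandMovie_line (l x₀ y₀ c d : ℝ) :
    HasDerivAt (fun t => bandMovie q m ε l (x₀ + t * c) (y₀ + t * d))
      ((1 - l) * (Real.pi * (q * c - (q * m + 2 * ε) * d) *
          Real.cos (Real.pi * (q * x₀ - (q * m + 2 * ε) * y₀))) +
        l * (Real.pi * (c - m * d) * Real.cos (Real.pi * (x₀ - m * y₀)))) 0 := by
  have hlin : ∀ x v : ℝ, HasDerivAt (fun t => x + t * v) v 0 := fun x v => by
    simpa using ((hasDerivAt_id (0 : ℝ)).mul_const v).const_add x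
  have hA := (((hlin x₀ c).const_mul (q : ℝ)).sub
    ((hlin y₀ d).const_mul (q * m + 2 * ε : ℝ))).const_mul Real.pi
  have hB := ((hlin x₀ c).sub ((hlin y₀ d).const_mul (m : ℝ))).const_mul Real.pi
  refine ((hA.sin.const_mul (1 - l)).add (hB.sin.const_mul l)).congr_deriv ?_
  simp only [Pi.sub_apply, zero_mul, add_zero]
  ring

lemma hasDerivAt_bandMovie_level {L : ℝ → ℝ} {L' : ℝ} (hL : HasDerivAt L L' 0) (x y : ℝ) :
    HasDerivAt (fun t => bandMovie q m ε (L t) x y)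
      (L' * (Real.sin (Real.pi * (x - m * y)) -
        Real.sin (Real.pi * (q * x - (q * m + 2 * ε) * y)))) 0 := by
  refine (((hL.const_sub 1).mul_const _).add (hL.mul_const _)).congr_deriv ?_
  ring

section AtPoint

variable {α₀ x₀ β₀ y₀ : ℝ}

lemma exists_fderiv_eq_modulus (hα₀ : 0 < α₀) (hβ₀ : 0 < β₀) :
    ∃ v : C2, fderiv ℝ (fun P : C2 => 1 - ‖P‖ ^ 2) (polarPoint α₀ x₀ β₀ y₀) v = -α₀ ∧
      fderiv ℝ (radialEquation m α₀ β₀ (polarPoint α₀ x₀ β₀ y₀)) (polarPoint α₀ x₀ β₀ y₀) v = 1 ∧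
      fderiv ℝ (movieEquation q m ε x₀ β₀ y₀ (polarPoint α₀ x₀ β₀ y₀))
        (polarPoint α₀ x₀ β₀ y₀) v = 0 := by
  have h1 : HasDerivAt (fun t : ℝ => α₀ + t) 1 0 := (hasDerivAt_id (0 : ℝ)).const_add α₀
  refine exists_fderiv_eq hα₀ hβ₀ (a := fun t => α₀ + t) (x := fun _ => x₀) (b := fun _ => β₀)
    (y := fun _ => y₀) (by fun_prop) (by fun_prop) (by fun_prop) (by fun_prop) (by simp) rfl rfl rfl
    ?_ (h1.sub_const _) (hasDerivAt_const _ _)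
  refine ((((h1.pow 2).add_const (β₀ ^ 2)).div_const 2).const_sub 1).congr_deriv ?_
  norm_num

lemma exists_fderiv_eq_turn (hα₀ : 0 < α₀) (hβ₀ : 0 < β₀) (c d : ℝ) :
    ∃ v : C2, fderiv ℝ (fun P : C2 => 1 - ‖P‖ ^ 2) (polarPoint α₀ x₀ β₀ y₀) v = 0 ∧
      fderiv ℝ (radialEquation m α₀ β₀ (polarPoint α₀ x₀ β₀ y₀)) (polarPoint α₀ x₀ β₀ y₀) v = 0 ∧
      fderiv ℝ (movieEquation q m ε x₀ β₀ y₀ (polarPoint α₀ x₀ β₀ y₀))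
        (polarPoint α₀ x₀ β₀ y₀) v = (1 - radialLevel β₀) * (Real.pi *
          (q * c - (q * m + 2 * ε) * d) *
          Real.cos (Real.pi * (q * x₀ - (q * m + 2 * ε) * y₀))) +
        radialLevel β₀ * (Real.pi * (c - m * d) * Real.cos (Real.pi * (x₀ - m * y₀))) :=
  exists_fderiv_eq hα₀ hβ₀ (a := fun _ => α₀) (x := fun t => x₀ + t * c) (b := fun _ => β₀)
    (y := fun t => y₀ + t * d) (by fun_prop) (by fun_prop) (by fun_prop) (by fun_prop) rfl (by simp)
    rfl (by simp) (hasDerivAt_const _ _) (hasDerivAt_const _ _)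
    (hasDerivAt_bandMovie_line _ _ _ _ _)

lemma exists_fderiv_eq_turn_left (hε : ε = 1 ∨ ε = -1) (hα₀ : 0 < α₀) (hβ₀ : 0 < β₀) :
    ∃ v : C2, fderiv ℝ (fun P : C2 => 1 - ‖P‖ ^ 2) (polarPoint α₀ x₀ β₀ y₀) v = 0 ∧
      fderiv ℝ (radialEquation m α₀ β₀ (polarPoint α₀ x₀ β₀ y₀)) (polarPoint α₀ x₀ β₀ y₀) v = 0 ∧
      fderiv ℝ (movieEquation q m ε x₀ β₀ y₀ (polarPoint α₀ x₀ β₀ y₀))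
        (polarPoint α₀ x₀ β₀ y₀) v = (1 - radialLevel β₀) * (Real.pi *
          Real.cos (Real.pi * (q * x₀ - (q * m + 2 * ε) * y₀))) := by
  obtain ⟨v, h1, h2, h3⟩ := exists_fderiv_eq_turn (q := q) (m := m) (ε := ε) (x₀ := x₀) (y₀ := y₀)
    hα₀ hβ₀ (-(m * ε / 2)) (-(ε / 2))
  refine ⟨v, h1, h2, h3.trans ?_⟩
  have e1 : (q * -(m * ε / 2) - (q * m + 2 * ε) * -(ε / 2) : ℝ) = 1 := by
    linear_combination sq_eq_one_of_sign hε
  have e2 : (-(m * ε / 2) - m * -(ε / 2) : ℝ) = 0 := by ring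
  rw [e1, e2]
  ring

lemma exists_fderiv_eq_turn_right (hε : ε = 1 ∨ ε = -1) (hα₀ : 0 < α₀) (hβ₀ : 0 < β₀) :
    ∃ v : C2, fderiv ℝ (radialEquation m α₀ β₀ (polarPoint α₀ x₀ β₀ y₀))
        (polarPoint α₀ x₀ β₀ y₀) v = 0 ∧
      fderiv ℝ (movieEquation q m ε x₀ β₀ y₀ (polarPoint α₀ x₀ β₀ y₀))
        (polarPoint α₀ x₀ β₀ y₀) v = radialLevel β₀ * (Real.pi *
          Real.cos (Real.pi * (x₀ - m * y₀))) := by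
  obtain ⟨v, -, h2, h3⟩ := exists_fderiv_eq_turn (q := q) (m := m) (ε := ε) (x₀ := x₀) (y₀ := y₀)
    hα₀ hβ₀ (1 + m * ε * q / 2) (ε * q / 2)
  refine ⟨v, h2, h3.trans ?_⟩
  have e1 : (q * (1 + m * ε * q / 2) - (q * m + 2 * ε) * (ε * q / 2) : ℝ) = 0 := by
    linear_combination -(q : ℝ) * sq_eq_one_of_sign hε
  have e2 : (1 + m * ε * q / 2 - m * (ε * q / 2) : ℝ) = 1 := by ring
  rw [e1, e2]
  ring

lemma exists_fderiv_eq_level (hα₀ : 0 < α₀) (hβ₀ : 0 < β₀) (hα : α₀ = radialProfile m β₀)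
    {R' L' : ℝ} (hR : HasDerivAt (radialProfile m) R' β₀) (hL : HasDerivAt radialLevel L' β₀) :
    ∃ v : C2, fderiv ℝ (fun P : C2 => 1 - ‖P‖ ^ 2) (polarPoint α₀ x₀ β₀ y₀) v =
        -(α₀ * R' + β₀) ∧
      fderiv ℝ (radialEquation m α₀ β₀ (polarPoint α₀ x₀ β₀ y₀)) (polarPoint α₀ x₀ β₀ y₀) v = 0 ∧
      fderiv ℝ (movieEquation q m ε x₀ β₀ y₀ (polarPoint α₀ x₀ β₀ y₀))
        (polarPoint α₀ x₀ β₀ y₀) v = L' * (Real.sin (Real.pi * (x₀ - m * y₀)) -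
          Real.sin (Real.pi * (q * x₀ - (q * m + 2 * ε) * y₀))) := by
  have hb : HasDerivAt (fun t : ℝ => β₀ + t) 1 0 := (hasDerivAt_id (0 : ℝ)).const_add β₀
  have ha : HasDerivAt (fun t : ℝ => radialProfile m (β₀ + t)) R' 0 := by
    refine HasDerivAt.comp_const_add (f := radialProfile m) β₀ 0 ?_
    rwa [add_zero]
  have hl : HasDerivAt (fun t : ℝ => radialLevel (β₀ + t)) L' 0 := by
    refine HasDerivAt.comp_const_add (f := radialLevel) β₀ 0 ?_
    rwa [add_zero]
  refine exists_fderiv_eq hα₀ hβ₀ (a := fun t => radialProfile m (β₀ + t)) (x := fun _ => x₀)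
    (b := fun t => β₀ + t) (y := fun _ => y₀) ha.differentiableAt (by fun_prop) (by fun_prop)
    (by fun_prop) (by simp [hα]) rfl (by simp) rfl ?_ ?_ (hasDerivAt_bandMovie_level hl _ _)
  · refine ((((ha.pow 2).add (hb.pow 2)).div_const 2).const_sub 1).congr_deriv ?_
    simp only [add_zero, ← hα]
    norm_num
    ring
  · simp only [sub_self]
    exact hasDerivAt_const _ _

lemma hasDerivAt_radialLevel_of_half (hl : radialLevel β₀ = 1 / 2) :
    HasDerivAt radialLevel (-4) β₀ := by
  have h1 := eq_of_smoothTransition_eq_half hl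
  have h2 : HasDerivAt (fun β : ℝ => 2 * (1 - β)) (-2) β₀ := by
    simpa using ((hasDerivAt_id β₀).const_sub 1).const_mul (2 : ℝ)
  have h3 : HasDerivAt Real.smoothTransition 2 (2 * (1 - β₀)) := by
    rw [h1]; exact hasDerivAt_smoothTransition_half
  exact (h3.comp β₀ h2).congr_deriv (by norm_num)

/-- The movie equation is regular on `α = radialProfile β`: where the movie is singular it passes
through a saddle, and the derivative in the direction of time does not vanish. -/
lemma exists_fderiv_movieEquation_ne_zero (hε : ε = 1 ∨ ε = -1) (hα₀ : 0 < α₀) (hβ₀ : 0 < β₀)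
    (hα : α₀ = radialProfile m β₀) (hm : bandMovie q m ε (radialLevel β₀) x₀ y₀ = 0) :
    ∃ v : C2, fderiv ℝ (radialEquation m α₀ β₀ (polarPoint α₀ x₀ β₀ y₀))
        (polarPoint α₀ x₀ β₀ y₀) v = 0 ∧
      fderiv ℝ (movieEquation q m ε x₀ β₀ y₀ (polarPoint α₀ x₀ β₀ y₀))
        (polarPoint α₀ x₀ β₀ y₀) v ≠ 0 := by
  have hpi := Real.pi_ne_zero
  rw [bandMovie] at hm
  obtain ⟨A, hA⟩ : ∃ A, A = Real.pi * (q * x₀ - (q * m + 2 * ε) * y₀) := ⟨_, rfl⟩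
  obtain ⟨B, hB⟩ : ∃ B, B = Real.pi * (x₀ - m * y₀) := ⟨_, rfl⟩
  obtain ⟨l, hl⟩ : ∃ l, l = radialLevel β₀ := ⟨_, rfl⟩
  rw [← hA, ← hB, ← hl] at hm
  have hsA := Real.sin_sq_add_cos_sq A
  have hsB := Real.sin_sq_add_cos_sq B
  by_cases h1 : (1 - l) * Real.cos A = 0
  · by_cases h2 : l * Real.cos B = 0
    · have hl0 : l ≠ 0 := by
        rintro rfl
        simp only [sub_zero, one_mul, zero_mul, add_zero] at h1 hm
        rw [h1, hm] at hsA
        norm_num at hsA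
      have hl1 : 1 - l ≠ 0 := by
        intro h
        have hl : l = 1 := by linarith
        rw [h, hl, zero_mul, zero_add, one_mul] at hm
        rw [hl, one_mul] at h2
        rw [h2, hm] at hsB
        norm_num at hsB
      have hcA := (mul_eq_zero.1 h1).resolve_left hl1
      have hcB := (mul_eq_zero.1 h2).resolve_left hl0
      rw [hcA] at hsA
      rw [hcB] at hsB
      have hhalf : l = 1 / 2 := by
        have : (1 - l) ^ 2 * (Real.sin A ^ 2 + 0 ^ 2) = l ^ 2 * (Real.sin B ^ 2 + 0 ^ 2) := by
          have h3 : (1 - l) * Real.sin A = -(l * Real.sin B) := by linarith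
          have := congrArg (· ^ 2) h3
          linear_combination this
        rw [hsA, hsB] at this
        linarith
      have hAB : Real.sin A = -Real.sin B := by rw [hhalf] at hm; linarith
      have hB0 : Real.sin B ≠ 0 := by
        intro h
        rw [h] at hsB
        norm_num at hsB
      have hR := ((contDiff_radialProfile m).differentiable (by simp) β₀).hasDerivAt
      obtain ⟨v, -, hv, hv'⟩ := exists_fderiv_eq_level (q := q) (ε := ε) (x₀ := x₀) (y₀ := y₀)
        hα₀ hβ₀ hα hR (hasDerivAt_radialLevel_of_half (hl ▸ hhalf))
      refine ⟨v, hv, ?_⟩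
      rw [hv', ← hA, ← hB, hAB]
      intro h
      apply hB0
      linarith
    · obtain ⟨v, hv, hv'⟩ := exists_fderiv_eq_turn_right (q := q) (m := m) (ε := ε) (x₀ := x₀)
        (y₀ := y₀) hε hα₀ hβ₀
      refine ⟨v, hv, ?_⟩
      rw [hv', ← hB, ← hl, mul_left_comm]
      exact mul_ne_zero hpi h2
  · obtain ⟨v, -, hv, hv'⟩ := exists_fderiv_eq_turn_left (q := q) (m := m) (ε := ε) (x₀ := x₀)
      (y₀ := y₀) hε hα₀ hβ₀
    refine ⟨v, hv, ?_⟩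
    rw [hv', ← hA, ← hl, mul_left_comm]
    exact mul_ne_zero hpi h1

lemma exists_isSliceChart_polarPoint (hq : Odd q) (hε : ε = 1 ∨ ε = -1) (hα₀ : 0 < α₀)
    (hβ₀ : 0 < β₀) (hP : polarPoint α₀ x₀ β₀ y₀ ∈ smoothBand q m ε) :
    ∃ φ, IsSliceChart (smoothBand q m ε) φ ∧ polarPoint α₀ x₀ β₀ y₀ ∈ φ.source := by
  have hU := isOpen_polarDomain (polarPoint α₀ x₀ β₀ y₀)
  have hPU := mem_polarDomain (x₀ := x₀) (y₀ := y₀) hα₀ hβ₀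
  have hf := contDiffOn_radialEquation m α₀ β₀ (polarPoint α₀ x₀ β₀ y₀)
  have hg := contDiffOn_movieEquation (q := q) (m := m) (ε := ε) x₀ β₀ y₀ (polarPoint α₀ x₀ β₀ y₀)
  have hmem := fun P hP => mem_smoothBand_iff_equations (q := q) (m := m) (ε := ε) hq hα₀ hβ₀
    (x₀ := x₀) (y₀ := y₀) (P := P) hP
  obtain ⟨hB, hα, hm⟩ := (polarPoint_mem_smoothBand hq hα₀ hβ₀ _ _).1 hP
  obtain ⟨w, -, hw, hw'⟩ := exists_fderiv_eq_modulus (q := q) (m := m) (ε := ε) (x₀ := x₀)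
    (y₀ := y₀) hα₀ hβ₀
  rw [B4, mem_closedBall_zero_iff] at hB
  rcases lt_or_eq_of_le hB with hlt | heq
  · obtain ⟨v, hv, hv'⟩ := exists_fderiv_movieEquation_ne_zero hε hα₀ hβ₀ hα hm
    exact exists_isSliceChart_interior hU hPU hlt hf hg hmem
      (linearIndependent_pair_of_apply (by rw [hw]; exact one_ne_zero) hw' hv')
  · -- at the boundary `β = 1`, and the movie is at its regular time `0`
    have hβ1 : β₀ = 1 := by
      have h1 := norm_polarPoint_sq α₀ x₀ β₀ y₀
      rw [heq] at h1
      rcases lt_or_ge β₀ (1 / 2) with h | h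
      · have h2 : α₀ ≤ 1 / 2 := by
          rw [hα, radialProfile]
          have := smoothProfile_le_one (m := m) (r := 2 * β₀) (by linarith) (by linarith)
          linarith
        nlinarith
      · rw [radialProfile_of_ge (by linarith)] at hα
        rw [hα] at h1
        nlinarith
    have hα1 : α₀ = 1 := by rw [hα, hβ1, radialProfile_of_ge (by norm_num)]
    have hl : radialLevel β₀ = 0 := by
      rw [radialLevel, hβ1, sub_self, mul_zero, Real.smoothTransition.zero]
    have hR : HasDerivAt (radialProfile m) 1 β₀ := by
      refine (hasDerivAt_id β₀).congr_of_eventuallyEq ?_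
      filter_upwards [lt_mem_nhds (show 3 / 8 < β₀ by rw [hβ1]; norm_num)] with β hβ
      exact radialProfile_of_ge hβ.le
    obtain ⟨v, hv, hv', -⟩ := exists_fderiv_eq_level (q := q) (ε := ε) (x₀ := x₀) (y₀ := y₀)
      hα₀ hβ₀ hα hR (contDiff_radialLevel.differentiable (by simp) β₀).hasDerivAt
    obtain ⟨u, hu, hu', hu''⟩ := exists_fderiv_eq_turn_left (q := q) (m := m) (ε := ε) (x₀ := x₀)
      (y₀ := y₀) hε hα₀ hβ₀
    refine exists_isSliceChart_boundary hU hPU hf hg hmem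
      (linearIndependent_triple_of_apply hu hu' ?_ (v := v) ?_ hv' (w := w) ?_)
    · rw [hu'', hl, sub_zero, one_mul]
      rw [bandMovie, hl, sub_zero, one_mul, zero_mul, add_zero] at hm
      refine mul_ne_zero Real.pi_ne_zero fun h => ?_
      have := Real.sin_sq_add_cos_sq (Real.pi * (q * x₀ - (q * m + 2 * ε) * y₀))
      rw [hm, h] at this
      norm_num at this
    · rw [hv, hα1, hβ1]
      norm_num
    · rw [hw]
      exact one_ne_zero

end AtPoint

lemma exists_isSliceChart_center {P : C2} (hP : P ∈ smoothBand q m ε)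
    (hP1 : ‖P 1‖ < (1 / 4) / √2) : ∃ φ, IsSliceChart (smoothBand q m ε) φ ∧ P ∈ φ.source := by
  have h2 : (0 : ℝ) < √2 := by positivity
  obtain ⟨c, hc⟩ : ∃ c : ℝ, c = (1 / 2) / √2 := ⟨_, rfl⟩
  have hc0 : 0 < c := by rw [hc]; positivity
  let F : C2 → ℂ := fun P => P 0 - (c : ℂ) * (P 1 / (c : ℂ)) ^ m
  have hF : ContDiff ℝ ∞ F :=
    (contDiff_coord 0).sub (contDiff_const.mul (((contDiff_coord 1).div_const _).pow m))
  have hre : ContDiff ℝ ∞ fun P => (F P).re := Complex.reCLM.contDiff.comp hF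
  have him : ContDiff ℝ ∞ fun P => (F P).im := Complex.imCLM.contDiff.comp hF
  have hmem : ∀ Q ∈ {Q : C2 | ‖Q 1‖ < (1 / 4) / √2}, Q ∈ smoothBand q m ε ↔
      Q ∈ B4 ∧ (F Q).re = 0 ∧ (F Q).im = 0 := by
    intro Q hQ
    have h3 := mem_smoothBand_of_norm_lt (q := q) (m := m) (ε := ε) hQ
    rw [← hc, ← sub_eq_zero] at h3
    have h4 : F Q = 0 ↔ (F Q).re = 0 ∧ (F Q).im = 0 := Complex.ext_iff
    exact ⟨fun h => ⟨smoothBand_subset h, h4.1 (h3.1 h)⟩, fun h => h3.2 (h4.2 h.2)⟩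
  have hnorm : ‖P‖ < 1 := by
    have h3 := (mem_smoothBand_of_norm_lt hP1).1 hP
    rw [← hc] at h3
    have h4 : ‖P 1‖ ≤ c := by
      refine hP1.le.trans ?_
      rw [hc]
      gcongr
      norm_num
    have h5 : ‖P 0‖ ≤ c := by
      rw [h3, norm_mul, norm_pow, norm_div, Complex.norm_real, Real.norm_of_nonneg hc0.le]
      refine mul_le_of_le_one_right hc0.le (pow_le_one₀ (by positivity) ?_)
      exact div_le_one_of_le₀ h4 hc0.le
    have h6 : c ^ 2 = 1 / 8 := by
      rw [hc, div_pow, Real.sq_sqrt (by norm_num)]; norm_num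
    have h7 := C2.norm_sq P
    nlinarith [norm_nonneg (P 0), norm_nonneg (P 1), norm_nonneg P]
  have hvel : ∀ z : ℂ, ∃ v : C2, fderiv ℝ (fun P => (F P).re) P v = z.re ∧
      fderiv ℝ (fun P => (F P).im) P v = z.im := by
    intro z
    have hκ0 : (!₂[P 0 + ((0 : ℝ) : ℂ) * z, P 1] : C2) = P := by
      ext i
      fin_cases i <;> simp
    have hline : DifferentiableAt ℝ (fun t : ℝ => P 0 + (t : ℂ) * z) 0 :=
      (differentiableAt_const _).add (Complex.ofRealCLM.differentiableAt.mul_const z)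
    have hκ : DifferentiableAt ℝ (fun t : ℝ => (!₂[P 0 + (t : ℂ) * z, P 1] : C2)) 0 :=
      differentiableAt_C2 hline (differentiableAt_const _)
    obtain ⟨v, hv⟩ := exists_velocity hκ
    simp only [hκ0] at hv
    have hF' : ∀ t : ℝ, F !₂[P 0 + (t : ℂ) * z, P 1] = F P + t * z := by
      intro t
      change P 0 + (t : ℂ) * z - (c : ℂ) * (P 1 / (c : ℂ)) ^ m =
        P 0 - (c : ℂ) * (P 1 / (c : ℂ)) ^ m + t * z
      ring
    have hlin : ∀ x v : ℝ, HasDerivAt (fun t => x + t * v) v 0 := fun x v => by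
      simpa using ((hasDerivAt_id (0 : ℝ)).mul_const v).const_add x
    refine ⟨v, hv _ _ (hre.differentiable (by simp) P) ?_,
      hv _ _ (him.differentiable (by simp) P) ?_⟩
    · simp only [hF', Complex.add_re, Complex.re_ofReal_mul]
      exact hlin _ _
    · simp only [hF', Complex.add_im, Complex.im_ofReal_mul]
      exact hlin _ _
  obtain ⟨v, hv, hv'⟩ := hvel 1
  obtain ⟨w, -, hw'⟩ := hvel Complex.I
  refine exists_isSliceChart_interior (U := {Q : C2 | ‖Q 1‖ < (1 / 4) / √2})
    (isOpen_lt (by fun_prop) continuous_const) hP1 hnorm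
    hre.contDiffOn him.contDiffOn hmem (linearIndependent_pair_of_apply (v := v) (w := w) ?_ ?_ ?_)
  · rw [hv]; simp
  · rw [hv']; simp
  · rw [hw']; simp

lemma isProperSurface_smoothBand (hq : Odd q) (hε : ε = 1 ∨ ε = -1) :
    IsProperSurface (smoothBand q m ε) where
  compact := isCompact_of_isMobiusBand (isMobiusBand_smoothBand hq hε)
  connected := isConnected_of_isMobiusBand (isMobiusBand_smoothBand hq hε)
  subset := smoothBand_subset
  chart P hP := by
    by_cases h1 : ‖P 1‖ < (1 / 4) / √2
    · exact exists_isSliceChart_center hP h1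
    · have h1' : P 1 ≠ 0 := by
        intro h
        rw [h, norm_zero] at h1
        exact h1 (by positivity)
      obtain ⟨α, x, β, y, hα, hβ, rfl⟩ := exists_polarPoint (ne_zero_of_mem_smoothBand hP h1') h1'
      exact exists_isSliceChart_polarPoint hq hε hα hβ hP

end ProperSurface

/-! ### A moving frame that is reversed along a loop -/

section Frame

open Topology

variable {S : Set C2} {φ ψ : OpenPartialHomeomorph C2 (Fin 4 → ℝ)} {x v w : C2}

/-- `v` is the velocity of a curve in `S` that starts at `x`. -/
def IsVelocity (S : Set C2) (x v : C2) : Prop :=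
  ∃ δ : ℝ → C2, (∀ᶠ t in 𝓝[≥] (0 : ℝ), δ t ∈ S) ∧ δ 0 = x ∧ HasDerivAt δ v 0

/-- The determinant of two tangent vectors of `S` in the coordinates `y₀, y₁` of a slice chart. -/
noncomputable def frameDet (φ : OpenPartialHomeomorph C2 (Fin 4 → ℝ)) (x v w : C2) : ℝ :=
  fderiv ℝ φ x v 0 * fderiv ℝ φ x w 1 - fderiv ℝ φ x v 1 * fderiv ℝ φ x w 0

namespace IsSliceChart

lemma fderiv_apply_eq_zero (hφ : IsSliceChart S φ) (hx : x ∈ φ.source) (hv : IsVelocity S x v) :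
    fderiv ℝ φ x v 2 = 0 ∧ fderiv ℝ φ x v 3 = 0 := by
  obtain ⟨δ, hS, rfl, hδ⟩ := hv
  have h1 := ((hφ.contDiffAt hx).differentiableAt (by simp)).hasFDerivAt.comp_hasDerivAt 0 hδ
  exact hφ.deriv_normal_eq_zero hS hx hδ.continuousAt.continuousWithinAt h1.hasDerivWithinAt

lemma fderiv_injective (hφ : IsSliceChart S φ) (hx : x ∈ φ.source) (hv : fderiv ℝ φ x v = 0) :
    v = 0 := by
  have h1 := ((hφ.contDiffAt hx).differentiableAt (by simp)).hasFDerivAt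
  have h2 := ((hφ.contDiffAt_symm (φ.map_source hx)).differentiableAt (by simp)).hasFDerivAt
  have h3 := (h2.comp x h1).congr_of_eventuallyEq
    (show id =ᶠ[𝓝 x] φ.symm ∘ φ from by
      filter_upwards [φ.open_source.mem_nhds hx] with y hy
      exact (φ.left_inv hy).symm)
  have h4 := DFunLike.congr_fun (h3.unique (hasFDerivAt_id x)) v
  rw [ContinuousLinearMap.comp_apply, hv, map_zero] at h4
  exact h4.symm

lemma fderiv_eq_transitionMap (hφ : IsSliceChart S φ) (hψ : IsSliceChart S ψ) (h1 : x ∈ φ.source)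
    (h2 : x ∈ ψ.source) : fderiv ℝ ψ x = (transitionMap φ ψ x).comp (fderiv ℝ φ x) := by
  have d1 := ((hφ.contDiffAt h1).differentiableAt (by simp)).hasFDerivAt
  have d2 := hφ.hasFDerivAt_transition hψ h1 h2
  refine HasFDerivAt.fderiv ((d2.comp x d1).congr_of_eventuallyEq ?_)
  filter_upwards [φ.open_source.mem_nhds h1] with y hy
  simp [φ.left_inv hy]

lemma frameDet_eq_transitionDet_mul (hφ : IsSliceChart S φ) (hψ : IsSliceChart S ψ)
    (h1 : x ∈ φ.source) (h2 : x ∈ ψ.source) (hv : IsVelocity S x v) (hw : IsVelocity S x w) :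
    frameDet ψ x v w = transitionDet φ ψ x * frameDet φ x v w := by
  have key : ∀ {v}, IsVelocity S x v → ∀ i, fderiv ℝ ψ x v i =
      fderiv ℝ φ x v 0 * transitionMap φ ψ x (Pi.single 0 1) i +
        fderiv ℝ φ x v 1 * transitionMap φ ψ x (Pi.single 1 1) i := by
    intro v hv i
    obtain ⟨hv2, hv3⟩ := hφ.fderiv_apply_eq_zero h1 hv
    have h3 : fderiv ℝ φ x v = fderiv ℝ φ x v 0 • (Pi.single 0 1 : Fin 4 → ℝ) +
        fderiv ℝ φ x v 1 • (Pi.single 1 1 : Fin 4 → ℝ) := by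
      ext k
      fin_cases k <;> simp [hv2, hv3]
    rw [hφ.fderiv_eq_transitionMap hψ h1 h2, ContinuousLinearMap.comp_apply]
    nth_rewrite 1 [h3]
    rw [map_add, map_smul, map_smul]
    rfl
  rw [frameDet, key hv, key hv, key hw, key hw, transitionDet_eq, Matrix.det_fin_two, frameDet]
  simp only [Matrix.of_apply]
  change _ = (transitionMap φ ψ x (Pi.single 0 1) 0 * transitionMap φ ψ x (Pi.single 1 1) 1 -
    transitionMap φ ψ x (Pi.single 1 1) 0 * transitionMap φ ψ x (Pi.single 0 1) 1) * _
  ring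

lemma frameDet_ne_zero (hφ : IsSliceChart S φ) (hx : x ∈ φ.source) (hv : IsVelocity S x v)
    (hw : IsVelocity S x w) (hind : ∀ a b : ℝ, a • v + b • w = 0 → a = 0 ∧ b = 0) :
    frameDet φ x v w ≠ 0 := by
  intro h
  rw [frameDet] at h
  obtain ⟨hv2, hv3⟩ := hφ.fderiv_apply_eq_zero hx hv
  obtain ⟨hw2, hw3⟩ := hφ.fderiv_apply_eq_zero hx hw
  have key : ∀ a b : ℝ, a * fderiv ℝ φ x v 0 + b * fderiv ℝ φ x w 0 = 0 →
      a * fderiv ℝ φ x v 1 + b * fderiv ℝ φ x w 1 = 0 → a = 0 ∧ b = 0 := by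
    intro a b h0 h1
    refine hind a b (hφ.fderiv_injective hx ?_)
    rw [map_add, map_smul, map_smul]
    ext k
    fin_cases k
    · exact h0
    · exact h1
    · simp [hv2, hw2]
    · simp [hv3, hw3]
  obtain ⟨h1, h2⟩ := key (fderiv ℝ φ x w 1) (-fderiv ℝ φ x v 1) (by linarith) (by ring)
  obtain ⟨h3, h4⟩ := key (fderiv ℝ φ x w 0) (-fderiv ℝ φ x v 0) (by ring) (by linarith)
  have h5 := key 1 0 (by linarith) (by linarith)
  exact one_ne_zero h5.1

lemma continuousAt_frameDet (hφ : IsSliceChart S φ) {c T N : ℝ → C2} {t : ℝ}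
    (hx : c t ∈ φ.source) (hc : ContinuousAt c t) (hT : ContinuousAt T t)
    (hN : ContinuousAt N t) : ContinuousAt (fun t => frameDet φ (c t) (T t) (N t)) t := by
  have h1 : ContinuousAt (fderiv ℝ φ) (c t) :=
    ((hφ.contDiffAt hx).fderiv_right (m := 0) (by simp)).continuousAt
  have h2 : ContinuousAt (fun t => fderiv ℝ φ (c t)) t := h1.comp (f := c) hc
  have key : ∀ {V : ℝ → C2}, ContinuousAt V t → ∀ i : Fin 4,
      ContinuousAt (fun t => fderiv ℝ φ (c t) (V t) i) t := fun hV i =>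
    (continuous_apply i).continuousAt.comp (h2.clm_apply hV)
  exact ((key hT 0).mul (key hN 1)).sub ((key hT 1).mul (key hN 0))

end IsSliceChart

/-- A surface is nonorientable if it contains a closed curve with a frame of tangent vectors along
it that is orientation-reversed after one turn. -/
lemma not_isOrientable_of_frame {c T N : ℝ → C2} (hc : Continuous c) (hT : Continuous T)
    (hN : Continuous N) (hS : ∀ t, c t ∈ S) (hTv : ∀ t, IsVelocity S (c t) (T t))
    (hNv : ∀ t, IsVelocity S (c t) (N t))
    (hind : ∀ (t a b : ℝ), a • T t + b • N t = 0 → a = 0 ∧ b = 0)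
    (hc1 : c 1 = c 0) (hT1 : T 1 = T 0) (hN1 : N 1 = -N 0) : ¬ IsOrientable S := by
  rintro ⟨A, hA, hcov, hpos⟩
  have hne : ∀ φ ∈ A, ∀ t, c t ∈ φ.source → frameDet φ (c t) (T t) (N t) ≠ 0 :=
    fun φ hφ t ht => (hA φ hφ).frameDet_ne_zero ht (hTv t) (hNv t) (hind t)
  have hcont : ∀ φ ∈ A, ∀ t, c t ∈ φ.source →
      ContinuousAt (fun t => frameDet φ (c t) (T t) (N t)) t := fun φ hφ t ht =>
    (hA φ hφ).continuousAt_frameDet ht hc.continuousAt hT.continuousAt hN.continuousAt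
  have hopen : ∀ φ ∈ A, ∀ t, c t ∈ φ.source → ∀ᶠ t in 𝓝 t, c t ∈ φ.source := fun φ _ t ht =>
    hc.continuousAt.eventually (φ.open_source.mem_nhds ht)
  -- the times at which the frame is positive
  let E : Set ℝ := {t | ∃ φ ∈ A, c t ∈ φ.source ∧ 0 < frameDet φ (c t) (T t) (N t)}
  have hE : ∀ φ ∈ A, ∀ t, c t ∈ φ.source → (t ∈ E ↔ 0 < frameDet φ (c t) (T t) (N t)) := by
    intro φ hφ t ht
    constructor
    · rintro ⟨ψ, hψ, ht', h⟩
      rw [(hA ψ hψ).frameDet_eq_transitionDet_mul (hA φ hφ) ht' ht (hTv t) (hNv t)]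
      exact mul_pos (hpos ψ hψ φ hφ _ (hS t) ht' ht) h
    · exact fun h => ⟨φ, hφ, ht, h⟩
  have hclopen : IsClopen E := by
    constructor
    · rw [← isOpen_compl_iff, isOpen_iff_mem_nhds]
      intro t ht
      obtain ⟨φ, hφ, htφ⟩ := hcov _ (hS t)
      rw [Set.mem_compl_iff, hE φ hφ t htφ, not_lt] at ht
      have hlt := lt_of_le_of_ne ht (hne φ hφ t htφ)
      filter_upwards [(hcont φ hφ t htφ).eventually (gt_mem_nhds hlt),
        hopen φ hφ t htφ] with s hs hs'
      rw [Set.mem_compl_iff, hE φ hφ s hs', not_lt]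
      exact hs.le
    · rw [isOpen_iff_mem_nhds]
      intro t ht
      obtain ⟨φ, hφ, htφ⟩ := hcov _ (hS t)
      rw [hE φ hφ t htφ] at ht
      filter_upwards [(hcont φ hφ t htφ).eventually (lt_mem_nhds ht),
        hopen φ hφ t htφ] with s hs hs'
      rwa [hE φ hφ s hs']
  obtain ⟨φ, hφ, h0⟩ := hcov _ (hS 0)
  have h1 : c 1 ∈ φ.source := by rwa [hc1]
  have hflip : frameDet φ (c 1) (T 1) (N 1) = -frameDet φ (c 0) (T 0) (N 0) := by
    rw [hc1, hT1, hN1, frameDet, frameDet, map_neg]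
    simp only [Pi.neg_apply]
    ring
  have e0 := hE φ hφ 0 h0
  have e1 := hE φ hφ 1 h1
  rw [hflip] at e1
  have hn := hne φ hφ 0 h0
  rcases isClopen_iff.1 hclopen with h | h
  · rw [h] at e0 e1
    simp only [Set.mem_empty_iff_false, false_iff, not_lt] at e0 e1
    exact hn (le_antisymm e0 (by linarith))
  · rw [h] at e0 e1
    simp only [Set.mem_univ, true_iff] at e0 e1
    linarith

end Frame

/-! ### The surface is nonorientable -/

section Nonorientable

open Topology

lemma hasDerivAt_radius_half : HasDerivAt radius (-(1 / 4)) (1 / 2) := by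
  have hu : timeInv (1 / 2) = 1 / 2 := by
    have h := exists_smoothTransition_inverse.choose_spec.2.1 (1 / 2) (by norm_num)
    rwa [smoothTransition_half] at h
  have h1 : HasDerivAt timeInv (2 : ℝ)⁻¹ (1 / 2) := by
    refine HasDerivAt.of_local_left_inverse (f := Real.smoothTransition)
      exists_smoothTransition_inverse.choose_spec.1.continuousAt ?_ two_ne_zero ?_
    · rw [hu]; exact hasDerivAt_smoothTransition_half
    · filter_upwards [Icc_mem_nhds (show (0 : ℝ) < 1 / 2 by norm_num)
        (show (1 / 2 : ℝ) < 1 by norm_num)] with l hl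
      exact (exists_smoothTransition_inverse.choose_spec.2.2 l hl).2
  exact ((h1.div_const 2).const_sub 1).congr_deriv (by norm_num)

lemma radius_half : radius (1 / 2) = 3 / 4 := by
  have h := exists_smoothTransition_inverse.choose_spec.2.1 (1 / 2) (by norm_num)
  rw [smoothTransition_half] at h
  rw [radius, timeInv, h]
  norm_num

/-- The velocity of a curve at the point with coordinates `(ρ, x, y)`, in terms of the velocities
of the coordinates. -/
noncomputable def torusVelocity (ρ x y ρ' x' y' : ℝ) : C2 :=
  !₂[(((ρ' / √2 : ℝ) : ℂ) + ((ρ / √2 * (2 * Real.pi * x') : ℝ) : ℂ) * Complex.I) *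
      Complex.exp ((2 * Real.pi * x : ℝ) * Complex.I),
    (((ρ' / √2 : ℝ) : ℂ) + ((ρ / √2 * (2 * Real.pi * y') : ℝ) : ℂ) * Complex.I) *
      Complex.exp ((2 * Real.pi * y : ℝ) * Complex.I)]

lemma hasDerivAt_C2 {κ : ℝ → C2} {v : C2} {t : ℝ} (h0 : HasDerivAt (fun t => κ t 0) (v 0) t)
    (h1 : HasDerivAt (fun t => κ t 1) (v 1) t) : HasDerivAt κ v t := by
  rw [hasDerivAt_iff_hasFDerivAt, ← hasFDerivWithinAt_univ, hasFDerivWithinAt_piLp]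
  intro i
  rw [hasFDerivWithinAt_univ]
  fin_cases i
  · exact h0.hasFDerivAt.congr_fderiv (by ext; rfl)
  · exact h1.hasFDerivAt.congr_fderiv (by ext; rfl)

lemma hasDerivAt_torusPoint {a x y : ℝ → ℝ} {a' x' y' t : ℝ} (ha : HasDerivAt a a' t)
    (hx : HasDerivAt x x' t) (hy : HasDerivAt y y' t) :
    HasDerivAt (fun t => torusPoint (a t) (x t) (y t))
      (torusVelocity (a t) (x t) (y t) a' x' y') t := by
  have key : ∀ {x : ℝ → ℝ} {x' : ℝ}, HasDerivAt x x' t → HasDerivAt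
      (fun t => ((a t / √2 : ℝ) : ℂ) * Complex.exp ((2 * Real.pi * x t : ℝ) * Complex.I))
      ((((a' / √2 : ℝ) : ℂ) + ((a t / √2 * (2 * Real.pi * x') : ℝ) : ℂ) * Complex.I) *
        Complex.exp ((2 * Real.pi * x t : ℝ) * Complex.I)) t := by
    intro x x' hx
    have h1 := (ha.div_const √2).ofReal_comp
    have h2 := ((hx.const_mul (2 * Real.pi)).ofReal_comp.mul_const Complex.I).cexp
    refine (h1.mul h2).congr_deriv ?_
    push_cast
    ring
  exact hasDerivAt_C2 (key hx) (key hy)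

lemma continuous_torusVelocity {ρ x y ρ' x' y' : ℝ → ℝ} (hρ : Continuous ρ) (hx : Continuous x)
    (hy : Continuous y) (hρ' : Continuous ρ') (hx' : Continuous x') (hy' : Continuous y') :
    Continuous fun t => torusVelocity (ρ t) (x t) (y t) (ρ' t) (x' t) (y' t) := by
  unfold torusVelocity
  refine (PiLp.continuous_toLp 2 _).comp (continuous_pi fun i => ?_)
  fin_cases i
  · change Continuous fun t => (((ρ' t / √2 : ℝ) : ℂ) +
      ((ρ t / √2 * (2 * Real.pi * x' t) : ℝ) : ℂ) * Complex.I) *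
        Complex.exp ((2 * Real.pi * x t : ℝ) * Complex.I)
    fun_prop
  · change Continuous fun t => (((ρ' t / √2 : ℝ) : ℂ) +
      ((ρ t / √2 * (2 * Real.pi * y' t) : ℝ) : ℂ) * Complex.I) *
        Complex.exp ((2 * Real.pi * y t : ℝ) * Complex.I)
    fun_prop

lemma torusVelocity_add_int (ρ x y ρ' x' y' : ℝ) (i j : ℤ) :
    torusVelocity ρ (x + i) (y + j) ρ' x' y' = torusVelocity ρ x y ρ' x' y' := by
  rw [torusVelocity, torusVelocity, ← (exp_two_pi_eq_iff x (x + i)).2 ⟨i, rfl⟩,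
    ← (exp_two_pi_eq_iff y (y + j)).2 ⟨j, rfl⟩]

lemma smul_add_smul_torusVelocity (ρ x y ρ' x' y' ρ'' x'' y'' a b : ℝ) :
    a • torusVelocity ρ x y ρ' x' y' + b • torusVelocity ρ x y ρ'' x'' y'' =
      torusVelocity ρ x y (a * ρ' + b * ρ'') (a * x' + b * x'') (a * y' + b * y'') := by
  ext i
  fin_cases i
  · simp only [torusVelocity, Fin.zero_eta, PiLp.add_apply, PiLp.smul_apply, Complex.real_smul,
      PiLp.toLp_apply, Matrix.cons_val_zero]
    push_cast
    ring
  · simp only [torusVelocity, Fin.mk_one, PiLp.add_apply, PiLp.smul_apply, Complex.real_smul,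
      PiLp.toLp_apply, Matrix.cons_val_one]
    push_cast
    ring

lemma torusVelocity_eq_zero {ρ x y ρ' x' y' : ℝ} (hρ : 0 < ρ)
    (h : torusVelocity ρ x y ρ' x' y' = 0) : ρ' = 0 ∧ x' = 0 ∧ y' = 0 := by
  have key : ∀ {x x' : ℝ}, (((ρ' / √2 : ℝ) : ℂ) + ((ρ / √2 * (2 * Real.pi * x') : ℝ) : ℂ) *
      Complex.I) * Complex.exp ((2 * Real.pi * x : ℝ) * Complex.I) = 0 → ρ' = 0 ∧ x' = 0 := by
    intro x x' h
    have h1 := (mul_eq_zero.1 h).resolve_right (Complex.exp_ne_zero _)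
    have hre := congrArg Complex.re h1
    have him := congrArg Complex.im h1
    rw [Complex.add_re, Complex.ofReal_re, Complex.re_ofReal_mul, Complex.I_re, mul_zero, add_zero,
      Complex.zero_re] at hre
    rw [Complex.add_im, Complex.ofReal_im, Complex.im_ofReal_mul, Complex.I_im, mul_one, zero_add,
      Complex.zero_im] at him
    have h2 : √2 ≠ 0 := by positivity
    refine ⟨(div_eq_zero_iff.1 hre).resolve_right h2, ?_⟩
    have h3 := (mul_eq_zero.1 him).resolve_left (by positivity)
    exact (mul_eq_zero.1 h3).resolve_left (by positivity)
  have h0 := key (congrArg (fun P : C2 => P 0) h)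
  have h1 := key (congrArg (fun P : C2 => P 1) h)
  exact ⟨h0.1, h0.2, h1.2⟩

variable {q m : ℕ} {ε : ℤ}

/-- The velocity of a curve through `slopePoint q m ε (1 / 2) A B`, in terms of the velocities of
the radius and of `A`, `B`. -/
noncomputable def slopeVelocity (q m : ℕ) (ε : ℤ) (A B ρ' A' B' : ℝ) : C2 :=
  torusVelocity (3 / 4) (B + m * slopeY q ε A B) (slopeY q ε A B) ρ' (B' + m * slopeY q ε A' B')
    (slopeY q ε A' B')

lemma hasDerivAt_slopePoint {l A B : ℝ → ℝ} {l' A' B' t : ℝ} (hl : HasDerivAt l l' t)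
    (hA : HasDerivAt A A' t) (hB : HasDerivAt B B' t) (hlt : l t = 1 / 2) :
    HasDerivAt (fun t => slopePoint q m ε (l t) (A t) (B t))
      (slopeVelocity q m ε (A t) (B t) (-(1 / 4) * l') A' B') t := by
  have hr : HasDerivAt (fun t => radius (l t)) (-(1 / 4) * l') t := by
    refine HasDerivAt.comp (h₂ := radius) t ?_ hl
    rw [hlt]
    exact hasDerivAt_radius_half
  have hY : HasDerivAt (fun t => slopeY q ε (A t) (B t)) (slopeY q ε A' B') t :=
    (((hB.const_mul (q : ℝ)).sub hA).const_mul (ε : ℝ)).div_const 2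
  have := hasDerivAt_torusPoint hr (hB.add (hY.const_mul (m : ℝ))) hY
  simp only [hlt, radius_half] at this
  exact this

lemma slopeVelocity_eq_zero (hε : ε = 1 ∨ ε = -1) {A B ρ' A' B' : ℝ}
    (h : slopeVelocity q m ε A B ρ' A' B' = 0) : ρ' = 0 ∧ A' = 0 ∧ B' = 0 := by
  obtain ⟨h1, h2, h3⟩ := torusVelocity_eq_zero (by norm_num) h
  have hB : B' = 0 := by rwa [h3, mul_zero, add_zero] at h2
  have hA := slope_eq (q := q) (m := m) hε A' B'
  rw [h3, hB, mul_zero, mul_zero, add_zero, mul_zero, sub_zero] at hA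
  exact ⟨h1, hA.symm, hB⟩

lemma smul_add_smul_slopeVelocity (A B ρ' A' B' ρ'' A'' B'' a b : ℝ) :
    a • slopeVelocity q m ε A B ρ' A' B' + b • slopeVelocity q m ε A B ρ'' A'' B'' =
      slopeVelocity q m ε A B (a * ρ' + b * ρ'') (a * A' + b * A'') (a * B' + b * B'') := by
  have hY : slopeY q ε (a * A' + b * A'') (a * B' + b * B'') =
      a * slopeY q ε A' B' + b * slopeY q ε A'' B'' := by
    unfold slopeY
    ring
  rw [slopeVelocity, slopeVelocity, smul_add_smul_torusVelocity, slopeVelocity, hY]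
  congr 1
  ring

lemma slopeVelocity_add_one (hq : Odd q) (A B ρ' A' B' : ℝ) :
    slopeVelocity q m ε (A + 1) (B + 1) ρ' A' B' = slopeVelocity q m ε A B ρ' A' B' := by
  obtain ⟨k, hk⟩ := hq
  have hY : slopeY q ε (A + 1) (B + 1) = slopeY q ε A B + (ε * k : ℤ) := by
    unfold slopeY
    rw [hk]
    push_cast
    ring
  have hX : B + 1 + m * slopeY q ε (A + 1) (B + 1) =
      B + m * slopeY q ε A B + (1 + m * (ε * k) : ℤ) := by
    rw [hY]
    push_cast
    ring
  rw [slopeVelocity, hX, hY, torusVelocity_add_int, slopeVelocity]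

lemma continuous_slopeVelocity {A B ρ' A' B' : ℝ → ℝ} (hA : Continuous A) (hB : Continuous B)
    (hρ' : Continuous ρ') (hA' : Continuous A') (hB' : Continuous B') :
    Continuous fun t => slopeVelocity q m ε (A t) (B t) (ρ' t) (A' t) (B' t) := by
  have hY : ∀ {A B : ℝ → ℝ}, Continuous A → Continuous B →
      Continuous fun t => slopeY q ε (A t) (B t) := by
    intro A B hA hB
    unfold slopeY
    fun_prop
  exact continuous_torusVelocity continuous_const (hB.add (continuous_const.mul (hY hA hB)))
    (hY hA hB) hρ' (hB'.add (continuous_const.mul (hY hA' hB'))) (hY hA' hB')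

/-- A transverse curve in the shell: with `a = t + s` and `b = t - s`, `tan (πs) = v sin (πt)`, the
equation `(1 - l) sin (πa) = l sin (πb)` holds for `l = (1 + v cos (πt)) / 2`. -/
lemma normalCurve_mem (hε : ε = 1 ∨ ε = -1) {v : ℝ} (hv : |v| ≤ 1) (t : ℝ) :
    slopePoint q m ε ((1 + v * Real.cos (Real.pi * t)) / 2)
      (t + Real.arctan (v * Real.sin (Real.pi * t)) / Real.pi)
      (t - Real.arctan (v * Real.sin (Real.pi * t)) / Real.pi + 1) ∈ bandShell q m ε := by
  have hpi := Real.pi_pos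
  have h1 : |v * Real.cos (Real.pi * t)| ≤ 1 := by
    rw [abs_mul]
    exact mul_le_one₀ hv (abs_nonneg _) (Real.abs_cos_le_one _)
  rw [abs_le] at h1
  refine slopePoint_mem hε ⟨by linarith, by linarith⟩ ?_
  obtain ⟨s, hs⟩ : ∃ s, s = Real.arctan (v * Real.sin (Real.pi * t)) := ⟨_, rfl⟩
  have htan : Real.sin s = v * Real.sin (Real.pi * t) * Real.cos s := by
    have h2 := Real.tan_arctan (v * Real.sin (Real.pi * t))
    have h3 : Real.cos s ≠ 0 := by rw [hs]; exact (Real.cos_arctan_pos _).ne'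
    rw [← hs, Real.tan_eq_sin_div_cos, div_eq_iff h3] at h2
    exact h2
  rw [← hs, mul_add, mul_sub, mul_div_cancel₀ _ hpi.ne', Real.sin_add, Real.sin_sub]
  linear_combination Real.cos (Real.pi * t) * htan

/-- The surface is not orientable: the frame `∂/∂t, ∂/∂v` of `normalCurve_mem` along the core curve
`v = 0` is reversed after one turn. -/
lemma not_isOrientable_smoothBand (hq : Odd q) (hε : ε = 1 ∨ ε = -1) :
    ¬ IsOrientable (smoothBand q m ε) := by
  have hpi := Real.pi_pos
  have hsub : bandShell q m ε ⊆ smoothBand q m ε := Set.subset_union_left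
  have hmem : ∀ t, slopePoint q m ε (1 / 2) t (t + 1) ∈ bandShell q m ε := fun t =>
    slopePoint_mem hε (by norm_num) (by norm_num)
  have hcore : ∀ t, HasDerivAt (fun t => slopePoint q m ε (1 / 2) t (t + 1))
      (slopeVelocity q m ε t (t + 1) 0 1 1) t := by
    intro t
    have := hasDerivAt_slopePoint (q := q) (m := m) (ε := ε) (hasDerivAt_const t (1 / 2 : ℝ))
      (hasDerivAt_id t) ((hasDerivAt_id t).add_const 1) rfl
    rwa [mul_zero] at this
  refine not_isOrientable_of_frame (c := fun t => slopePoint q m ε (1 / 2) t (t + 1))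
    (T := fun t => slopeVelocity q m ε t (t + 1) 0 1 1)
    (N := fun t => slopeVelocity q m ε t (t + 1) (-(1 / 4) * (Real.cos (Real.pi * t) / 2))
      (Real.sin (Real.pi * t) / Real.pi) (-(Real.sin (Real.pi * t) / Real.pi)))
    (continuous_iff_continuousAt.2 fun t => (hcore t).continuousAt)
    (continuous_slopeVelocity (by fun_prop) (by fun_prop) (by fun_prop) (by fun_prop) (by fun_prop))
    (continuous_slopeVelocity (by fun_prop) (by fun_prop) (by fun_prop) (by fun_prop) (by fun_prop))
    (fun t => hsub (hmem t)) (fun t => ?_) (fun t => ?_) (fun t a b h => ?_) ?_ ?_ ?_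
  · refine ⟨fun s => slopePoint q m ε (1 / 2) (t + s) (t + s + 1),
      Filter.Eventually.of_forall fun s => hsub (hmem _), by simp, ?_⟩
    refine HasDerivAt.comp_const_add (f := fun t => slopePoint q m ε (1 / 2) t (t + 1)) t 0 ?_
    rw [add_zero]
    exact hcore t
  · refine ⟨fun v => slopePoint q m ε ((1 + v * Real.cos (Real.pi * t)) / 2)
      (t + Real.arctan (v * Real.sin (Real.pi * t)) / Real.pi)
      (t - Real.arctan (v * Real.sin (Real.pi * t)) / Real.pi + 1), ?_, by simp, ?_⟩
    · refine Filter.Eventually.filter_mono nhdsWithin_le_nhds ?_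
      filter_upwards [Icc_mem_nhds (show (-1 : ℝ) < 0 by norm_num) zero_lt_one] with v hv
      exact hsub (normalCurve_mem hε (abs_le.2 hv) t)
    · have hlin : ∀ d : ℝ, HasDerivAt (fun v => v * d) d 0 := fun d => by
        simpa using (hasDerivAt_id (0 : ℝ)).mul_const d
      have harc : HasDerivAt (fun v => Real.arctan (v * Real.sin (Real.pi * t)) / Real.pi)
          (Real.sin (Real.pi * t) / Real.pi) 0 := by
        refine ((hlin (Real.sin (Real.pi * t))).arctan.div_const Real.pi).congr_deriv ?_
        simp
      have := hasDerivAt_slopePoint (q := q) (m := m) (ε := ε)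
        (((hlin (Real.cos (Real.pi * t))).const_add 1).div_const 2) (harc.const_add t)
        ((harc.const_sub t).add_const 1) (by simp)
      simpa using this
  · rw [smul_add_smul_slopeVelocity] at h
    obtain ⟨h1, h2, h3⟩ := slopeVelocity_eq_zero hε h
    have ha : a = 0 := by linarith
    have h4 : b * Real.cos (Real.pi * t) = 0 := by linarith
    have h5 : b * Real.sin (Real.pi * t) = 0 := by
      rw [ha] at h2
      field_simp at h2
      linarith
    have h6 : b * b = 0 := by
      have h7 := Real.sin_sq_add_cos_sq (Real.pi * t)
      linear_combination b * Real.cos (Real.pi * t) * h4 + b * Real.sin (Real.pi * t) * h5 -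
        b * b * h7
    exact ⟨ha, mul_self_eq_zero.1 h6⟩
  · refine (slopePoint_eq_iff hq hε (by norm_num) (by norm_num) _ _ _ _).2
      ⟨rfl, -1, -1, by decide, by norm_num, by norm_num⟩
  · have := slopeVelocity_add_one (m := m) (ε := ε) hq 0 (0 + 1) 0 1 1
    rwa [zero_add] at this ⊢
  · have h1 := slopeVelocity_add_one (m := m) (ε := ε) hq 0 (0 + 1) (1 / 8) 0 0
    have h2 := smul_add_smul_slopeVelocity (q := q) (m := m) (ε := ε) 0 (0 + 1) (-(1 / 8)) 0 0
      0 0 0 (-1) 0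
    simp only [mul_one, mul_zero, Real.cos_pi, Real.sin_pi, Real.cos_zero, Real.sin_zero, zero_div,
      neg_zero, zero_add] at h1 h2 ⊢
    rw [zero_smul, add_zero, neg_smul, one_smul] at h2
    norm_num at h1 h2 ⊢
    rw [h1, h2]

end Nonorientable

/-! ### The nonorientable 4-genus and the recognition of `T(am ± 2, a)` -/

section Genus

variable {p q m : ℕ} {ε : ℤ}

lemma bettiOne_smoothBand (hq : Odd q) (hε : ε = 1 ∨ ε = -1) :
    bettiOne (smoothBand q m ε) = 1 := by
  obtain ⟨e⟩ := isMobiusBand_smoothBand (m := m) hq hε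
  obtain ⟨C⟩ := exists_mobiusCover e
  exact le_antisymm C.bettiOne_le_one
    (one_le_bettiOne (isProperSurface_smoothBand hq hε) (not_isOrientable_smoothBand hq hε))

lemma gammaFour_torusKnot_eq_one (hq : Odd q) (hε : ε = 1 ∨ ε = -1) :
    gammaFour (torusKnot (q * m + 2 * ε) q) = 1 := by
  have hmem : 1 ∈ {b | ∃ S : Set C2, IsProperSurface S ∧ ¬ IsOrientable S ∧
      S ∩ S3 = torusKnot (q * m + 2 * ε) q ∧ b = bettiOne S} :=
    ⟨smoothBand q m ε, isProperSurface_smoothBand hq hε, not_isOrientable_smoothBand hq hε,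
      smoothBand_inter_S3 hq hε, (bettiOne_smoothBand hq hε).symm⟩
  refine le_antisymm (Nat.sInf_le hmem) ?_
  obtain ⟨S, hS, hno, -, h⟩ := Nat.sInf_mem ⟨1, hmem⟩
  exact (one_le_bettiOne hS hno).trans_eq h.symm

lemma pinchNumber_eq_one_of_sameUpToMirror {a : ℕ} (hp : 1 < p) (hq : 1 < q) (hc : p.Coprime q)
    (hodd : Odd q) (hpq : Odd p → q < p) (ha : 3 ≤ a) (haodd : Odd a) (hε : ε = 1 ∨ ε = -1)
    (h : SameUpToMirror (torusKnot p q) (torusKnot (a * m + 2 * ε) a)) : pinchNumber p q = 1 := by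
  have hcop : IsCoprime (a * m + 2 * ε : ℤ) a := by
    have h2 : IsCoprime (2 : ℤ) a := by
      rw [show (2 : ℤ) = ((2 : ℕ) : ℤ) from rfl, Nat.isCoprime_iff_coprime]
      exact Nat.coprime_two_left.2 haodd
    have h2ε : IsCoprime (2 * ε) (a : ℤ) := by
      rcases hε with rfl | rfl
      · rwa [mul_one]
      · rw [mul_neg_one]; exact h2.neg_left
    rw [add_comm]
    exact h2ε.add_mul_left_left _
  have hm : a * m = 0 ∨ 3 ≤ a * m := by
    rcases Nat.eq_zero_or_pos m with rfl | h
    · left; simp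
    · right; nlinarith
  rcases natAbs_eq_of_sameUpToMirror (Nat.isCoprime_iff_coprime.2 hc) hcop (by positivity) h with
    ⟨h1, h2⟩ | ⟨h1, h2⟩
  · have hqa : q = a := by simpa using h2
    subst hqa
    rcases hm with hm | hm
    · -- `T(±2, q)`
      refine pinchNumber_eq_one (m := 0) (ε := 1) (by omega) ha hodd (Or.inl rfl) ?_
      have : (q * m : ℤ) = 0 := by exact_mod_cast hm
      omega
    · refine pinchNumber_eq_one (m := m) (ε := ε) (by omega) ha hodd hε ?_
      have : (3 : ℤ) ≤ q * m := by exact_mod_cast hm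
      omega
  · have hpa : p = a := by simpa using h1
    subst hpa
    have hlt := hpq haodd
    -- `q = |pm ± 2| < p` is odd, so that `m = 1`
    have hm1 : m = 1 ∧ ε = -1 := by
      rcases Nat.lt_or_ge m 2 with h | h
      · interval_cases m
        · obtain ⟨k, hk⟩ := hodd
          simp only [Nat.cast_zero, mul_zero, zero_add] at h2
          omega
        · simp only [Nat.cast_one, mul_one] at h2
          omega
      · have : p * 2 ≤ p * m := Nat.mul_le_mul_left p h
        have : (p * 2 : ℤ) ≤ p * m := by exact_mod_cast this
        omega
    obtain ⟨rfl, rfl⟩ := hm1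
    simp only [Nat.cast_one, mul_one] at h2
    refine pinchNumber_eq_one (m := 1) (ε := 1) (by omega) ?_ hodd (Or.inl rfl) ?_
    · obtain ⟨k, hk⟩ := hodd
      omega
    · push_cast
      omega

lemma isMobiusBand_pinchSurface_iff (hp : 1 < p) (hq : 1 < q) (hc : p.Coprime q) (hodd : Odd q)
    (hpq : Odd p → q < p) : IsMobiusBand (pinchSurface p q) ↔
      ∃ (a m : ℕ) (ε : ℤ), 3 ≤ a ∧ Odd a ∧ (ε = 1 ∨ ε = -1) ∧
        SameUpToMirror (torusKnot p q) (torusKnot (a * m + 2 * ε) a) := by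
  constructor
  · intro h
    have h1 := pinchNumber_le_one_of_isMobiusBand hodd hc h
    have h2 := pinchNumber_pos hq hodd hc
    obtain ⟨ε, hε, hpe⟩ := exists_eq_of_pinchNumber_eq_one hodd hc (by omega)
    refine ⟨q, (pinchIter p q 1).1, ε, ?_, hodd, hε, LinearIsometryEquiv.refl ℝ C2, ?_⟩
    · obtain ⟨k, hk⟩ := hodd
      omega
    · rw [← hpe]
      exact Set.image_id _
  · rintro ⟨a, m, ε, ha, haodd, hε, h⟩
    exact isMobiusBand_pinchSurface hodd hc
      (pinchNumber_eq_one_of_sameUpToMirror hp hq hc hodd hpq ha haodd hε h)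

end Genus

end TorusKnotMobius

theorem mainTheorem7 :
    (∀ p q : ℕ, 1 < p → 1 < q → p.Coprime q → Odd q → (Odd p → q < p) →
      (TorusKnotMobius.IsMobiusBand (TorusKnotMobius.pinchSurface p q) ↔
        ∃ (a m : ℕ) (ε : ℤ), 3 ≤ a ∧ Odd a ∧ (ε = 1 ∨ ε = -1) ∧
          TorusKnotMobius.SameUpToMirror (TorusKnotMobius.torusKnot p q)
            (TorusKnotMobius.torusKnot (a * m + 2 * ε) a))) ∧
    (∀ (q m : ℕ) (ε : ℤ), 3 ≤ q → Odd q → (ε = 1 ∨ ε = -1) →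
      TorusKnotMobius.gammaFour (TorusKnotMobius.torusKnot (q * m + 2 * ε) q) = 1) :=
  ⟨fun _ _ hp hq hc hodd hpq =>
      TorusKnotMobius.isMobiusBand_pinchSurface_iff hp hq hc hodd hpq,
    fun _ _ _ _ hq hε => TorusKnotMobius.gammaFour_torusKnot_eq_one hq hε⟩
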